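/- Let $\Bbbk$ be a field of characteristic $0$. For $n\ge 1$ write $\underline n=\{1,\dots,n\}$. A (graded) permutad over $\Bbbk$ is a family $A=\{A(n)\}_{n\ge1}$ of $\mathbb Z$-graded $\Bbbk$-vector spaces with degree-$0$ operations $\diamond_r\colon A(r_1)\otimes A(r_2)\to A(n)$, one for each surjection $r\colon\underline n\to\underline 2$ with fibres of cardinalities $r_1,r_2$, such that $\diamond_u(\diamond_v\otimes 1)=\diamond_t(1\otimes\diamond_s)$ whenever $u(v\times 1)=t(1\times s)$ as surjections onto $\underline 3$; here $s$ and $v$ are surjections to $\underline 2$ from the second fibre of $t$ and from the first fibre of $u$, identified order-preservingly with standard ordinals. A dg permutad has moreover a differential of degree $-1$ which is a derivation of all $\diamond_r$. Let $\mathbb P(B)$ be the free permutad on a collection $B$ of graded vector spaces. A binary quadratic permutad is a quotient $A=\mathbb P(V)/(S)$, where $V$ is a finite-dimensional space of generators in arity $1$ (and in a single degree) and $(S)$ is the ideal generated by a subspace $S\subset\mathbb P^2(V)=\bigoplus_{r\colon\underline 2\twoheadrightarrow\underline 2}V\otimes V$. Its Koszul dual is $A^!=\mathbb P({\uparrow}V^*)/(S^\perp)$.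 The dual bar construction $\mathbb D(A)$ of a permutad $A$ with finite-dimensional $A(n)$ is the free permutad on the desuspended component-wise linear dual ${\downarrow}A^*$ (duals taken degree-wise, so that $(A^*)_k=(A_k)^*$), with the derivation that on generators is $\partial({\downarrow}c)=\sum_r\sum(-1)^{|{\downarrow}c'|}\,{\downarrow}c'\diamond_r{\downarrow}c''$, where $r$ runs over all surjections $\underline n\to\underline 2$ and $\sum c'\otimes c''$ is the image of $c$ under the dual of $\diamond_r$. The permutad $A$ is Koszul if the canonical morphism of permutads $\mathbb D(A^!)\to A$, which extends the map ${\downarrow}(A^!)^*\twoheadrightarrow V\hookrightarrow A$, is a morphism of dg permutads to $(A,0)$ and induces an isomorphism on homology in each arity. Let $\mathrm{perAs}$ be the terminal permutad: $\mathrm{perAs}(n)=\Bbbk$ in degree $0$ for all $n\ge1$, all operations being the multiplication of $\Bbbk$. Let $P_n\subset\mathbb R^n$ be the permutohedron, the convex hull of all permutations of $(1,\dots,n)$, and let $CC_*(P)$ be the collection of the cellular chain complexes $CC_*(P_n)$ with coefficients in $\Bbbk$ of these polytopes (cells are the nonempty faces, oriented, with incidence numbers given by the outward-normal-first rule), with the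 operations induced by the facet embeddings $P_{r_1}\times P_{r_2}\hookrightarrow P_n$, for $r\colon\underline n\twoheadrightarrow\underline 2$, which put the coordinates of the first point in the positions of the first fibre of $r$ and those of the second point, increased by $r_1$, in the positions of the second fibre. **Theorem A.** (1) $\mathrm{perAs}$ is binary quadratic: it is isomorphic to $\mathbb P(\mu)/(S)$, with one generator $\mu$ of arity $1$ and degree $0$, and $S$ spanned by $\mu\diamond_{\mathrm{id}}\mu-\mu\diamond_{(21)}\mu$, where $\mathrm{id}$ and $(21)$ are the two bijections of $\underline 2$. (2) With $\mathrm{perAs}^!$ the Koszul dual of this presentation, $\mathbb D(\mathrm{perAs}^!)$ and $CC_*(P)$ are dg permutads, and they are isomorphic as dg permutads. (3) All $P_n$ are contractible, and $CC_*(P)$ is a minimal model of $\mathrm{perAs}$: its underlying graded permutad is free, with generators whose boundaries are decomposable (sums of products), and there is a morphism of dg permutads $CC_*(P)\to(\mathrm{perAs},0)$ which induces an isomorphism on homology in each arity. (4) $\mathrm{perAs}$, presented as in (1), is Koszul. -/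

import Mathlib

open scoped TensorProduct

universe u

/-! ## Surjections onto two and three elements -/

/-- A surjection `r : {1, …, n} → {1, 2}` whose fibres have `a` and `b` elements; equivalently an
`(a, b)`-shuffle. The two values are written `0` and `1`. Surjectivity is automatic, because `a`
and `b` are positive. -/
abbrev Shuffle (n a b : ℕ+) : Type :=
  {r : Fin n → Fin 2 // (Finset.univ.filter fun i => r i = 0).card = (a : ℕ) ∧
    (Finset.univ.filter fun i => r i = 1).card = (b : ℕ)}

/-- The position of `i` inside its own fibre, with respect to the natural order. -/
def fibreRank {n k : ℕ} (r : Fin n → Fin k) (i : Fin n) : ℕ :=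
  (Finset.univ.filter fun j => j < i ∧ r j = r i).card

theorem fibreRank_lt {n k : ℕ} (r : Fin n → Fin k) (i : Fin n) (c : Fin k) (h : r i = c) :
    fibreRank r i < (Finset.univ.filter fun j => r j = c).card := by
  subst h
  refine Finset.card_lt_card ⟨fun j hj => ?_, fun hs => ?_⟩
  · simp only [Finset.mem_filter, Finset.mem_univ, true_and] at hj ⊢
    exact hj.2
  · have := hs (show i ∈ Finset.univ.filter fun j => r j = r i by simp)
    simp at this

namespace Shuffle

variable {n a b : ℕ+}

/-- The order preserving identification of the first fibre with `{1, …, a}`. -/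
def idx₀ (r : Shuffle n a b) (i : Fin n) (h : r.1 i = 0) : Fin a :=
  ⟨fibreRank r.1 i, (fibreRank_lt r.1 i 0 h).trans_eq r.2.1⟩

/-- The order preserving identification of the second fibre with `{1, …, b}`. -/
def idx₁ (r : Shuffle n a b) (i : Fin n) (h : ¬ r.1 i = 0) : Fin b :=
  ⟨fibreRank r.1 i, (fibreRank_lt r.1 i 1 (by omega)).trans_eq r.2.2⟩

/-- The surjection `t(1 × s)` onto three elements. -/
def oneTimes {m a e b c : ℕ+} (t : Shuffle m a e) (s : Shuffle e b c) (j : Fin m) : Fin 3 :=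
  if h : t.1 j = 0 then 0 else (s.1 (t.idx₁ j h)).succ

/-- The surjection `u(v × 1)` onto three elements. -/
def timesOne {m f c a b : ℕ+} (u : Shuffle m f c) (v : Shuffle f a b) (j : Fin m) : Fin 3 :=
  if h : u.1 j = 0 then (v.1 (u.idx₀ j h)).castSucc else 2

end Shuffle

/-- A surjection onto two elements, of unspecified fibre sizes. -/
abbrev Surj₂ (n : ℕ+) : Type := {r : Fin n → Fin 2 // Function.Surjective r}

namespace Surj₂

/-- The cardinality of a fibre. -/
def fibre {n : ℕ+} (r : Surj₂ n) (c : Fin 2) : ℕ+ :=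
  ⟨(Finset.univ.filter fun i => r.1 i = c).card, by
    obtain ⟨i, hi⟩ := r.2 c
    exact Finset.card_pos.2 ⟨i, by simp [hi]⟩⟩

/-- A surjection onto two elements as a shuffle. -/
def toShuffle {n : ℕ+} (r : Surj₂ n) : Shuffle n (r.fibre 0) (r.fibre 1) := ⟨r.1, rfl, rfl⟩

end Surj₂

/-! ## Collections, permutads and differential graded permutads -/

/-- A collection of graded vector spaces: `X n p` is the degree `p` component in arity `n`. -/
structure Coll (K : Type u) [Field K] where
  X : ℕ+ → ℤ → Type u
  [acg : ∀ n p, AddCommGroup (X n p)]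
  [mod : ∀ n p, Module K (X n p)]

attribute [instance] Coll.acg Coll.mod

/-- A collection of graded vector spaces with a degree `0` operation `A(a) ⊗ A(b) → A(n)` for each
surjection `{1, …, n} → {1, 2}` with fibres of sizes `a` and `b`. The associativity axiom is
`PrePermutad.IsPermutad`. -/
structure PrePermutad (K : Type u) [Field K] extends Coll K where
  op : ∀ {n a b : ℕ+} (_ : Shuffle n a b) {p q s : ℤ} (_ : p + q = s),
    X a p →ₗ[K] X b q →ₗ[K] X n s

/-- A `PrePermutad` with degree `-1` linear maps `d : A(n) → A(n)`. The axioms of a differential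
graded permutad are `PreDGPermutad.IsDGPermutad`. -/
structure PreDGPermutad (K : Type u) [Field K] extends PrePermutad K where
  d : ∀ {n : ℕ+} {p q : ℤ} (_ : q + 1 = p), X n p →ₗ[K] X n q

section Basics

variable {K : Type u} [Field K]

namespace PrePermutad

/-- The axiom of a (graded) permutad: `(x ⋄_v y) ⋄_u z = x ⋄_t (y ⋄_s z)` whenever
`t(1 × s) = u(v × 1)`. -/
def IsPermutad (A : PrePermutad K) : Prop :=
  ∀ {m a b c e f : ℕ+} (t : Shuffle m a e) (s : Shuffle e b c) (u : Shuffle m f c)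
    (v : Shuffle f a b), t.oneTimes s = u.timesOne v →
    ∀ {i j k ij jk l : ℤ} (hij : i + j = ij) (hjk : j + k = jk) (h : ij + k = l)
      (h' : i + jk = l) (x : A.X a i) (y : A.X b j) (z : A.X c k),
      A.op u h (A.op v hij x y) z = A.op t h' x (A.op s hjk y z)

/-- A morphism of graded permutads: degree `0` linear maps which preserve the operations. -/
structure Hom (A B : PrePermutad K) where
  map : ∀ n p, A.X n p →ₗ[K] B.X n p
  map_op : ∀ {n a b : ℕ+} (r : Shuffle n a b) {p q s : ℤ} (h : p + q = s) (x : A.X a p)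
    (y : A.X b q), map n s (A.op r h x y) = B.op r h (map a p x) (map b q y)

/-- An isomorphism is a morphism which is bijective in each arity and degree. -/
def Hom.IsIso {A B : PrePermutad K} (f : Hom A B) : Prop :=
  ∀ n p, Function.Bijective (f.map n p)

/-- The decomposable elements: the linear span of all products. -/
def decomposables (A : PrePermutad K) (n : ℕ+) (s : ℤ) : Submodule K (A.X n s) :=
  Submodule.span K {w | ∃ (a b : ℕ+) (r : Shuffle n a b) (p q : ℤ) (h : p + q = s)
    (x : A.X a p) (y : A.X b q), w = A.op r h x y}

/-- A permutadic ideal. -/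
structure IsIdeal (A : PrePermutad K) (I : ∀ n p, Submodule K (A.X n p)) : Prop where
  left : ∀ {n a b : ℕ+} (r : Shuffle n a b) {p q s : ℤ} (h : p + q = s) (x : A.X a p)
    (y : A.X b q), x ∈ I a p → A.op r h x y ∈ I n s
  right : ∀ {n a b : ℕ+} (r : Shuffle n a b) {p q s : ℤ} (h : p + q = s) (x : A.X a p)
    (y : A.X b q), y ∈ I b q → A.op r h x y ∈ I n s

/-- The ideal generated by a family `R` of sets of homogeneous elements: the intersection of all
ideals which contain `R`. -/
def idealSpan (A : PrePermutad K) (R : ∀ n p, A.X n p → Prop) (n : ℕ+) (p : ℤ) :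
    Submodule K (A.X n p) :=
  sInf {J | ∃ I, A.IsIdeal I ∧ (∀ n p x, R n p x → x ∈ I n p) ∧ J = I n p}

theorem isIdeal_idealSpan (A : PrePermutad K) (R : ∀ n p, A.X n p → Prop) :
    A.IsIdeal (A.idealSpan R) where
  left r _ _ _ h x y hx := by
    simp only [idealSpan, Submodule.mem_sInf] at hx ⊢
    rintro _ ⟨I, hI, hR, rfl⟩
    exact hI.left r h x y (hx _ ⟨I, hI, hR, rfl⟩)
  right r _ _ _ h x y hx := by
    simp only [idealSpan, Submodule.mem_sInf] at hx ⊢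
    rintro _ ⟨I, hI, hR, rfl⟩
    exact hI.right r h x y (hx _ ⟨I, hI, hR, rfl⟩)

/-- The quotient of a permutad by an ideal. -/
def quotient (A : PrePermutad K) (I : ∀ n p, Submodule K (A.X n p)) (hI : A.IsIdeal I) :
    PrePermutad K where
  X n p := A.X n p ⧸ I n p
  op {n a b} r {p q s} h :=
    (I a p).liftQ
      { toFun := fun x => (I b q).mapQ (I n s) (A.op r h x) fun y hy => hI.right r h x y hy
        map_add' := fun x x' => by
          refine Submodule.linearMap_qext _ (LinearMap.ext fun y => ?_)
          simp
        map_smul' := fun c x => by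
          refine Submodule.linearMap_qext _ (LinearMap.ext fun y => ?_)
          simp }
      fun x hx => by
        rw [LinearMap.mem_ker]
        refine Submodule.linearMap_qext _ (LinearMap.ext fun y => ?_)
        simpa using hI.left r h x y hx

theorem quotient_isPermutad {A : PrePermutad K} (hA : A.IsPermutad)
    {I : ∀ n p, Submodule K (A.X n p)} (hI : A.IsIdeal I) : (A.quotient I hI).IsPermutad := by
  intro m a b c e f t s u v huv i j k ij jk l hij hjk h h' x y z
  obtain ⟨x, rfl⟩ := (I a i).mkQ_surjective x
  obtain ⟨y, rfl⟩ := (I b j).mkQ_surjective y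
  obtain ⟨z, rfl⟩ := (I c k).mkQ_surjective z
  exact congrArg (I m l).mkQ (hA t s u v huv hij hjk h h' x y z)

/-- A graded permutad, regarded as a differential graded permutad with zero differential. -/
def toDG (A : PrePermutad K) : PreDGPermutad K where
  toPrePermutad := A
  d _ := 0

end PrePermutad

namespace PreDGPermutad

/-- The axioms of a differential graded permutad: associativity, `d² = 0`, and `d` is a degree `-1`
derivation. -/
structure IsDGPermutad (A : PreDGPermutad K) : Prop where
  assoc : A.toPrePermutad.IsPermutad
  d_d : ∀ {n : ℕ+} {p q s : ℤ} (h : q + 1 = p) (h' : s + 1 = q) (x : A.X n p),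
    A.d h' (A.d h x) = 0
  leibniz : ∀ {n a b : ℕ+} (r : Shuffle n a b) {p q s s' p' q' : ℤ} (h : p + q = s)
    (hs : s' + 1 = s) (hp : p' + 1 = p) (hq : q' + 1 = q) (h₁ : p' + q = s') (h₂ : p + q' = s')
    (x : A.X a p) (y : A.X b q),
    A.d hs (A.op r h x y) =
      A.op r h₁ (A.d hp x) y + ((-1 : K) ^ p) • A.op r h₂ x (A.d hq y)

/-- A morphism of the underlying graded permutads commutes with the differentials. -/
def IsDGHom (A B : PreDGPermutad K) (f : PrePermutad.Hom A.toPrePermutad B.toPrePermutad) :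
    Prop :=
  ∀ (n : ℕ+) {p q : ℤ} (h : q + 1 = p) (x : A.X n p), f.map n q (A.d h x) = B.d h (f.map n p x)

/-- A chain map induces a bijection on the homology in each arity and degree. The first clause is
surjectivity, the second one injectivity. -/
def IsQuasiIso (A B : PreDGPermutad K) (f : PrePermutad.Hom A.toPrePermutad B.toPrePermutad) :
    Prop :=
  ∀ (n : ℕ+) {p q s : ℤ} (hq : q + 1 = p) (hs : p + 1 = s),
    (∀ y : B.X n p, B.d hq y = 0 →
      ∃ x : A.X n p, A.d hq x = 0 ∧ ∃ z : B.X n s, f.map n p x - y = B.d hs z) ∧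
    (∀ x : A.X n p, A.d hq x = 0 → (∃ z : B.X n s, f.map n p x = B.d hs z) →
      ∃ w : A.X n s, x = A.d hs w)

/-- Isomorphism of differential graded permutads. -/
def Isomorphic (A B : PreDGPermutad K) : Prop :=
  ∃ f : PrePermutad.Hom A.toPrePermutad B.toPrePermutad, f.IsIso ∧ IsDGHom A B f

end PreDGPermutad

end Basics

/-! ## The free permutad -/

section Free

variable {K : Type u} [Field K]

/-- Formal expressions in the elements of `B`, the operations of a permutad, and the operations of a
vector space. -/
inductive FreePermutad.Pre (B : Coll K) : ℕ+ → ℤ → Type u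
  | of {n : ℕ+} {p : ℤ} (b : B.X n p) : Pre B n p
  | op {n a b : ℕ+} (r : Shuffle n a b) {p q s : ℤ} (h : p + q = s) (x : Pre B a p)
      (y : Pre B b q) : Pre B n s
  | zero {n : ℕ+} {p : ℤ} : Pre B n p
  | add {n : ℕ+} {p : ℤ} (x y : Pre B n p) : Pre B n p
  | smul {n : ℕ+} {p : ℤ} (c : K) (x : Pre B n p) : Pre B n p

namespace FreePermutad

open Pre

/-- The relations which hold between formal expressions in every permutad. -/
inductive Rel (B : Coll K) : ∀ (n : ℕ+) (p : ℤ), Pre B n p → Pre B n p → Prop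
  -- the inclusion of `B` is linear
  | of_add {n p} (b b' : B.X n p) : Rel B n p (of (b + b')) (add (of b) (of b'))
  | of_smul {n p} (c : K) (b : B.X n p) : Rel B n p (of (c • b)) (smul c (of b))
  -- vector space axioms
  | add_comm {n p} (x y : Pre B n p) : Rel B n p (add x y) (add y x)
  | add_assoc {n p} (x y z : Pre B n p) : Rel B n p (add (add x y) z) (add x (add y z))
  | zero_add {n p} (x : Pre B n p) : Rel B n p (add zero x) x
  | zero_smul {n p} (x : Pre B n p) : Rel B n p (smul 0 x) zero
  | one_smul {n p} (x : Pre B n p) : Rel B n p (smul 1 x) x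
  | mul_smul {n p} (c c' : K) (x : Pre B n p) : Rel B n p (smul (c * c') x) (smul c (smul c' x))
  | add_smul {n p} (c c' : K) (x : Pre B n p) :
      Rel B n p (smul (c + c') x) (add (smul c x) (smul c' x))
  | smul_add {n p} (c : K) (x y : Pre B n p) :
      Rel B n p (smul c (add x y)) (add (smul c x) (smul c y))
  -- the operations are bilinear
  | op_add_left {n a b} (r : Shuffle n a b) {p q s} (h : p + q = s) (x x' : Pre B a p)
      (y : Pre B b q) : Rel B n s (op r h (add x x') y) (add (op r h x y) (op r h x' y))
  | op_smul_left {n a b} (r : Shuffle n a b) {p q s} (h : p + q = s) (c : K) (x : Pre B a p)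
      (y : Pre B b q) : Rel B n s (op r h (smul c x) y) (smul c (op r h x y))
  | op_add_right {n a b} (r : Shuffle n a b) {p q s} (h : p + q = s) (x : Pre B a p)
      (y y' : Pre B b q) : Rel B n s (op r h x (add y y')) (add (op r h x y) (op r h x y'))
  | op_smul_right {n a b} (r : Shuffle n a b) {p q s} (h : p + q = s) (c : K) (x : Pre B a p)
      (y : Pre B b q) : Rel B n s (op r h x (smul c y)) (smul c (op r h x y))
  -- the permutad axiom
  | assoc {m a b c e f} (t : Shuffle m a e) (s : Shuffle e b c) (w : Shuffle m f c)
      (v : Shuffle f a b) (huv : t.oneTimes s = w.timesOne v)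
      {i j k ij jk l} (hij : i + j = ij) (hjk : j + k = jk) (h : ij + k = l) (h' : i + jk = l)
      (x : Pre B a i) (y : Pre B b j) (z : Pre B c k) :
      Rel B m l (op w h (op v hij x y) z) (op t h' x (op s hjk y z))
  -- compatibility with all operations
  | congr_add_left {n p} {x x' : Pre B n p} (y : Pre B n p) :
      Rel B n p x x' → Rel B n p (add x y) (add x' y)
  | congr_add_right {n p} (x : Pre B n p) {y y' : Pre B n p} :
      Rel B n p y y' → Rel B n p (add x y) (add x y')
  | congr_smul {n p} (c : K) {x x' : Pre B n p} :
      Rel B n p x x' → Rel B n p (smul c x) (smul c x')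
  | congr_op_left {n a b} (r : Shuffle n a b) {p q s} (h : p + q = s) {x x' : Pre B a p}
      (y : Pre B b q) : Rel B a p x x' → Rel B n s (op r h x y) (op r h x' y)
  | congr_op_right {n a b} (r : Shuffle n a b) {p q s} (h : p + q = s) (x : Pre B a p)
      {y y' : Pre B b q} : Rel B b q y y' → Rel B n s (op r h x y) (op r h x y')

/-- The underlying graded vector spaces of the free permutad on `B`. -/
def Carrier (B : Coll K) (n : ℕ+) (p : ℤ) : Type u := Quot (Rel B n p)

variable {B : Coll K}

instance (n : ℕ+) (p : ℤ) : Add (Carrier B n p) where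
  add := Quot.map₂ add (fun x _ _ h => Rel.congr_add_right x h)
    (fun _ _ y h => Rel.congr_add_left y h)

instance (n : ℕ+) (p : ℤ) : Zero (Carrier B n p) where
  zero := Quot.mk _ zero

instance (n : ℕ+) (p : ℤ) : AddCommMonoid (Carrier B n p) where
  nsmul := nsmulRec
  add_assoc := by
    rintro ⟨x⟩ ⟨y⟩ ⟨z⟩
    exact Quot.sound (Rel.add_assoc x y z)
  add_comm := by
    rintro ⟨x⟩ ⟨y⟩
    exact Quot.sound (Rel.add_comm x y)
  zero_add := by
    rintro ⟨x⟩
    exact Quot.sound (Rel.zero_add x)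
  add_zero := by
    rintro ⟨x⟩
    exact (Quot.sound (Rel.add_comm x zero)).trans (Quot.sound (Rel.zero_add x))

instance (n : ℕ+) (p : ℤ) : SMul K (Carrier B n p) where
  smul c := Quot.map (smul c) fun _ _ h => Rel.congr_smul c h

theorem smul_zero_aux (n : ℕ+) (p : ℤ) (c : K) : c • (0 : Carrier B n p) = 0 := by
  have h0 : (0 : Carrier B n p) = (0 : K) • (0 : Carrier B n p) :=
    (Quot.sound (Rel.zero_smul (B := B) zero)).symm
  have h1 : c • ((0 : K) • (0 : Carrier B n p)) = (c * 0) • (0 : Carrier B n p) :=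
    (Quot.sound (Rel.mul_smul (B := B) c 0 zero)).symm
  rw [h0, h1, mul_zero]

instance (n : ℕ+) (p : ℤ) : Module K (Carrier B n p) where
  one_smul := by
    rintro ⟨x⟩
    exact Quot.sound (Rel.one_smul x)
  mul_smul := by
    rintro c c' ⟨x⟩
    exact Quot.sound (Rel.mul_smul c c' x)
  smul_zero := smul_zero_aux n p
  smul_add := by
    rintro c ⟨x⟩ ⟨y⟩
    exact Quot.sound (Rel.smul_add c x y)
  add_smul := by
    rintro c c' ⟨x⟩
    exact Quot.sound (Rel.add_smul c c' x)
  zero_smul := by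
    rintro ⟨x⟩
    exact Quot.sound (Rel.zero_smul x)

instance (n : ℕ+) (p : ℤ) : AddCommGroup (Carrier B n p) :=
  Module.addCommMonoidToAddCommGroup K

end FreePermutad

open FreePermutad

/-- The free permutad `ℙ(B)` on a collection `B` of graded vector spaces: formal expressions modulo
the relations which hold in every permutad. Its universal property is `FreePermutad.lift` with
`FreePermutad.lift_ι` and `FreePermutad.hom_ext`. -/
def freePermutad (B : Coll K) : PrePermutad K where
  X := Carrier B
  op {n a b} r {p q s} h := LinearMap.mk₂ K
    (Quot.map₂ (Pre.op r h) (fun x _ _ hy => Rel.congr_op_right r h x hy)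
      (fun _ _ y hx => Rel.congr_op_left r h y hx))
    (by
      rintro ⟨x⟩ ⟨x'⟩ ⟨y⟩
      exact Quot.sound (Rel.op_add_left r h x x' y))
    (by
      rintro c ⟨x⟩ ⟨y⟩
      exact Quot.sound (Rel.op_smul_left r h c x y))
    (by
      rintro ⟨x⟩ ⟨y⟩ ⟨y'⟩
      exact Quot.sound (Rel.op_add_right r h x y y'))
    (by
      rintro c ⟨x⟩ ⟨y⟩
      exact Quot.sound (Rel.op_smul_right r h c x y))

namespace FreePermutad

theorem isPermutad (B : Coll K) : (freePermutad B).IsPermutad := by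
  rintro m a b c e f t s u v huv i j k ij jk l hij hjk h h' ⟨x⟩ ⟨y⟩ ⟨z⟩
  exact Quot.sound (Rel.assoc t s u v huv hij hjk h h' x y z)

/-- The element of the free permutad which a formal expression represents. -/
def mk {B : Coll K} {n : ℕ+} {p : ℤ} (x : Pre B n p) : (freePermutad B).X n p := Quot.mk _ x

theorem mk_add {B : Coll K} {n : ℕ+} {p : ℤ} (x y : Pre B n p) :
    mk (Pre.add x y) = mk x + mk y := rfl

theorem mk_smul {B : Coll K} {n : ℕ+} {p : ℤ} (c : K) (x : Pre B n p) :
    mk (Pre.smul c x) = c • mk x := rfl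

theorem mk_op {B : Coll K} {n a b : ℕ+} (r : Shuffle n a b) {p q s : ℤ} (h : p + q = s)
    (x : Pre B a p) (y : Pre B b q) :
    mk (Pre.op r h x y) = (freePermutad B).op r h (mk x) (mk y) := rfl

/-- The inclusion of the generators. -/
def ι (B : Coll K) (n : ℕ+) (p : ℤ) : B.X n p →ₗ[K] (freePermutad B).X n p where
  toFun b := Quot.mk _ (Pre.of b)
  map_add' b b' := Quot.sound (Rel.of_add b b')
  map_smul' c b := Quot.sound (Rel.of_smul c b)

variable {B : Coll K}

/-- The value of a formal expression in a permutad. -/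
def evalPre (A : PrePermutad K) (f : ∀ n p, B.X n p →ₗ[K] A.X n p) :
    ∀ {n : ℕ+} {p : ℤ}, Pre B n p → A.X n p
  | _, _, .of b => f _ _ b
  | _, _, .op r h x y => A.op r h (evalPre A f x) (evalPre A f y)
  | _, _, .zero => 0
  | _, _, .add x y => evalPre A f x + evalPre A f y
  | _, _, .smul c x => c • evalPre A f x

theorem evalPre_rel (A : PrePermutad K) (hA : A.IsPermutad)
    (f : ∀ n p, B.X n p →ₗ[K] A.X n p) {n : ℕ+} {p : ℤ} {x y : Pre B n p}
    (h : Rel B n p x y) : evalPre A f x = evalPre A f y := by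
  induction h with
  | add_comm => simp only [evalPre]; exact _root_.add_comm _ _
  | add_assoc => simp only [evalPre]; exact _root_.add_assoc _ _ _
  | mul_smul => simp only [evalPre]; exact SemigroupAction.mul_smul _ _ _
  | add_smul => simp only [evalPre]; exact _root_.add_smul _ _ _
  | assoc t s u v huv hij hjk h h' x y z => exact hA t s u v huv hij hjk h h' _ _ _
  | _ => simp_all [evalPre]

/-- The morphism of permutads which extends a morphism `f` of collections. -/
def lift (A : PrePermutad K) (hA : A.IsPermutad) (f : ∀ n p, B.X n p →ₗ[K] A.X n p) :
    PrePermutad.Hom (freePermutad B) A where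
  map n p :=
    { toFun := Quot.lift (evalPre A f) fun _ _ h => evalPre_rel A hA f h
      map_add' := by
        rintro ⟨x⟩ ⟨y⟩
        rfl
      map_smul' := by
        rintro c ⟨x⟩
        rfl }
  map_op := by
    rintro n a b r p q s h ⟨x⟩ ⟨y⟩
    rfl

theorem lift_ι (A : PrePermutad K) (hA : A.IsPermutad) (f : ∀ n p, B.X n p →ₗ[K] A.X n p)
    (n : ℕ+) (p : ℤ) (b : B.X n p) : (lift A hA f).map n p (ι B n p b) = f n p b := rfl

theorem hom_ext {A : PrePermutad K} (g g' : PrePermutad.Hom (freePermutad B) A)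
    (h : ∀ n p b, g.map n p (ι B n p b) = g'.map n p (ι B n p b)) (n : ℕ+) (p : ℤ)
    (x : (freePermutad B).X n p) : g.map n p x = g'.map n p x := by
  have key : ∀ {n : ℕ+} {p : ℤ} (x : Pre B n p), g.map n p (mk x) = g'.map n p (mk x) := by
    intro n p x
    induction x with
    | of b => exact h _ _ b
    | op r hpq x y hx hy =>
      have := g.map_op r hpq (mk x) (mk y)
      rw [hx, hy] at this
      exact this.trans (g'.map_op r hpq (mk x) (mk y)).symm
    | zero => exact (map_zero (g.map _ _)).trans (map_zero (g'.map _ _)).symm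
    | add x y hx hy =>
      have := map_add (g.map _ _) (mk x) (mk y)
      rw [hx, hy] at this
      exact this.trans (map_add (g'.map _ _) (mk x) (mk y)).symm
    | smul c x hx =>
      have := map_smul (g.map _ _) c (mk x)
      rw [hx] at this
      exact this.trans (map_smul (g'.map _ _) c (mk x)).symm
  obtain ⟨x⟩ := x
  exact key x

/-- The value of a degree `-1` derivation on a formal expression, given its values `σ` on the
generators. -/
def derivPre (σ : ∀ (n : ℕ+) {p q : ℤ}, q + 1 = p → B.X n p →ₗ[K] (freePermutad B).X n q) :
    ∀ {n : ℕ+} {p : ℤ}, Pre B n p → ∀ {q : ℤ}, q + 1 = p → (freePermutad B).X n q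
  | _, _, .of b, _, h => σ _ h b
  | _, _, .op r (p := p) (q := q) h x y, _, hs =>
      (freePermutad B).op r (p := p - 1) (q := q) (by omega)
          (derivPre σ x (by omega)) (mk y) +
        ((-1 : K) ^ p) • (freePermutad B).op r (p := p) (q := q - 1) (by omega)
          (mk x) (derivPre σ y (by omega))
  | _, _, .zero, _, _ => 0
  | _, _, .add x y, _, h => derivPre σ x h + derivPre σ y h
  | _, _, .smul c x, _, h => c • derivPre σ x h

theorem derivPre_rel
    (σ : ∀ (n : ℕ+) {p q : ℤ}, q + 1 = p → B.X n p →ₗ[K] (freePermutad B).X n q)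
    {n : ℕ+} {p : ℤ} {x y : Pre B n p} (hxy : Rel B n p x y) {q : ℤ} (h : q + 1 = p) :
    derivPre σ x h = derivPre σ y h := by
  induction hxy generalizing q with
  | of_add b b' => exact map_add _ _ _
  | of_smul c b => exact map_smul _ _ _
  | add_comm => simp only [derivPre]; exact _root_.add_comm _ _
  | add_assoc => simp only [derivPre]; exact _root_.add_assoc _ _ _
  | mul_smul => simp only [derivPre]; exact SemigroupAction.mul_smul _ _ _
  | add_smul => simp only [derivPre]; exact _root_.add_smul _ _ _
  | zero_add => simp only [derivPre]; exact _root_.zero_add _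
  | zero_smul => simp only [derivPre]; exact _root_.zero_smul _ _
  | one_smul => simp only [derivPre]; exact _root_.one_smul _ _
  | smul_add => simp only [derivPre]; exact _root_.smul_add _ _ _
  | op_add_left r h x x' y =>
    simp only [derivPre, mk_add, map_add, LinearMap.add_apply, _root_.smul_add]
    abel
  | op_smul_left r h c x y =>
    simp only [derivPre, mk_smul, map_smul, LinearMap.smul_apply, _root_.smul_add]
    rw [smul_comm c]
  | op_add_right r h x y y' =>
    simp only [derivPre, mk_add, map_add, _root_.smul_add]
    abel
  | op_smul_right r h c x y =>
    simp only [derivPre, mk_smul, map_smul, _root_.smul_add]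
    rw [smul_comm c]
  | @assoc m a b c e f t s u v huv i j k ij jk l hij hjk h h' x y z =>
    subst hij hjk
    simp only [derivPre, mk_op, map_add, map_smul, LinearMap.add_apply, LinearMap.smul_apply,
      _root_.smul_add]
    rw [isPermutad B t s u v huv _ rfl _ (by omega),
      isPermutad B t s u v huv (jk := j + k - 1) _ (by omega) _ (by omega),
      isPermutad B t s u v huv (jk := j + k - 1) _ (by omega) _ (by omega),
      _root_.add_assoc, smul_smul, zpow_add₀ (neg_ne_zero.2 one_ne_zero)]
  | congr_add_left y _ ih => simp only [derivPre, ih]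
  | congr_add_right x _ ih => simp only [derivPre, ih]
  | congr_smul c _ ih => simp only [derivPre, ih]
  | congr_op_left r h y hx ih =>
    simp only [derivPre, ih]
    rw [show mk _ = mk _ from Quot.sound hx]
  | congr_op_right r h x hy ih =>
    simp only [derivPre, ih]
    rw [show mk _ = mk _ from Quot.sound hy]

/-- The degree `-1` derivation of the free permutad which extends `σ`. -/
def deriv (σ : ∀ (n : ℕ+) {p q : ℤ}, q + 1 = p → B.X n p →ₗ[K] (freePermutad B).X n q)
    {n : ℕ+} {p q : ℤ} (h : q + 1 = p) : (freePermutad B).X n p →ₗ[K] (freePermutad B).X n q where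
  toFun := Quot.lift (fun x => derivPre σ x h) fun _ _ hxy => derivPre_rel σ hxy h
  map_add' := by
    rintro ⟨x⟩ ⟨y⟩
    rfl
  map_smul' := by
    rintro c ⟨x⟩
    rfl

end FreePermutad

end Free

/-! ## The cobar construction and the dual bar construction -/

/-- A collection of graded vector spaces with degree `0` cooperations
`C(n) → C(a) ⊗ C(b)`, given by their components in each bidegree. -/
structure PreCopermutad (K : Type u) [Field K] extends Coll K where
  coop : ∀ {n a b : ℕ+} (_ : Shuffle n a b) {p q s : ℤ} (_ : p + q = s),
    X n s →ₗ[K] X a p ⊗[K] X b q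

section Bar

variable {K : Type u} [Field K]

open Classical in
/-- The component-wise (and degree-wise) linear dual. It is meant for a permutad with finite
dimensional components, for which `(A(a) ⊗ A(b))* = A(a)* ⊗ A(b)*`. -/
noncomputable def PrePermutad.dual (A : PrePermutad K) : PreCopermutad K where
  X n p := Module.Dual K (A.X n p)
  coop {_ a b} r {p q _} h :=
    if hf : Module.Finite K (A.X a p) ∧ Module.Finite K (A.X b q) then
      haveI := hf.1
      haveI := hf.2
      (TensorProduct.dualDistribEquiv K (A.X a p) (A.X b q)).symm.toLinearMap ∘ₗ
        (TensorProduct.lift (A.op r h)).dualMap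
    else 0

/-- The desuspension `↓C`: its degree `p` component is the degree `p + 1` component of `C`. -/
def Coll.desuspension (C : Coll K) : Coll K where
  X n p := C.X n (p + 1)

namespace PreCopermutad

/-- The product `↓c' ⊗ ↓c'' ↦ ↓c' ⋄_r ↓c''` of two generators in the free permutad on `↓C`. -/
noncomputable def mulGen (C : PreCopermutad K) {n a b : ℕ+} (r : Shuffle n a b) {i j q : ℤ}
    (h : i + j = q) :
    C.X a (i + 1) ⊗[K] C.X b (j + 1) →ₗ[K] (freePermutad C.toColl.desuspension).X n q :=
  TensorProduct.lift (((freePermutad C.toColl.desuspension).op r h).compl₁₂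
    (FreePermutad.ι C.toColl.desuspension a i) (FreePermutad.ι C.toColl.desuspension b j))

/-- The differential of the cobar construction on the generators:
`↓c ↦ ∑ (-1)^|↓c'| ↓c' ⋄_r ↓c''`, where `r` runs over all surjections onto two elements and
`δ_r c = ∑ c' ⊗ c''`. The sum over the degree `i` of `↓c'` has only finitely many nonzero terms
when the components of `C` are finite dimensional, or of finite type and bounded on one side. -/
noncomputable def sigma (C : PreCopermutad K) (n : ℕ+) {p q : ℤ} (h : q + 1 = p) :
    C.toColl.desuspension.X n p →ₗ[K] (freePermutad C.toColl.desuspension).X n q :=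
  ∑ r : Surj₂ n, ∑ᶠ i : ℤ, ((-1 : K) ^ i) •
    (C.mulGen r.toShuffle (i := i) (j := q - i) (by omega) ∘ₗ
      C.coop r.toShuffle (p := i + 1) (q := q - i + 1) (s := p + 1) (by omega))

/-- The cobar construction: the free permutad on `↓C`, with the derivation which extends
`sigma`. -/
noncomputable def cobar (C : PreCopermutad K) : PreDGPermutad K where
  toPrePermutad := freePermutad C.toColl.desuspension
  d h := FreePermutad.deriv C.sigma h

end PreCopermutad

/-- The dual bar construction `𝔻(A)`: the cobar construction of the linear dual of `A`. -/
noncomputable def PrePermutad.dualBar (A : PrePermutad K) : PreDGPermutad K := A.dual.cobar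

end Bar

/-! ## Binary quadratic permutads, Koszul duals and Koszulity -/

section Quadratic

variable {K : Type u} [Field K]

/-- The subspace of `V` which is all of `V` when `P` holds, and zero otherwise. -/
def conc (K : Type u) [Field K] (V : Type u) [AddCommGroup V] [Module K V] (P : Prop) :
    Submodule K V where
  carrier := {v | ¬P → v = 0}
  add_mem' hv hw hP := by rw [hv hP, hw hP, add_zero]
  zero_mem' _ := rfl
  smul_mem' c v hv hP := by rw [hv hP, smul_zero]

open Classical in
/-- The identity of `V` when `P` holds, and zero otherwise. -/
noncomputable def toConc (K : Type u) [Field K] (V : Type u) [AddCommGroup V] [Module K V]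
    (P : Prop) : V →ₗ[K] conc K V P :=
  if h : P then LinearMap.codRestrict (conc K V P) LinearMap.id fun _ hP => absurd h hP else 0

/-- The collection with `V` in arity `1` and degree `q`, and zero elsewhere. -/
def Coll.single (K : Type u) [Field K] (V : Type u) [AddCommGroup V] [Module K V] (q : ℤ) :
    Coll K where
  X n p := conc K V (n = 1 ∧ p = q)

/-- A presentation of a binary quadratic permutad: a finite dimensional space `V` of generators of
arity `1`, placed in degree `deg`, and a space `S` of relations in
`ℙ²(V)(2) = ⨁_r V ⊗ V`, where `r` runs over the two surjections `{1, 2} → {1, 2}`. -/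
structure BinaryQuadratic (K : Type u) [Field K] where
  V : Type u
  [acg : AddCommGroup V]
  [mod : Module K V]
  [fin : Module.Finite K V]
  deg : ℤ
  S : Submodule K (Shuffle 2 1 1 → V ⊗[K] V)

attribute [instance] BinaryQuadratic.acg BinaryQuadratic.mod BinaryQuadratic.fin

namespace BinaryQuadratic

variable (Q : BinaryQuadratic K)

/-- The free permutad `ℙ(V)` on the generators. -/
abbrev free : PrePermutad K := freePermutad (Coll.single K Q.V Q.deg)

/-- The map `V → ℙ(V)(n)` to degree `p`: the inclusion of the generators when `n = 1` and
`p = deg`, and zero otherwise. -/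
noncomputable def freeGen (n : ℕ+) (p : ℤ) : Q.V →ₗ[K] Q.free.X n p :=
  FreePermutad.ι (Coll.single K Q.V Q.deg) n p ∘ₗ toConc K Q.V (n = 1 ∧ p = Q.deg)

/-- The element of `ℙ(V)(2)` which corresponds to an element of `⨁_r V ⊗ V`. -/
noncomputable def ofQuad (x : Shuffle 2 1 1 → Q.V ⊗[K] Q.V) : Q.free.X 2 (Q.deg + Q.deg) :=
  ∑ r : Shuffle 2 1 1, TensorProduct.lift
    ((Q.free.op r (p := Q.deg) (q := Q.deg) rfl).compl₁₂ (Q.freeGen 1 Q.deg)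
      (Q.freeGen 1 Q.deg)) (x r)

/-- The relations, as elements of `ℙ(V)`. -/
inductive IsRelation : ∀ (n : ℕ+) (p : ℤ), Q.free.X n p → Prop
  | mk (x : Shuffle 2 1 1 → Q.V ⊗[K] Q.V) (hx : x ∈ Q.S) :
      IsRelation 2 (Q.deg + Q.deg) (Q.ofQuad x)

/-- The binary quadratic permutad `ℙ(V)/(S)`. -/
def permutad : PrePermutad K :=
  Q.free.quotient (Q.free.idealSpan Q.IsRelation) (Q.free.isIdeal_idealSpan Q.IsRelation)

theorem isPermutad : Q.permutad.IsPermutad :=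
  PrePermutad.quotient_isPermutad (FreePermutad.isPermutad _) _

/-- The map `V → (ℙ(V)/(S))(n)` to degree `p`: the class of a generator when `n = 1` and
`p = deg`, and zero otherwise. -/
noncomputable def gen (n : ℕ+) (p : ℤ) : Q.V →ₗ[K] Q.permutad.X n p :=
  (Q.free.idealSpan Q.IsRelation n p).mkQ ∘ₗ Q.freeGen n p

/-- The pairing `⟨(f_r ⊗ g_r)_r, (x_r ⊗ y_r)_r⟩ = ∑_r f_r(x_r) g_r(y_r)`. -/
noncomputable def pairing (φ : Shuffle 2 1 1 → Module.Dual K Q.V ⊗[K] Module.Dual K Q.V)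
    (x : Shuffle 2 1 1 → Q.V ⊗[K] Q.V) : K :=
  ∑ r : Shuffle 2 1 1, TensorProduct.dualDistrib K Q.V Q.V (φ r) (x r)

/-- The annihilator of the relations. -/
noncomputable def annihilator :
    Submodule K (Shuffle 2 1 1 → Module.Dual K Q.V ⊗[K] Module.Dual K Q.V) where
  carrier := {φ | ∀ x ∈ Q.S, Q.pairing φ x = 0}
  add_mem' hφ hψ x hx := by
    have h1 := hφ x hx
    have h2 := hψ x hx
    simp only [pairing] at h1 h2 ⊢
    simp [Finset.sum_add_distrib, h1, h2]
  zero_mem' x _ := by simp [pairing]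
  smul_mem' c φ hφ x hx := by
    have h1 := hφ x hx
    simp only [pairing] at h1 ⊢
    simp [← Finset.mul_sum, h1]

/-- The Koszul dual `ℙ(↑V*)/(S^⊥)`. -/
noncomputable def koszulDual : BinaryQuadratic K where
  V := Module.Dual K Q.V
  deg := Q.deg + 1
  S := Q.annihilator

/-- The twisting morphism `↓(A^!)* → V → A`: a functional on `A^!` is restricted to the generators
`V*` of `A^!`, and thus becomes an element of `V** = V`. -/
noncomputable def twisting (n : ℕ+) (p : ℤ) :
    Q.koszulDual.permutad.dual.toColl.desuspension.X n p →ₗ[K] Q.permutad.X n p :=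
  Q.gen n p ∘ₗ (Module.evalEquiv K Q.V).symm.toLinearMap ∘ₗ
    (Q.koszulDual.gen n (p + 1)).dualMap

/-- The canonical map `𝔻(A^!) → A`: the morphism of permutads which extends the twisting
morphism. -/
noncomputable def canonicalMap :
    PrePermutad.Hom Q.koszulDual.permutad.dualBar.toPrePermutad Q.permutad :=
  FreePermutad.lift Q.permutad Q.isPermutad Q.twisting

/-- A binary quadratic permutad `A` is Koszul if the canonical map `𝔻(A^!) → (A, 0)` of
differential graded permutads induces an isomorphism on homology. -/
def IsKoszul : Prop :=
  PreDGPermutad.IsDGHom Q.koszulDual.permutad.dualBar Q.permutad.toDG Q.canonicalMap ∧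
    PreDGPermutad.IsQuasiIso Q.koszulDual.permutad.dualBar Q.permutad.toDG Q.canonicalMap

end BinaryQuadratic

/-- `M` is a minimal model of `A`: a differential graded permutad whose underlying graded permutad
is free, such that the differential of each generator is decomposable, together with a morphism
`M → A` of differential graded permutads which induces an isomorphism on homology. -/
def PreDGPermutad.IsMinimalModel (M A : PreDGPermutad K) : Prop :=
  M.IsDGPermutad ∧
    (∃ (B : Coll K) (f : PrePermutad.Hom (freePermutad B) M.toPrePermutad), f.IsIso ∧
      ∀ (n : ℕ+) {p q : ℤ} (h : q + 1 = p) (b : B.X n p),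
        M.d h (f.map n p (FreePermutad.ι B n p b)) ∈ M.toPrePermutad.decomposables n q) ∧
    ∃ g : PrePermutad.Hom M.toPrePermutad A.toPrePermutad,
      PreDGPermutad.IsDGHom M A g ∧ PreDGPermutad.IsQuasiIso M A g

/-! ## The terminal permutad -/

/-- The terminal permutad: `K` in degree `0` of each arity, all operations being the
multiplication of `K`; that is, the linearization of the terminal permutad in sets. -/
def perAs (K : Type u) [Field K] : PrePermutad K where
  X _ p := conc K K (p = 0)
  op {_ _ _} _ {p q s} h := LinearMap.mk₂ K
    (fun x y => ⟨x.1 * y.1, fun hs => by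
      by_cases hp : p = 0
      · rw [y.2 (by omega), mul_zero]
      · rw [x.2 hp, zero_mul]⟩)
    (fun _ _ _ => Subtype.ext (add_mul _ _ _))
    (fun _ _ _ => Subtype.ext (mul_assoc _ _ _))
    (fun _ _ _ => Subtype.ext (mul_add _ _ _))
    (fun _ _ _ => Subtype.ext (mul_left_comm _ _ _))

theorem perAs_isPermutad : (perAs K).IsPermutad := by
  intro m a b c e f t s u v huv i j k ij jk l hij hjk h h' x y z
  exact Subtype.ext (mul_assoc x.1 y.1 z.1)

/-- The identity of `{1, 2}`. -/
def idShuffle : Shuffle 2 1 1 := ⟨fun i => i, by decide⟩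

/-- The transposition of `{1, 2}`. -/
def swapShuffle : Shuffle 2 1 1 := ⟨fun i => Fin.rev i, by decide⟩

/-- The presentation of the terminal permutad: one generator `μ` in arity `1` and degree `0`, and
the relation `μ ⋄_id μ - μ ⋄_(21) μ`. -/
noncomputable def perAsPresentation (K : Type u) [Field K] : BinaryQuadratic K where
  V := K
  deg := 0
  S := Submodule.span K {Pi.single idShuffle (1 ⊗ₜ[K] 1) - Pi.single swapShuffle (1 ⊗ₜ[K] 1)}

end Quadratic

/-! ## The cellular chains of the permutohedra -/

section Permutohedron

/-- The permutohedron: the convex hull in `ℝⁿ` of all permutations of `(1, 2, …, n)`. Its dimension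
is `n - 1`. -/
def permutohedron (n : ℕ+) : Set (Fin n → ℝ) :=
  convexHull ℝ (Set.range fun (σ : Equiv.Perm (Fin n)) (i : Fin n) => ((σ i : ℕ) : ℝ) + 1)

/-- `F` is a closed `p`-dimensional cell of the polytope `P`, that is, a nonempty face of dimension
`p`. The polytope itself is one of its faces. -/
def IsCell {N : ℕ} (P : Set (Fin N → ℝ)) (p : ℤ) (F : Set (Fin N → ℝ)) : Prop :=
  F.Nonempty ∧ IsExposed ℝ P F ∧ (Module.finrank ℝ (vectorSpan ℝ F) : ℤ) = p

/-- The `p`-dimensional cells of the polytope `P`. -/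
abbrev Cell {N : ℕ} (P : Set (Fin N → ℝ)) (p : ℤ) : Type :=
  {F : Set (Fin N → ℝ) // IsCell P p F}

/-- A fixed orientation of each cell: an ordered basis of the space of vectors parallel to it. -/
noncomputable def cellBasis {N : ℕ} (F : Set (Fin N → ℝ)) :
    Fin (Module.finrank ℝ (vectorSpan ℝ F)) → (Fin N → ℝ) :=
  fun i => (Module.finBasis ℝ (vectorSpan ℝ F) i : Fin N → ℝ)

/-- Two ordered bases of the same space of vectors have the same orientation. -/
def SameOrientation {N d d' : ℕ} (v : Fin d → (Fin N → ℝ)) (w : Fin d' → (Fin N → ℝ)) : Prop :=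
  ∃ (h : d = d') (M : Matrix (Fin d) (Fin d) ℝ), 0 < M.det ∧
    ∀ i, w (Fin.cast h i) = ∑ j, M i j • v j

open Classical in
/-- The incidence number `[F : G]` of a cell `F` and a cell `G` of dimension one less: it is zero if
`G` is not contained in `F`; otherwise it is `1` or `-1` according as the outward pointing vector
`x - y`, with `x` in `G` and `y` in `F` outside `G`, followed by the basis of `G` gives the
orientation of `F` or the opposite one. -/
noncomputable def incidence (K : Type u) [Field K] {N : ℕ} (F G : Set (Fin N → ℝ)) : K :=
  if G ⊆ F then
    if ∃ x ∈ G, ∃ y ∈ F \ G, SameOrientation (Fin.cons (x - y) (cellBasis G)) (cellBasis F)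
    then 1 else -1
  else 0

/-- The boundary operator on the cellular chains of a polytope, `∂F = ∑_G [F : G] G`. A polytope
has finitely many cells, so that the sum is finite. -/
noncomputable def cellularBoundary (K : Type u) [Field K] {N : ℕ} (P : Set (Fin N → ℝ))
    (p q : ℤ) : (Cell P p →₀ K) →ₗ[K] (Cell P q →₀ K) :=
  Finsupp.linearCombination K fun F => ∑ᶠ G : Cell P q, Finsupp.single G (incidence K F.1 G.1)

namespace Shuffle

variable {n a b : ℕ+}

/-- The vector with the coordinates of `x` in the positions of the first fibre of `r`, and those of
`y`, increased by `c`, in the positions of the second one. -/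
def combine (r : Shuffle n a b) (c : ℝ) (x : Fin a → ℝ) (y : Fin b → ℝ) : Fin n → ℝ :=
  fun i => if h : r.1 i = 0 then x (r.idx₀ i h) else y (r.idx₁ i h) + c

/-- The affine embedding of a product of two permutohedra as a facet of a permutohedron takes
`F × G` to this set. -/
def prodCell (r : Shuffle n a b) (F : Set (Fin a → ℝ)) (G : Set (Fin b → ℝ)) :
    Set (Fin n → ℝ) :=
  Set.image2 (r.combine ((a : ℕ) : ℝ)) F G

/-- The product orientation: the basis of `F` followed by the basis of `G`. -/
noncomputable def prodBasis (r : Shuffle n a b) (F : Set (Fin a → ℝ)) (G : Set (Fin b → ℝ)) :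
    Fin (Module.finrank ℝ (vectorSpan ℝ F) + Module.finrank ℝ (vectorSpan ℝ G)) →
      (Fin n → ℝ) :=
  Fin.append (fun i => r.combine 0 (cellBasis F i) 0) (fun j => r.combine 0 0 (cellBasis G j))

open Classical in
/-- The product of two cells: the cell `F × G` with the product orientation. The condition is there
for typing only: the image of `F × G` is always a cell of the permutohedron. -/
noncomputable def cellProd (K : Type u) [Field K] (r : Shuffle n a b) {p q : ℤ} (s : ℤ)
    (F : Cell (permutohedron a) p) (G : Cell (permutohedron b) q) :
    Cell (permutohedron n) s →₀ K :=
  if h : IsCell (permutohedron n) s (r.prodCell F.1 G.1) then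
    Finsupp.single ⟨r.prodCell F.1 G.1, h⟩
      (if SameOrientation (r.prodBasis F.1 G.1) (cellBasis (r.prodCell F.1 G.1)) then 1 else -1)
  else 0

end Shuffle

/-- The cellular chains `CC_*(P)` of the permutohedra, with the operations induced by the
embeddings of products of permutohedra as facets of permutohedra. -/
noncomputable def permutohedralChains (K : Type u) [Field K] : PreDGPermutad K where
  X n p := Cell (permutohedron n) p →₀ K
  op r _ _ s _ := Finsupp.linearCombination K fun F =>
    Finsupp.linearCombination K fun G => r.cellProd K s F G
  d {n p q} _ := cellularBoundary K (permutohedron n) p q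

end Permutohedron

/-!
The proof compares three descriptions of the complex of ordered set partitions of `{1, …, n}`: the
dual bar construction of `perAs^!`, a subcomplex of a free associative algebra, and the cellular
chains of the permutohedron.

*Presentations of rank one.* If a permutad is generated by one element `v` of arity one with
`v ⋄_(21) v = ε v ⋄_id v`, then associativity alone shows that any product of two powers of `v` is
`ε ^ k` times a power of `v`, where `k` is the number of inversions of the surjection
(`IsPowerFamily.op_eq`). Hence its components are at most one-dimensional, and if it is presented
by this relation, it is isomorphic to an explicit permutad of signs
(`BinaryQuadratic.toSign_isIso`). For `ε = 1` this is `perAs`. The Koszul dual has `ε = -1` and a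
generator of degree `1`, so its dual bar construction is free on one generator in each arity `n`,
of degree `n - 1`, whose derivation is a sum over the surjections onto two elements with the signs
of the shuffles (`SignPresentation.sigma_β`).

*Words of subsets.* Such a free permutad has the products of generators indexed by ordered set
partitions as a basis. The proof of linear independence sends an ordered partition to the word of
its blocks in the free algebra on the finite subsets (`GeneratorBasis.realize_injective`). This
turns the derivation into the restriction of one derivation `SetWord.d` of the free algebra
(`GeneratorBasis.realize_deriv`), for which `d ∘ d = 0` is a computation with letters. To see that
the complex of ordered partitions has the homology of a point, an explicit homotopy moves the least
element into later and later blocks, until it is the last block on its own; then induction on the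
number of elements applies (`SetWord.exists_eq_d_add_smul`). As the canonical map to `perAs` is the
augmentation of this complex, `perAs` is Koszul (`BinaryQuadratic.isKoszul`).

*Cells.* The nonempty faces of the permutohedron are the faces on which a linear form is maximal,
and the order of the coefficients of the form is an ordered partition, which determines the face.
So the cells are indexed by the ordered partitions (`OrderedPartition.cell_injective`,
`exists_eq_cell`), and products of cells correspond to concatenations. Orientations are compared in
the exterior algebra of `ℝⁿ`, where the sign of a product of cells and the incidence numbers become
relations up to positive scalars (`cellSign_rel`, `incidenceSign_rel`). Associativity of the
operations on the chains and the Leibniz rule then follow from identities in the exterior algebra.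
For the top cell, exterior multiplication by `(1, …, 1)` turns its volume element into that of
`ℝⁿ`, up to sign, and the products of these standard volume elements involve the signs of the
shuffles. After this normalization, the boundary of the top cell is the derivation of the generator
of the free permutad (`boundary_topChain`).

The morphism from the dual bar construction to the chains which sends the generators to the top
cells is therefore an isomorphism of dg permutads (`GeneratorBasis.toChains_isIso`), and the
homology of the chains and the minimal model are obtained by transport along it.
-/


/-! ### Shuffles and the embeddings of their fibres -/

namespace Shuffle

variable {n m a b c e f : ℕ+}

/-- The order embedding of the first fibre. -/
def emb₀ (r : Shuffle n a b) : Fin a ↪o Fin n :=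
  (Finset.univ.filter fun i => r.1 i = 0).orderEmbOfFin r.2.1

/-- The order embedding of the second fibre. -/
def emb₁ (r : Shuffle n a b) : Fin b ↪o Fin n :=
  (Finset.univ.filter fun i => r.1 i = 1).orderEmbOfFin r.2.2

@[simp] theorem apply_emb₀ (r : Shuffle n a b) (j : Fin a) : r.1 (r.emb₀ j) = 0 := by
  have := Finset.orderEmbOfFin_mem _ r.2.1 j
  exact (Finset.mem_filter.1 this).2

@[simp] theorem apply_emb₁ (r : Shuffle n a b) (j : Fin b) : r.1 (r.emb₁ j) = 1 := by
  have := Finset.orderEmbOfFin_mem _ r.2.2 j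
  exact (Finset.mem_filter.1 this).2

theorem range_emb₀ (r : Shuffle n a b) : Set.range r.emb₀ = {i | r.1 i = 0} := by
  rw [emb₀, Finset.range_orderEmbOfFin]; simp

theorem range_emb₁ (r : Shuffle n a b) : Set.range r.emb₁ = {i | r.1 i = 1} := by
  rw [emb₁, Finset.range_orderEmbOfFin]; simp

theorem exists_emb₀ (r : Shuffle n a b) {i : Fin n} (h : r.1 i = 0) : ∃ j, r.emb₀ j = i := by
  have : i ∈ Set.range r.emb₀ := by rw [range_emb₀]; exact h
  exact this

theorem exists_emb₁ (r : Shuffle n a b) {i : Fin n} (h : ¬ r.1 i = 0) : ∃ j, r.emb₁ j = i := by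
  have : i ∈ Set.range r.emb₁ := by rw [range_emb₁]; exact Fin.eq_one_of_ne_zero _ h
  exact this

theorem emb_cases (r : Shuffle n a b) {P : Fin n → Prop} (h0 : ∀ j, P (r.emb₀ j))
    (h1 : ∀ j, P (r.emb₁ j)) (i : Fin n) : P i := by
  by_cases h : r.1 i = 0
  · obtain ⟨j, rfl⟩ := r.exists_emb₀ h
    exact h0 j
  · obtain ⟨j, rfl⟩ := r.exists_emb₁ h
    exact h1 j

theorem emb₀_ne_emb₁ (r : Shuffle n a b) (i : Fin a) (j : Fin b) : r.emb₀ i ≠ r.emb₁ j := by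
  intro h
  have := r.apply_emb₁ j
  rw [← h, r.apply_emb₀] at this
  exact absurd this (by decide)

theorem fibreRank_orderEmb {N k d : ℕ} (r : Fin N → Fin k) (g : Fin d ↪o Fin N) (x : Fin k)
    (hg : Set.range g = {i | r i = x}) (j : Fin d) : fibreRank r (g j) = j := by
  have hx : r (g j) = x := by
    have : g j ∈ Set.range g := ⟨j, rfl⟩
    rw [hg] at this
    exact this
  have : (Finset.univ.filter fun i => i < g j ∧ r i = r (g j)) =
      (Finset.Iio j).map g.toEmbedding := by
    ext i
    simp only [Finset.mem_filter, Finset.mem_univ, true_and, Finset.mem_map, Finset.mem_Iio,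
      RelEmbedding.coe_toEmbedding, hx]
    constructor
    · rintro ⟨h1, h2⟩
      have : i ∈ Set.range g := by rw [hg]; exact h2
      obtain ⟨l, rfl⟩ := this
      exact ⟨l, g.lt_iff_lt.1 h1, rfl⟩
    · rintro ⟨l, hl, rfl⟩
      have : g l ∈ Set.range g := ⟨l, rfl⟩
      rw [hg] at this
      exact ⟨g.lt_iff_lt.2 hl, this⟩
  rw [fibreRank, this, Finset.card_map, Fin.card_Iio]

@[simp] theorem idx₀_emb₀ (r : Shuffle n a b) (j : Fin a) (h : r.1 (r.emb₀ j) = 0) :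
    r.idx₀ (r.emb₀ j) h = j :=
  Fin.ext (fibreRank_orderEmb r.1 r.emb₀ 0 r.range_emb₀ j)

@[simp] theorem idx₁_emb₁ (r : Shuffle n a b) (j : Fin b) (h : ¬ r.1 (r.emb₁ j) = 0) :
    r.idx₁ (r.emb₁ j) h = j :=
  Fin.ext (fibreRank_orderEmb r.1 r.emb₁ 1 r.range_emb₁ j)

theorem filter_zero_eq (r : Shuffle n a b) :
    (Finset.univ.filter fun i => r.1 i = 0) = Finset.univ.map r.emb₀.toEmbedding := by
  ext i
  have := Set.ext_iff.1 r.range_emb₀ i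
  simpa using this.symm

theorem filter_one_eq (r : Shuffle n a b) :
    (Finset.univ.filter fun i => r.1 i = 1) = Finset.univ.map r.emb₁.toEmbedding := by
  ext i
  have := Set.ext_iff.1 r.range_emb₁ i
  simpa using this.symm

theorem card_eq (r : Shuffle n a b) : (n : ℕ) = a + b := by
  have h := Finset.card_filter_add_card_filter_not (s := (Finset.univ : Finset (Fin n)))
    (fun i => r.1 i = 0)
  have h2 : (Finset.univ.filter fun i => ¬ r.1 i = 0) = Finset.univ.filter fun i => r.1 i = 1 :=
    Finset.filter_congr fun i _ => by omega
  rw [h2, r.2.1, r.2.2] at h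
  simpa using h.symm

theorem ext_zero {r r' : Shuffle n a b} (h : ∀ i, r.1 i = 0 ↔ r'.1 i = 0) : r = r' := by
  refine Subtype.ext (funext fun i => ?_)
  have := h i
  omega

@[simp] theorem oneTimes_emb₀ (t : Shuffle m a e) (s : Shuffle e b c) (j : Fin a) :
    t.oneTimes s (t.emb₀ j) = 0 := by
  simp [oneTimes]

@[simp] theorem oneTimes_emb₁ (t : Shuffle m a e) (s : Shuffle e b c) (j : Fin e) :
    t.oneTimes s (t.emb₁ j) = (s.1 j).succ := by
  simp [oneTimes]

@[simp] theorem timesOne_emb₀ (w : Shuffle m f c) (v : Shuffle f a b) (j : Fin f) :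
    w.timesOne v (w.emb₀ j) = (v.1 j).castSucc := by
  simp [timesOne]

@[simp] theorem timesOne_emb₁ (w : Shuffle m f c) (v : Shuffle f a b) (j : Fin c) :
    w.timesOne v (w.emb₁ j) = 2 := by
  simp [timesOne]

theorem range_oneTimes_zero (t : Shuffle m a e) (s : Shuffle e b c) :
    Set.range t.emb₀ = {i | t.oneTimes s i = 0} := by
  ext i
  induction i using t.emb_cases with
  | h0 j => simp
  | h1 j => simp [t.emb₀_ne_emb₁]

theorem range_oneTimes_one (t : Shuffle m a e) (s : Shuffle e b c) :
    Set.range (s.emb₀.trans t.emb₁) = {i | t.oneTimes s i = 1} := by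
  ext i
  induction i using t.emb_cases with
  | h0 j => simp [(t.emb₀_ne_emb₁ _ _).symm]
  | h1 j =>
    induction j using s.emb_cases with
    | h0 j => simp
    | h1 j => simp [s.emb₀_ne_emb₁]

theorem range_oneTimes_two (t : Shuffle m a e) (s : Shuffle e b c) :
    Set.range (s.emb₁.trans t.emb₁) = {i | t.oneTimes s i = 2} := by
  ext i
  induction i using t.emb_cases with
  | h0 j => simp [(t.emb₀_ne_emb₁ _ _).symm]
  | h1 j =>
    induction j using s.emb_cases with
    | h0 j => simp [(s.emb₀_ne_emb₁ _ _).symm]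
    | h1 j => simp

theorem range_timesOne_zero (w : Shuffle m f c) (v : Shuffle f a b) :
    Set.range (v.emb₀.trans w.emb₀) = {i | w.timesOne v i = 0} := by
  ext i
  induction i using w.emb_cases with
  | h1 j => simp [w.emb₀_ne_emb₁]
  | h0 j =>
    induction j using v.emb_cases with
    | h0 j => simp
    | h1 j => simp [v.emb₀_ne_emb₁]

theorem range_timesOne_one (w : Shuffle m f c) (v : Shuffle f a b) :
    Set.range (v.emb₁.trans w.emb₀) = {i | w.timesOne v i = 1} := by
  ext i
  induction i using w.emb_cases with
  | h1 j => simp [w.emb₀_ne_emb₁]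
  | h0 j =>
    induction j using v.emb_cases with
    | h0 j => simp [(v.emb₀_ne_emb₁ _ _).symm]
    | h1 j => simp

theorem range_timesOne_two (w : Shuffle m f c) (v : Shuffle f a b) :
    Set.range w.emb₁ = {i | w.timesOne v i = 2} := by
  ext i
  induction i using w.emb_cases with
  | h1 j => simp
  | h0 j =>
    induction j using v.emb_cases with
    | h0 j => simp [(w.emb₀_ne_emb₁ _ _).symm]
    | h1 j => simp [(w.emb₀_ne_emb₁ _ _).symm]

section Assoc

variable {t : Shuffle m a e} {s : Shuffle e b c} {w : Shuffle m f c} {v : Shuffle f a b}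

theorem emb_assoc_zero (h : t.oneTimes s = w.timesOne v) : v.emb₀.trans w.emb₀ = t.emb₀ := by
  refine OrderEmbedding.range_inj.1 ?_
  rw [range_timesOne_zero, range_oneTimes_zero t s, h]

theorem emb_assoc_one (h : t.oneTimes s = w.timesOne v) :
    v.emb₁.trans w.emb₀ = s.emb₀.trans t.emb₁ := by
  refine OrderEmbedding.range_inj.1 ?_
  rw [range_timesOne_one, range_oneTimes_one, h]

theorem emb_assoc_two (h : t.oneTimes s = w.timesOne v) : w.emb₁ = s.emb₁.trans t.emb₁ := by
  refine OrderEmbedding.range_inj.1 ?_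
  rw [range_timesOne_two w v, range_oneTimes_two, h]

theorem emb_assoc_zero_apply (h : t.oneTimes s = w.timesOne v) (i : Fin a) :
    w.emb₀ (v.emb₀ i) = t.emb₀ i := DFunLike.congr_fun (emb_assoc_zero h) i

theorem emb_assoc_one_apply (h : t.oneTimes s = w.timesOne v) (i : Fin b) :
    w.emb₀ (v.emb₁ i) = t.emb₁ (s.emb₀ i) := DFunLike.congr_fun (emb_assoc_one h) i

theorem emb_assoc_two_apply (h : t.oneTimes s = w.timesOne v) (i : Fin c) :
    w.emb₁ i = t.emb₁ (s.emb₁ i) := DFunLike.congr_fun (emb_assoc_two h) i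

end Assoc

/-- Every map onto three elements has the form `t(1 × s)`. -/
theorem exists_oneTimes (w : Fin m → Fin 3) (ha : (Finset.univ.filter fun i => w i = 0).card = a)
    (hb : (Finset.univ.filter fun i => w i = 1).card = b)
    (hc : (Finset.univ.filter fun i => w i = 2).card = c) :
    ∃ (t : Shuffle m a (b + c)) (s : Shuffle (b + c) b c), t.oneTimes s = w := by
  have h1 : (Finset.univ.filter fun i => (if w i = 0 then (0 : Fin 2) else 1) = 0) =
      Finset.univ.filter fun i => w i = 0 :=
        Finset.filter_congr fun i _ => by split_ifs <;> simp_all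
  have h2 : (Finset.univ.filter fun i => (if w i = 0 then (0 : Fin 2) else 1) = 1) =
      (Finset.univ.filter fun i => w i = 1) ∪ (Finset.univ.filter fun i => w i = 2) := by
    ext i
    simp only [Finset.mem_filter, Finset.mem_univ, true_and, Finset.mem_union]
    split_ifs with h
    · simp [h]
    · simp; omega
  have h3 : Disjoint (Finset.univ.filter fun i => w i = 1)
      (Finset.univ.filter fun i => w i = 2) :=
    Finset.disjoint_filter.2 fun i _ h h' => by rw [h] at h'; exact absurd h' (by decide)
  obtain ⟨t, ht⟩ : ∃ t : Shuffle m a (b + c), ∀ i, t.1 i = 0 ↔ w i = 0 :=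
    ⟨⟨fun i => if w i = 0 then 0 else 1, by rw [h1, ha], by
      rw [h2, Finset.card_union_of_disjoint h3, hb, hc]; rfl⟩, fun i => by simp⟩
  have key : ∀ x : Fin 3, x ≠ 0 →
      (Finset.univ.filter fun k => w (t.emb₁ k) = x).map t.emb₁.toEmbedding =
        Finset.univ.filter fun i => w i = x := by
    intro x hx
    ext i
    simp only [Finset.mem_map, Finset.mem_filter, Finset.mem_univ, true_and,
      RelEmbedding.coe_toEmbedding]
    constructor
    · rintro ⟨k, hk, rfl⟩
      exact hk
    · intro hi
      obtain ⟨k, rfl⟩ := t.exists_emb₁ (i := i) (by rw [ht, hi]; exact hx)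
      exact ⟨k, hi, rfl⟩
  have hne : ∀ k, w (t.emb₁ k) ≠ 0 := by
    intro k hk
    rw [← ht, t.apply_emb₁] at hk
    exact absurd hk (by decide)
  obtain ⟨s, hs⟩ : ∃ s : Shuffle (b + c) b c, ∀ k, s.1 k = if w (t.emb₁ k) = 1 then 0 else 1 := by
    refine ⟨⟨fun k => if w (t.emb₁ k) = 1 then 0 else 1, ?_, ?_⟩, fun _ => rfl⟩
    · rw [← hb, ← key 1 (by decide), Finset.card_map]
      congr 1
      exact Finset.filter_congr fun i _ => by simp
    · rw [← hc, ← key 2 (by decide), Finset.card_map]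
      congr 1
      refine Finset.filter_congr fun i _ => ?_
      have := hne i
      simp only [ite_eq_right_iff]
      omega
  refine ⟨t, s, funext fun i => ?_⟩
  induction i using t.emb_cases with
  | h0 j =>
    rw [oneTimes_emb₀]
    exact ((ht _).1 (t.apply_emb₀ j)).symm
  | h1 j =>
    rw [oneTimes_emb₁, hs]
    have := hne j
    split_ifs with h
    · rw [h]; rfl
    · simp; omega

/-- Every map onto three elements has the form `u(v × 1)`. -/
theorem exists_timesOne (w : Fin m → Fin 3) (ha : (Finset.univ.filter fun i => w i = 0).card = a)
    (hb : (Finset.univ.filter fun i => w i = 1).card = b)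
    (hc : (Finset.univ.filter fun i => w i = 2).card = c) :
    ∃ (t : Shuffle m (a + b) c) (s : Shuffle (a + b) a b), t.timesOne s = w := by
  have h1 : (Finset.univ.filter fun i => (if w i = 2 then (1 : Fin 2) else 0) = 1) =
      Finset.univ.filter fun i => w i = 2 :=
        Finset.filter_congr fun i _ => by split_ifs <;> simp_all
  have h2 : (Finset.univ.filter fun i => (if w i = 2 then (1 : Fin 2) else 0) = 0) =
      (Finset.univ.filter fun i => w i = 0) ∪ (Finset.univ.filter fun i => w i = 1) := by
    ext i
    simp only [Finset.mem_filter, Finset.mem_univ, true_and, Finset.mem_union]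
    split_ifs with h
    · simp [h]
    · simp; omega
  have h3 : Disjoint (Finset.univ.filter fun i => w i = 0)
      (Finset.univ.filter fun i => w i = 1) :=
    Finset.disjoint_filter.2 fun i _ h h' => by rw [h] at h'; exact absurd h' (by decide)
  obtain ⟨t, ht⟩ : ∃ t : Shuffle m (a + b) c, ∀ i, t.1 i = 1 ↔ w i = 2 :=
    ⟨⟨fun i => if w i = 2 then 1 else 0, by
      rw [h2, Finset.card_union_of_disjoint h3, ha, hb]; rfl, by rw [h1, hc]⟩, fun i => by simp⟩
  have key : ∀ x : Fin 3, x ≠ 2 →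
      (Finset.univ.filter fun k => w (t.emb₀ k) = x).map t.emb₀.toEmbedding =
        Finset.univ.filter fun i => w i = x := by
    intro x hx
    ext i
    simp only [Finset.mem_map, Finset.mem_filter, Finset.mem_univ, true_and,
      RelEmbedding.coe_toEmbedding]
    constructor
    · rintro ⟨k, hk, rfl⟩
      exact hk
    · intro hi
      obtain ⟨k, rfl⟩ := t.exists_emb₀ (i := i) (by
        have := (ht i).not.2 (by rw [hi]; exact hx)
        omega)
      exact ⟨k, hi, rfl⟩
  have hne : ∀ k, w (t.emb₀ k) ≠ 2 := by
    intro k hk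
    rw [← ht, t.apply_emb₀] at hk
    exact absurd hk (by decide)
  obtain ⟨s, hs⟩ : ∃ s : Shuffle (a + b) a b, ∀ k, s.1 k = if w (t.emb₀ k) = 0 then 0 else 1 := by
    refine ⟨⟨fun k => if w (t.emb₀ k) = 0 then 0 else 1, ?_, ?_⟩, fun _ => rfl⟩
    · rw [← ha, ← key 0 (by decide), Finset.card_map]
      congr 1
      exact Finset.filter_congr fun i _ => by simp
    · rw [← hb, ← key 1 (by decide), Finset.card_map]
      congr 1
      refine Finset.filter_congr fun i _ => ?_
      have := hne i
      simp only [ite_eq_right_iff]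
      omega
  refine ⟨t, s, funext fun i => ?_⟩
  induction i using t.emb_cases with
  | h1 j =>
    rw [timesOne_emb₁]
    exact ((ht _).1 (t.apply_emb₁ j)).symm
  | h0 j =>
    rw [timesOne_emb₀, hs]
    have := hne j
    split_ifs with h
    · rw [h]; rfl
    · simp; omega

theorem card_of_range {N d : ℕ} (g : Fin d ↪o Fin N) (w : Fin N → Fin 3) (x : Fin 3)
    (h : Set.range g = {i | w i = x}) : (Finset.univ.filter fun i => w i = x).card = d := by
  have : (Finset.univ.filter fun i => w i = x) = Finset.univ.map g.toEmbedding := by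
    ext i
    have := Set.ext_iff.1 h i
    simpa using this.symm
  rw [this, Finset.card_map, Finset.card_univ, Fintype.card_fin]

/-- Every composite bracketed to the left can be bracketed to the right: the surjection
`w (v × 1)` onto three elements is also of the form `t (1 × s)`. -/
theorem exists_reassoc_right (w : Shuffle m f c) (v : Shuffle f a b) :
    ∃ (t : Shuffle m a (b + c)) (s : Shuffle (b + c) b c), t.oneTimes s = w.timesOne v :=
  exists_oneTimes _ (card_of_range _ _ _ (range_timesOne_zero w v))
    (card_of_range _ _ _ (range_timesOne_one w v)) (card_of_range _ _ _ (range_timesOne_two w v))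

/-- Every composite bracketed to the right can be bracketed to the left. -/
theorem exists_reassoc_left (t : Shuffle m a e) (s : Shuffle e b c) :
    ∃ (w : Shuffle m (a + b) c) (v : Shuffle (a + b) a b), t.oneTimes s = w.timesOne v := by
  obtain ⟨w, v, h⟩ := exists_timesOne (a := a) (b := b) (c := c) (t.oneTimes s)
    (card_of_range _ _ _ (range_oneTimes_zero t s))
    (card_of_range _ _ _ (range_oneTimes_one t s)) (card_of_range _ _ _ (range_oneTimes_two t s))
  exact ⟨w, v, h.symm⟩

/-- The shuffle with a given first fibre. -/
def ofFinset (A : Finset (Fin n)) (ha : A.card = a) (hb : Aᶜ.card = b) : Shuffle n a b :=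
  ⟨fun i => if i ∈ A then 0 else 1, by rw [← ha]; congr 1; ext i; simp, by
    rw [← hb]; congr 1; ext i; simp⟩

/-! ### Inversions -/

/-- The number of pairs `(i, j) ∈ X × Y` with `j < i`. -/
def _root_.inversions {ι : Type*} [LinearOrder ι] (X Y : Finset ι) : ℕ :=
  ((X ×ˢ Y).filter fun p => p.2 < p.1).card

theorem _root_.inversions_map {ι κ : Type*} [LinearOrder ι] [LinearOrder κ] (g : ι ↪o κ)
    (X Y : Finset ι) :
    inversions (X.map g.toEmbedding) (Y.map g.toEmbedding) = inversions X Y := by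
  unfold inversions
  rw [← Finset.card_map (Function.Embedding.prodMap g.toEmbedding g.toEmbedding)]
  congr 1
  ext ⟨i, j⟩
  simp only [Finset.mem_filter, Finset.mem_product, Finset.mem_map, RelEmbedding.coe_toEmbedding,
    Function.Embedding.prodMap, Prod.exists, Function.Embedding.coeFn_mk, Prod.map_apply,
    Prod.mk.injEq]
  constructor
  · rintro ⟨⟨⟨i, hi, rfl⟩, ⟨j, hj, rfl⟩⟩, h⟩
    exact ⟨i, j, ⟨⟨hi, hj⟩, g.lt_iff_lt.1 h⟩, rfl, rfl⟩
  · rintro ⟨i, j, ⟨⟨hi, hj⟩, h⟩, rfl, rfl⟩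
    exact ⟨⟨⟨i, hi, rfl⟩, ⟨j, hj, rfl⟩⟩, g.lt_iff_lt.2 h⟩

theorem _root_.inversions_union_left {ι : Type*} [LinearOrder ι] {X Y : Finset ι} (Z : Finset ι)
    (h : Disjoint X Y) : inversions (X ∪ Y) Z = inversions X Z + inversions Y Z := by
  unfold inversions
  rw [Finset.union_product, Finset.filter_union, Finset.card_union_of_disjoint]
  refine Finset.disjoint_filter_filter ?_
  exact Finset.disjoint_product.2 (Or.inl h)

theorem _root_.inversions_union_right {ι : Type*} [LinearOrder ι] (X : Finset ι) {Y Z : Finset ι}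
    (h : Disjoint Y Z) : inversions X (Y ∪ Z) = inversions X Y + inversions X Z := by
  unfold inversions
  rw [Finset.product_union, Finset.filter_union, Finset.card_union_of_disjoint]
  refine Finset.disjoint_filter_filter ?_
  exact Finset.disjoint_product.2 (Or.inr h)

/-- The first fibre. -/
def fib₀ (r : Shuffle n a b) : Finset (Fin n) := Finset.univ.map r.emb₀.toEmbedding

/-- The second fibre. -/
def fib₁ (r : Shuffle n a b) : Finset (Fin n) := Finset.univ.map r.emb₁.toEmbedding

@[simp] theorem mem_fib₀ (r : Shuffle n a b) (i : Fin n) : i ∈ r.fib₀ ↔ r.1 i = 0 := by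
  rw [fib₀, ← filter_zero_eq]; simp

@[simp] theorem mem_fib₁ (r : Shuffle n a b) (i : Fin n) : i ∈ r.fib₁ ↔ r.1 i = 1 := by
  rw [fib₁, ← filter_one_eq]; simp

theorem disjoint_fib (r : Shuffle n a b) : Disjoint r.fib₀ r.fib₁ := by
  rw [Finset.disjoint_left]
  intro i h0 h1
  simp at h0 h1
  omega

theorem fib_union (r : Shuffle n a b) : r.fib₀ ∪ r.fib₁ = Finset.univ := by
  ext i
  simp
  omega

/-- The number of inversions of a shuffle. -/
def inv (r : Shuffle n a b) : ℕ := inversions r.fib₀ r.fib₁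

/-- Both sums count the inversions of the surjection onto three elements. This is why the signs
`(-1) ^ r.inv` are compatible with associativity. -/
theorem inv_assoc {t : Shuffle m a e} {s : Shuffle e b c} {w : Shuffle m f c} {v : Shuffle f a b}
    (h : t.oneTimes s = w.timesOne v) : t.inv + s.inv = w.inv + v.inv := by
  have h1 : t.fib₁ = s.fib₀.map t.emb₁.toEmbedding ∪ s.fib₁.map t.emb₁.toEmbedding := by
    rw [← Finset.map_union, fib_union]; rfl
  have h2 : w.fib₀ = v.fib₀.map w.emb₀.toEmbedding ∪ v.fib₁.map w.emb₀.toEmbedding := by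
    rw [← Finset.map_union, fib_union]; rfl
  have e0 : v.fib₀.map w.emb₀.toEmbedding = t.fib₀ := by
    ext i; simp [fib₀, emb_assoc_zero_apply h]
  have e1 : v.fib₁.map w.emb₀.toEmbedding = s.fib₀.map t.emb₁.toEmbedding := by
    ext i; simp [fib₀, fib₁, emb_assoc_one_apply h]
  have e2 : w.fib₁ = s.fib₁.map t.emb₁.toEmbedding := by
    ext i; simp [fib₁, emb_assoc_two_apply h]
  have d1 := (Finset.disjoint_map t.emb₁.toEmbedding).2 s.disjoint_fib
  have d2 := (Finset.disjoint_map w.emb₀.toEmbedding).2 v.disjoint_fib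
  unfold inv
  rw [← inversions_map t.emb₁ s.fib₀, ← inversions_map w.emb₀ v.fib₀, h1, h2,
    inversions_union_right _ d1, inversions_union_left _ d2, e0, e1, e2]
  ring

end Shuffle

/-! ### Permutads generated by one element of arity one -/

theorem PNat.coe_two_eq : ((2 : ℕ+) : ℕ) = ((1 : ℕ+) : ℕ) + 1 := rfl

theorem PNat.coe_succ_eq (n : ℕ+) : ((n + 1 : ℕ+) : ℕ) = (n : ℕ) + 1 := rfl

namespace Shuffle

variable {n m a b c e f : ℕ+}

/-- The shuffle of `{1, …, n + 1}` whose first fibre is `{1}`. -/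
def first (m n : ℕ+) (h : (m : ℕ) = n + 1) : Shuffle m 1 n :=
  ofFinset {⟨0, m.pos⟩} (Finset.card_singleton _) (by
    rw [Finset.card_compl, Finset.card_singleton, Fintype.card_fin, h, Nat.add_sub_cancel])

theorem first_apply (h : (m : ℕ) = n + 1) (i : Fin m) : (first m n h).1 i = 0 ↔ (i : ℕ) = 0 := by
  unfold first ofFinset
  by_cases hi : i = ⟨0, m.pos⟩
  · simp [hi]
  · simp only [Finset.mem_singleton, hi, if_false]
    rw [Fin.ext_iff] at hi
    simpa using hi

theorem eq_first {r : Shuffle m 1 n} (h : r.1 ⟨0, PNat.pos _⟩ = 0) :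
    r = first m n (r.card_eq.trans (Nat.add_comm _ _)) := by
  refine ext_zero fun i => ?_
  rw [first_apply]
  constructor
  · intro hi
    obtain ⟨j, hj⟩ := r.exists_emb₀ hi
    obtain ⟨k, hk⟩ := r.exists_emb₀ h
    have : j = k := Subsingleton.elim (α := Fin 1) j k
    rw [← hj, this, hk]
  · intro hi
    rwa [show i = ⟨0, PNat.pos _⟩ from Fin.ext hi]

theorem first_emb₀_lt (h : (m : ℕ) = n + 1) (i : Fin (1 : ℕ+)) (j : Fin n) :
    (first m n h).emb₀ i < (first m n h).emb₁ j := by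
  have h0 := (first m n h).apply_emb₀ i
  have h1 := (first m n h).apply_emb₁ j
  rw [first_apply] at h0
  have h2 : ¬ (first m n h).1 ((first m n h).emb₁ j) = 0 := by rw [h1]; decide
  rw [first_apply] at h2
  rw [Fin.lt_def]
  omega

theorem inv_first (h : (m : ℕ) = n + 1) : (first m n h).inv = 0 := by
  rw [inv, inversions, Finset.card_eq_zero, Finset.filter_eq_empty_iff]
  rintro ⟨i, j⟩ hij
  simp only [fib₀, fib₁, Finset.mem_product, Finset.mem_map, Finset.mem_univ, true_and,
    RelEmbedding.coe_toEmbedding] at hij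
  obtain ⟨⟨i, rfl⟩, ⟨j, rfl⟩⟩ := hij
  exact not_lt.2 (first_emb₀_lt h i j).le

theorem emb₁_le (r : Shuffle n a b) {i : Fin n} (h : ¬ r.1 i = 0) :
    r.emb₁ ⟨0, b.pos⟩ ≤ i := by
  obtain ⟨j, rfl⟩ := r.exists_emb₁ h
  exact r.emb₁.monotone (Fin.mk_le_of_le_val (Nat.zero_le _))

theorem emb₀_le (r : Shuffle n a b) {i : Fin n} (h : r.1 i = 0) :
    r.emb₀ ⟨0, a.pos⟩ ≤ i := by
  obtain ⟨j, rfl⟩ := r.exists_emb₀ h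
  exact r.emb₀.monotone (Fin.mk_le_of_le_val (Nat.zero_le _))

theorem exists_reassoc_right' (w : Shuffle m f c) (v : Shuffle f a b) (he : (e : ℕ) = b + c) :
    ∃ (t : Shuffle m a e) (s : Shuffle e b c), t.oneTimes s = w.timesOne v := by
  obtain rfl : e = b + c := PNat.eq he
  exact exists_reassoc_right w v

theorem exists_reassoc_left' (t : Shuffle m a e) (s : Shuffle e b c) (hf : (f : ℕ) = a + b) :
    ∃ (w : Shuffle m f c) (v : Shuffle f a b), t.oneTimes s = w.timesOne v := by
  obtain rfl : f = a + b := PNat.eq hf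
  exact exists_reassoc_left t s

end Shuffle

theorem idShuffle_eq_first : idShuffle = Shuffle.first 2 1 PNat.coe_two_eq := by
  refine Shuffle.ext_zero fun i => ?_
  rw [Shuffle.first_apply]
  exact Fin.ext_iff

theorem eq_idShuffle_or (r : Shuffle 2 1 1) : r = idShuffle ∨ r = swapShuffle := by
  revert r
  decide

theorem inv_idShuffle : idShuffle.inv = 0 := by
  rw [idShuffle_eq_first, Shuffle.inv_first]

theorem inv_swapShuffle : swapShuffle.inv = 1 := by
  have h0 : swapShuffle.fib₀ = {⟨1, by decide⟩} := by
    ext i; rw [Shuffle.mem_fib₀]; revert i; decide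
  have h1 : swapShuffle.fib₁ = {⟨0, by decide⟩} := by
    ext i; rw [Shuffle.mem_fib₁]; revert i; decide
  rw [Shuffle.inv, h0, h1]
  decide

section RankOne

variable {K : Type u} [Field K]

/-- A family of elements of a permutad, `E n` in degree `n δ`, which is generated by `E 1` in the
sense that `E (n + 1)` is the product of `E 1` and `E n`, and where the two products of `E 1` with
itself differ by the factor `ε`. The elements in the other degrees are irrelevant. -/
structure IsPowerFamily (A : PrePermutad K) (ε : K) (δ : ℤ) (E : ∀ n p, A.X n p) : Prop where
  rec_eq : ∀ {m n : ℕ+} (hm : (m : ℕ) = n + 1) {p q s : ℤ} (h : p + q = s), p = δ → q = n * δ →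
    A.op (Shuffle.first m n hm) h (E 1 p) (E n q) = E m s
  swap_eq : ∀ {p q s : ℤ} (h : p + q = s), p = δ → q = δ →
    A.op swapShuffle h (E 1 p) (E 1 q) = ε • A.op idShuffle h (E 1 p) (E 1 q)

variable {A : PrePermutad K} (hA : A.IsPermutad) {ε : K} {δ : ℤ} {E : ∀ n p, A.X n p}
  (hE : IsPowerFamily A ε δ E)

include hA hE

/-- The case of `op_eq` in which the left factor is the generator, by induction on the arity: if `0`
is not in the first fibre of `t`, the generator is moved past the first letter of the power, which
costs one inversion. -/
theorem IsPowerFamily.op_one_eq {n : ℕ+} {m : ℕ+} (t : Shuffle m 1 n) {p q s : ℤ} (h : p + q = s)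
    (hp : p = δ) (hq : q = n * δ) : A.op t h (E 1 p) (E n q) = ε ^ t.inv • E m s := by
  have hm : (m : ℕ) = n + 1 := t.card_eq.trans (Nat.add_comm _ _)
  induction n generalizing p q s m with
  | one =>
    have hq' : q = δ := by simpa using hq
    obtain rfl : m = 2 := PNat.eq hm
    rcases eq_idShuffle_or t with rfl | rfl
    · rw [inv_idShuffle, pow_zero, one_smul, idShuffle_eq_first]
      exact hE.rec_eq _ h hp hq
    · rw [inv_swapShuffle, pow_one, hE.swap_eq h hp hq', idShuffle_eq_first]
      exact congrArg (ε • ·) (hE.rec_eq _ h hp hq)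
  | succ n ih =>
    by_cases ht : t.1 ⟨0, PNat.pos _⟩ = 0
    · rw [Shuffle.eq_first ht, Shuffle.inv_first, pow_zero, one_smul]
      exact hE.rec_eq _ h hp hq
    · -- `E 1 ⋄_t (E 1 ⋄ E n)` is bracketed as `(E 1 ⋄_v E 1) ⋄_w E n`, where `v = (21)`
      obtain ⟨w, v, hwv⟩ := Shuffle.exists_reassoc_left' (f := 2) t
        (Shuffle.first (n + 1) n (PNat.coe_succ_eq n)) rfl
      have hz : t.emb₁ ⟨0, PNat.pos _⟩ = ⟨0, PNat.pos _⟩ :=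
        le_antisymm (t.emb₁_le ht) (Fin.mk_le_of_le_val (Nat.zero_le _))
      have hz' : (Shuffle.first (n + 1) n (PNat.coe_succ_eq n)).emb₀ ⟨0, PNat.pos _⟩ =
          ⟨0, PNat.pos _⟩ :=
        le_antisymm (Shuffle.emb₀_le _ ((Shuffle.first_apply _ _).2 rfl))
          (Fin.mk_le_of_le_val (Nat.zero_le _))
      have hv : v = swapShuffle := by
        refine (eq_idShuffle_or v).resolve_left fun hv => ?_
        have h1 := Shuffle.emb_assoc_one_apply hwv ⟨0, PNat.pos _⟩
        rw [hz', hz] at h1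
        rw [idShuffle_eq_first] at hv
        have h2 := w.emb₀.strictMono (Shuffle.first_emb₀_lt (m := 2) (n := 1) PNat.coe_two_eq
          ⟨0, PNat.pos _⟩ ⟨0, PNat.pos _⟩)
        rw [← hv, h1] at h2
        exact absurd h2 (Nat.not_lt_zero _)
      subst hv
      -- after `v` is replaced by the identity, the generator with the least element is split off
      -- again
      obtain ⟨t', s', hts⟩ := Shuffle.exists_reassoc_right' w idShuffle (e := n + 1)
        (Nat.add_comm _ _)
      have hw : t'.1 ⟨0, PNat.pos _⟩ = 0 := by
        have h1 := Shuffle.emb_assoc_one_apply hwv ⟨0, PNat.pos _⟩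
        rw [hz', hz] at h1
        have h2 := Shuffle.emb_assoc_zero_apply hts ⟨0, PNat.pos _⟩
        have h3 : idShuffle.emb₀ ⟨0, PNat.pos _⟩ = swapShuffle.emb₁ ⟨0, PNat.pos _⟩ :=
          le_antisymm ((Shuffle.emb₀_le _ (by decide)).trans (Fin.mk_le_of_le_val (Nat.zero_le _)))
            ((Shuffle.emb₁_le _ (by decide)).trans (Fin.mk_le_of_le_val (Nat.zero_le _)))
        rw [h3, h1] at h2
        rw [h2]
        exact t'.apply_emb₀ _
      -- one inversion was lost, which accounts for the factor `ε`
      have hinv1 := Shuffle.inv_assoc hwv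
      have hinv2 := Shuffle.inv_assoc hts
      rw [Shuffle.inv_first, inv_swapShuffle] at hinv1
      rw [inv_idShuffle, Shuffle.eq_first hw, Shuffle.inv_first] at hinv2
      have hq1 : q = δ + n * δ := by rw [hq]; push_cast; ring
      rw [← hE.rec_eq (m := n + 1) (n := n) (PNat.coe_succ_eq n) (p := δ) (q := n * δ)
          hq1.symm rfl rfl,
        ← hA _ _ _ _ hwv rfl hq1.symm (by omega) h, hE.swap_eq rfl hp rfl,
        map_smul, LinearMap.smul_apply, hA _ _ _ _ hts rfl hq1.symm (by omega) h,
        ih s' hq1.symm rfl rfl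
          (by rw [PNat.add_coe]; rfl), Shuffle.eq_first hw, map_smul, hE.rec_eq _ h hp (by rw [hq]),
        smul_smul]
      congr 1
      rw [← pow_succ']
      congr 1
      omega

/-- In a permutad which is generated by one element of arity one, all products are determined by
the number of inversions. -/
theorem IsPowerFamily.op_eq {n a b : ℕ+} (w : Shuffle n a b) {p q s : ℤ} (h : p + q = s)
    (hp : p = a * δ) (hq : q = b * δ) : A.op w h (E a p) (E b q) = ε ^ w.inv • E n s := by
  induction a generalizing p q s n b with
  | one => exact hE.op_one_eq hA w h (by simpa using hp) hq
  | succ a ih =>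
    obtain ⟨t, s', hts⟩ := Shuffle.exists_reassoc_right w
      (Shuffle.first (a + 1) a (PNat.coe_succ_eq a))
    have hinv := Shuffle.inv_assoc hts
    have hp1 : p = δ + a * δ := by rw [hp]; push_cast; ring
    rw [Shuffle.inv_first] at hinv
    rw [← hE.rec_eq (m := a + 1) (n := a) (PNat.coe_succ_eq a) (p := δ) (q := a * δ)
        hp1.symm rfl rfl,
      hA _ _ _ _ hts hp1.symm rfl h (by omega), ih s' rfl rfl hq, map_smul,
      hE.op_one_eq hA t _ rfl (by rw [hq]; push_cast; ring), smul_smul, ← pow_add]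
    congr 2
    omega

end RankOne

section

variable {K : Type u} [Field K]

/-! ### Permutads with one-dimensional components -/

/-- The permutad with `K` in arity `n` and degree `n δ`, where the operation of `r` is the
multiplication of `K` twisted by `ε` to the power of the number of inversions of `r`. For `ε = 1`
and `δ = 0` it is the terminal permutad, for `ε = -1` and `δ = 1` its Koszul dual. -/
def signAs (K : Type u) [Field K] (ε : K) (δ : ℤ) : PrePermutad K where
  X n p := conc K K (p = n * δ)
  op {n a b} r {p q s} h := LinearMap.mk₂ K
    (fun x y => ⟨ε ^ r.inv * (x.1 * y.1), fun hs => by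
      by_cases hp : p = a * δ
      · rw [y.2 fun hq => hs (by rw [← h, hp, hq, r.card_eq]; push_cast; ring), mul_zero, mul_zero]
      · rw [x.2 hp, zero_mul, mul_zero]⟩)
    (fun _ _ _ => Subtype.ext (by simp only [Submodule.coe_add]; ring))
    (fun _ _ _ => Subtype.ext (by simp only [Submodule.coe_smul, smul_eq_mul]; ring))
    (fun _ _ _ => Subtype.ext (by simp only [Submodule.coe_add]; ring))
    (fun _ _ _ => Subtype.ext (by simp only [Submodule.coe_smul, smul_eq_mul]; ring))

/-- The coordinate on `signAs`. -/
def signAs.coord (ε : K) (δ : ℤ) (n : ℕ+) (p : ℤ) : (signAs K ε δ).X n p →ₗ[K] K :=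
  (conc K K (p = n * δ)).subtype

theorem signAs.coord_op (ε : K) (δ : ℤ) {n a b : ℕ+} (r : Shuffle n a b) {p q s : ℤ}
    (h : p + q = s) (x : (signAs K ε δ).X a p) (y : (signAs K ε δ).X b q) :
    coord ε δ n s ((signAs K ε δ).op r h x y) =
      ε ^ r.inv * (coord ε δ a p x * coord ε δ b q y) := rfl

theorem signAs.coord_injective (ε : K) (δ : ℤ) (n : ℕ+) (p : ℤ) :
    Function.Injective (coord ε δ n p) := Subtype.val_injective

theorem signAs.isPermutad (ε : K) (δ : ℤ) : (signAs K ε δ).IsPermutad := by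
  intro m a b c e f t s u v huv i j k ij jk l hij hjk h h' x y z
  apply signAs.coord_injective
  simp only [signAs.coord_op]
  have h1 : ε ^ t.inv * ε ^ s.inv = ε ^ u.inv * ε ^ v.inv := by
    rw [← pow_add, ← pow_add, Shuffle.inv_assoc huv]
  linear_combination
    (-(signAs.coord ε δ a i x * signAs.coord ε δ b j y * signAs.coord ε δ c k z)) * h1

/-- A morphism which vanishes on an ideal induces a morphism on the quotient. -/
def PrePermutad.quotientLift {A B : PrePermutad K} {I : ∀ n p, Submodule K (A.X n p)}
    (hI : A.IsIdeal I) (f : PrePermutad.Hom A B) (hf : ∀ n p, ∀ x ∈ I n p, f.map n p x = 0) :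
    PrePermutad.Hom (A.quotient I hI) B where
  map n p := (I n p).liftQ (f.map n p) (hf n p)
  map_op {n a b} r {p q s} h x y := by
    obtain ⟨x, rfl⟩ := (I a p).mkQ_surjective x
    obtain ⟨y, rfl⟩ := (I b q).mkQ_surjective y
    exact f.map_op r h x y

/-- The kernel of a morphism of permutads is an ideal. -/
theorem PrePermutad.Hom.isIdeal_ker {A B : PrePermutad K} (f : PrePermutad.Hom A B) :
    A.IsIdeal fun n p => LinearMap.ker (f.map n p) where
  left r p q s h x y hx := by
    rw [LinearMap.mem_ker] at hx ⊢
    rw [f.map_op, hx, map_zero, LinearMap.zero_apply]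
  right r p q s h x y hx := by
    rw [LinearMap.mem_ker] at hx ⊢
    rw [f.map_op, hx, map_zero]

theorem PrePermutad.idealSpan_le_ker {A B : PrePermutad K} (f : PrePermutad.Hom A B)
    {R : ∀ n p, A.X n p → Prop} (hR : ∀ n p x, R n p x → f.map n p x = 0) (n : ℕ+) (p : ℤ) :
    ∀ x ∈ A.idealSpan R n p, f.map n p x = 0 := by
  intro x hx
  rw [PrePermutad.idealSpan, Submodule.mem_sInf] at hx
  exact hx _ ⟨_, f.isIdeal_ker, hR, rfl⟩

theorem PrePermutad.mem_idealSpan (A : PrePermutad K) {R : ∀ n p, A.X n p → Prop} {n : ℕ+} {p : ℤ}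
    {x : A.X n p} (hx : R n p x) : x ∈ A.idealSpan R n p := by
  rw [PrePermutad.idealSpan, Submodule.mem_sInf]
  rintro _ ⟨I, -, hR, rfl⟩
  exact hR _ _ _ hx

/-- The induction principle of the free permutad. -/
theorem FreePermutad.induction {B : Coll K} {P : ∀ n p, (freePermutad B).X n p → Prop}
    (hι : ∀ n p b, P n p (FreePermutad.ι B n p b))
    (hop : ∀ {n a b : ℕ+} (r : Shuffle n a b) {p q s : ℤ} (h : p + q = s) x y, P a p x → P b q y →
      P n s ((freePermutad B).op r h x y))
    (hzero : ∀ n p, P n p 0) (hadd : ∀ n p x y, P n p x → P n p y → P n p (x + y))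
    (hsmul : ∀ n p (c : K) x, P n p x → P n p (c • x)) (n : ℕ+) (p : ℤ)
    (x : (freePermutad B).X n p) : P n p x := by
  have key : ∀ {n : ℕ+} {p : ℤ} (x : FreePermutad.Pre B n p), P n p (FreePermutad.mk x) := by
    intro n p x
    induction x with
    | of b => exact hι _ _ b
    | op r h x y hx hy => exact hop r h _ _ hx hy
    | zero => exact hzero _ _
    | add x y hx hy => exact hadd _ _ _ _ hx hy
    | smul c x hx => exact hsmul _ _ c _ hx
  obtain ⟨x⟩ := x
  exact key x

namespace BinaryQuadratic

variable (Q : BinaryQuadratic K)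

theorem toConc_of_not (V : Type u) [AddCommGroup V] [Module K V] {P : Prop} (h : ¬ P) :
    toConc K V P = 0 := dif_neg h

theorem toConc_of (V : Type u) [AddCommGroup V] [Module K V] {P : Prop} (h : P) (v : V) :
    (toConc K V P v).1 = v := by
  rw [toConc, dif_pos h]; rfl

theorem gen_eq_zero {n : ℕ+} {p : ℤ} (h : ¬ (n = 1 ∧ p = Q.deg)) (v : Q.V) : Q.gen n p v = 0 := by
  have h0 : Q.freeGen n p v = 0 := by
    refine Eq.trans (congrArg (FreePermutad.ι (Coll.single K Q.V Q.deg) n p) ?_) (map_zero _)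
    exact congrArg (fun f => f v) (toConc_of_not (K := K) Q.V h)
  exact (congrArg (Q.free.idealSpan Q.IsRelation n p).mkQ h0).trans (map_zero _)

variable (ψ : Q.V ≃ₗ[K] K) (ε : K)

/-- The morphism from the free permutad to `signAs` which is given by a coordinate on the
generators. -/
noncomputable def freeToSign : PrePermutad.Hom Q.free (signAs K ε Q.deg) :=
  FreePermutad.lift _ (signAs.isPermutad ε Q.deg) fun n p =>
    toConc K K (p = n * Q.deg) ∘ₗ ψ.toLinearMap ∘ₗ (conc K Q.V (n = 1 ∧ p = Q.deg)).subtype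

theorem coord_freeToSign (v : Q.V) :
    signAs.coord ε Q.deg 1 Q.deg ((Q.freeToSign ψ ε).map 1 Q.deg (Q.freeGen 1 Q.deg v)) =
      ψ v := by
  have h1 : (toConc K Q.V ((1 : ℕ+) = 1 ∧ Q.deg = Q.deg) v).1 = v :=
    toConc_of (K := K) Q.V ⟨rfl, rfl⟩ v
  have h2 : Q.deg = ((1 : ℕ+) : ℕ) * Q.deg := by simp
  refine (toConc_of (K := K) K h2 (ψ (toConc K Q.V ((1 : ℕ+) = 1 ∧ Q.deg = Q.deg) v).1)).trans ?_
  rw [h1]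

theorem coord_ofQuad (x : Shuffle 2 1 1 → Q.V ⊗[K] Q.V) :
    signAs.coord ε Q.deg 2 (Q.deg + Q.deg) ((Q.freeToSign ψ ε).map 2 _ (Q.ofQuad x)) =
      ∑ r, ε ^ r.inv *
        LinearMap.mul' K K (TensorProduct.map ψ.toLinearMap ψ.toLinearMap (x r)) := by
  rw [ofQuad, map_sum, map_sum]
  refine Finset.sum_congr rfl fun r _ => ?_
  generalize x r = y
  induction y using TensorProduct.induction_on with
  | zero => simp
  | add y z hy hz => simp only [map_add, hy, hz, mul_add]
  | tmul v w =>
    rw [TensorProduct.lift.tmul, LinearMap.compl₁₂_apply, (Q.freeToSign ψ ε).map_op,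
      signAs.coord_op, coord_freeToSign, coord_freeToSign]
    rfl

/-- The projection of the free permutad onto the quadratic permutad. -/
def proj (n : ℕ+) (p : ℤ) : Q.free.X n p →ₗ[K] Q.permutad.X n p :=
  (Q.free.idealSpan Q.IsRelation n p).mkQ

theorem proj_surjective (n : ℕ+) (p : ℤ) : Function.Surjective (Q.proj n p) :=
  (Q.free.idealSpan Q.IsRelation n p).mkQ_surjective

theorem proj_op {n a b : ℕ+} (r : Shuffle n a b) {p q s : ℤ} (h : p + q = s)
    (x : Q.free.X a p) (y : Q.free.X b q) : Q.proj n s (Q.free.op r h x y) =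
      Q.permutad.op r h (Q.proj a p x) (Q.proj b q y) := rfl

variable {ε}

/-- The morphism from the quadratic permutad to `signAs`. -/
noncomputable def toSign (hS : ∀ x ∈ Q.S, ∑ r : Shuffle 2 1 1, ε ^ r.inv *
    LinearMap.mul' K K (TensorProduct.map ψ.toLinearMap ψ.toLinearMap (x r)) = 0) :
    PrePermutad.Hom Q.permutad (signAs K ε Q.deg) :=
  PrePermutad.quotientLift _ (Q.freeToSign ψ ε)
    (PrePermutad.idealSpan_le_ker _ fun n p x hx => by
      obtain ⟨x, hx⟩ := hx
      apply signAs.coord_injective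
      rw [coord_ofQuad, hS x hx, map_zero])

/-- The powers of a generator in a quadratic permutad, extended by zero to all degrees. -/
noncomputable def power (v : Q.V) (n : ℕ+) : ∀ p, Q.permutad.X n p :=
  PNat.recOn n (p := fun n => ∀ p, Q.permutad.X n p) (fun p => Q.gen 1 p v) fun n x p =>
    Q.permutad.op (Shuffle.first (n + 1) n (PNat.coe_succ_eq n)) (p := Q.deg) (q := p - Q.deg)
      (by omega) (Q.gen 1 Q.deg v) (x (p - Q.deg))

theorem power_one (v : Q.V) (p : ℤ) : Q.power v 1 p = Q.gen 1 p v := by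
  rw [power, PNat.recOn_one]

theorem power_succ (v : Q.V) (n : ℕ+) (p : ℤ) : Q.power v (n + 1) p =
    Q.permutad.op (Shuffle.first (n + 1) n (PNat.coe_succ_eq n)) (p := Q.deg) (q := p - Q.deg)
      (by omega) (Q.gen 1 Q.deg v) (Q.power v n (p - Q.deg)) := by
  rw [power, PNat.recOn_succ, power]

theorem power_eq_zero (v : Q.V) (n : ℕ+) {p : ℤ} (h : p ≠ n * Q.deg) : Q.power v n p = 0 := by
  induction n generalizing p with
  | one => rw [power_one, gen_eq_zero]; simpa using h
  | succ n ih =>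
    rw [power_succ, ih, map_zero]
    intro h'
    apply h
    push_cast
    linarith

theorem ofQuad_eq (x : Shuffle 2 1 1 → Q.V ⊗[K] Q.V) : Q.ofQuad x =
    TensorProduct.lift
    ((Q.free.op idShuffle (p := Q.deg) (q := Q.deg) rfl).compl₁₂ (Q.freeGen 1 Q.deg)
      (Q.freeGen 1 Q.deg)) (x idShuffle) + TensorProduct.lift
    ((Q.free.op swapShuffle (p := Q.deg) (q := Q.deg) rfl).compl₁₂ (Q.freeGen 1 Q.deg)
      (Q.freeGen 1 Q.deg)) (x swapShuffle) := by
  have : (Finset.univ : Finset (Shuffle 2 1 1)) = {idShuffle, swapShuffle} := by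
    ext r
    simpa using eq_idShuffle_or r
  rw [ofQuad, this, Finset.sum_insert (by decide), Finset.sum_singleton]

/-- The powers of a generator satisfying `v ⋄_(21) v = ε v ⋄_id v` form a power family. -/
theorem isPowerFamily (v : Q.V) (hv : Pi.single swapShuffle (v ⊗ₜ[K] v) -
    ε • (Pi.single idShuffle (v ⊗ₜ[K] v) : Shuffle 2 1 1 → Q.V ⊗[K] Q.V) ∈ Q.S) :
    IsPowerFamily Q.permutad ε Q.deg (Q.power v) where
  rec_eq {m n} hm p q s h hp hq := by
    obtain rfl : m = n + 1 := PNat.eq hm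
    subst hp
    obtain rfl : q = s - Q.deg := by omega
    rw [power_succ, power_one]
  swap_eq {p q s} h hp hq := by
    subst hp hq h
    rw [power_one]
    have h0 := Q.free.mem_idealSpan (IsRelation.mk _ hv)
    have hne : idShuffle ≠ swapShuffle := by decide
    have h2 : Q.ofQuad (Pi.single swapShuffle (v ⊗ₜ[K] v) -
        ε • (Pi.single idShuffle (v ⊗ₜ[K] v) : Shuffle 2 1 1 → Q.V ⊗[K] Q.V)) =
        Q.free.op swapShuffle rfl (Q.freeGen 1 Q.deg v) (Q.freeGen 1 Q.deg v) -
        ε • Q.free.op idShuffle rfl (Q.freeGen 1 Q.deg v) (Q.freeGen 1 Q.deg v) := by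
      rw [ofQuad_eq]
      simp only [Pi.sub_apply, Pi.smul_apply, Pi.single_eq_same, Pi.single_eq_of_ne hne,
        Pi.single_eq_of_ne hne.symm, zero_sub, smul_zero, sub_zero, map_neg, map_smul,
        TensorProduct.lift.tmul, LinearMap.compl₁₂_apply]
      abel
    rw [h2] at h0
    exact sub_eq_zero.1 ((Submodule.Quotient.mk_eq_zero _).2 h0)

section Iso

variable {Q ψ}
variable (hS : ∀ x ∈ Q.S, ∑ r : Shuffle 2 1 1, ε ^ r.inv *
    LinearMap.mul' K K (TensorProduct.map ψ.toLinearMap ψ.toLinearMap (x r)) = 0)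
  (hv : Pi.single swapShuffle (ψ.symm 1 ⊗ₜ[K] ψ.symm 1) -
    ε • (Pi.single idShuffle (ψ.symm 1 ⊗ₜ[K] ψ.symm 1) : Shuffle 2 1 1 → Q.V ⊗[K] Q.V) ∈ Q.S)

theorem coord_toSign_gen (v : Q.V) :
    signAs.coord ε Q.deg 1 Q.deg ((Q.toSign ψ hS).map 1 Q.deg (Q.gen 1 Q.deg v)) = ψ v :=
  Q.coord_freeToSign ψ ε v

theorem coord_toSign_power {v : Q.V} (n : ℕ+) {p : ℤ} (hp : p = n * Q.deg) :
    signAs.coord ε Q.deg n p ((Q.toSign ψ hS).map n p (Q.power v n p)) = ψ v ^ (n : ℕ) := by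
  induction n generalizing p with
  | one =>
    obtain rfl : p = Q.deg := by simpa using hp
    rw [power_one, coord_toSign_gen]
    exact (pow_one _).symm
  | succ n ih =>
    rw [power_succ, (Q.toSign ψ hS).map_op, signAs.coord_op, Shuffle.inv_first, coord_toSign_gen,
      ih (by rw [hp]; push_cast; ring), PNat.coe_succ_eq, pow_succ]
    ring

include hv in
/-- The multiples of the powers contain the generator and are closed under products, so that every
component is at most one-dimensional. -/
theorem exists_smul_power (n : ℕ+) (p : ℤ) (x : Q.permutad.X n p) :
    ∃ c : K, x = c • Q.power (ψ.symm 1) n p := by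
  obtain ⟨x, rfl⟩ := Q.proj_surjective n p x
  induction n, p, x using FreePermutad.induction with
  | hι n p b =>
    by_cases h : n = 1 ∧ p = Q.deg
    · obtain ⟨rfl, rfl⟩ := h
      refine ⟨ψ b.1, ?_⟩
      rw [power_one, ← map_smul, ← map_smul, smul_eq_mul, mul_one, LinearEquiv.symm_apply_apply]
      have hb : b = toConc K Q.V ((1 : ℕ+) = 1 ∧ Q.deg = Q.deg) b.1 :=
        Subtype.ext (toConc_of (K := K) Q.V ⟨rfl, rfl⟩ b.1).symm
      exact congrArg (fun b => Q.proj 1 Q.deg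
        (FreePermutad.ι (Coll.single K Q.V Q.deg) 1 Q.deg b)) hb
    · refine ⟨0, ?_⟩
      have hb : b = 0 := Subtype.ext (b.2 h)
      rw [hb, map_zero, map_zero, zero_smul]
  | hop r h x y hx hy =>
    rename_i n a b p q s
    obtain ⟨c, hc⟩ := hx
    obtain ⟨c', hc'⟩ := hy
    rw [proj_op, hc, hc']
    by_cases hp : p = a * Q.deg
    · by_cases hq : q = b * Q.deg
      · refine ⟨c' * (c * ε ^ r.inv), ?_⟩
        rw [map_smul, map_smul, LinearMap.smul_apply,
          (Q.isPowerFamily _ hv).op_eq Q.isPermutad r h hp hq, smul_smul,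
          smul_smul, mul_assoc]
      · exact ⟨0, by rw [Q.power_eq_zero _ _ hq, smul_zero, map_zero, zero_smul]⟩
    · exact ⟨0, by rw [Q.power_eq_zero _ _ hp, smul_zero, map_zero, LinearMap.zero_apply,
        zero_smul]⟩
  | hzero n p => exact ⟨0, by rw [map_zero, zero_smul]⟩
  | hadd n p x y hx hy =>
    obtain ⟨c, hc⟩ := hx
    obtain ⟨c', hc'⟩ := hy
    exact ⟨c + c', by rw [map_add, hc, hc', add_smul]⟩
  | hsmul n p c x hx =>
    obtain ⟨c', hc'⟩ := hx
    exact ⟨c * c', by rw [map_smul, hc', smul_smul]⟩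

include hv in
/-- A binary quadratic permutad with one generator `v`, whose relations are spanned by
`v ⋄_(21) v - ε v ⋄_id v`, has one-dimensional components. -/
theorem toSign_isIso : (Q.toSign ψ hS).IsIso := by
  intro n p
  by_cases hp : p = n * Q.deg
  · have h1 : signAs.coord ε Q.deg n p ((Q.toSign ψ hS).map n p (Q.power (ψ.symm 1) n p)) = 1 := by
      rw [coord_toSign_power hS n hp, LinearEquiv.apply_symm_apply, one_pow]
    refine ⟨?_, fun y => ⟨signAs.coord ε Q.deg n p y • Q.power (ψ.symm 1) n p, ?_⟩⟩
    · rw [injective_iff_map_eq_zero]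
      intro x hx
      obtain ⟨c, rfl⟩ := exists_smul_power hv n p x
      rw [map_smul] at hx
      have := congrArg (signAs.coord ε Q.deg n p) hx
      rw [map_smul, h1, map_zero, smul_eq_mul, mul_one] at this
      rw [this, zero_smul]
    · apply signAs.coord_injective
      rw [map_smul, map_smul, h1, smul_eq_mul, mul_one]
  · refine ⟨?_, fun y => ⟨0, ?_⟩⟩
    · rw [injective_iff_map_eq_zero]
      intro x _
      obtain ⟨c, rfl⟩ := exists_smul_power hv n p x
      rw [Q.power_eq_zero _ _ hp, smul_zero]
    · rw [map_zero]
      exact (Subtype.ext (y.2 hp)).symm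

end Iso

end BinaryQuadratic

end

/-! ### The free algebra on finite subsets and its differential -/

namespace SetWord

variable (K : Type u) [Field K] {ι : Type}

/-- The free associative algebra on the finite subsets of a linearly ordered set. A word whose
letters form an ordered partition of `ι` stands for the corresponding product of the generators of
the dual bar construction. -/
abbrev Alg (K : Type u) [Field K] (ι : Type) : Type u := FreeAlgebra K (Finset ι)

/-- The sign of a homogeneous element of degree `n - 1`. -/
def par (n : ℕ) : K := (-1) ^ (n + 1)

variable {K}

/-- The product of the letters of a word. -/
def word (L : List (Finset ι)) : Alg K ι := (L.map (FreeAlgebra.ι K)).prod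

@[simp] theorem word_nil : word (K := K) ([] : List (Finset ι)) = 1 := rfl

@[simp] theorem word_cons (A : Finset ι) (L : List (Finset ι)) :
    word (K := K) (A :: L) = FreeAlgebra.ι K A * word L := by
  rw [word, List.map_cons, List.prod_cons, word]

/-- The basis of words. -/
noncomputable def wordBasis (K : Type u) [Field K] (ι : Type) :
    Module.Basis (List (Finset ι)) K (Alg K ι) :=
  (FreeAlgebra.basisFreeMonoid K (Finset ι)).reindex FreeMonoid.toList

theorem wordBasis_apply (L : List (Finset ι)) : wordBasis K ι L = word L := by
  rw [wordBasis, Module.Basis.reindex_apply]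
  simp [FreeAlgebra.basisFreeMonoid, FreeAlgebra.equivMonoidAlgebraFreeMonoid, word,
    FreeMonoid.lift_apply]

theorem linearIndependent_word :
    LinearIndependent K (word : List (Finset ι) → Alg K ι) := by
  have := (wordBasis K ι).linearIndependent
  rwa [show (wordBasis K ι : List (Finset ι) → Alg K ι) = word from
    funext wordBasis_apply] at this

theorem induction {P : Alg K ι → Prop} (hone : P 1)
    (hmul : ∀ A y, P y → P (FreeAlgebra.ι K A * y)) (hadd : ∀ x y, P x → P y → P (x + y))
    (hsmul : ∀ (c : K) x, P x → P (c • x)) (x : Alg K ι) : P x := by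
  have hw : ∀ L : List (Finset ι), P (word L) := by
    intro L
    induction L with
    | nil => exact hone
    | cons A L ih => rw [word_cons]; exact hmul A _ ih
  refine Submodule.span_induction (p := fun x _ => P x) (s := Set.range (wordBasis K ι)) ?_ ?_
    (fun x y _ _ => hadd x y) (fun c x _ => hsmul c x) (x := x)
    (by rw [(wordBasis K ι).span_eq]; trivial)
  · rintro _ ⟨L, rfl⟩
    rw [wordBasis_apply]
    exact hw L
  · rw [← zero_smul K 1]
    exact hsmul _ _ hone

/-- The linear map with prescribed values on the words. -/
noncomputable def ofWords (f : List (Finset ι) → Alg K ι) : Alg K ι →ₗ[K] Alg K ι :=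
  (wordBasis K ι).constr K f

theorem ofWords_word (f : List (Finset ι) → Alg K ι) (L : List (Finset ι)) :
    ofWords f (word L) = f L := by
  rw [ofWords, ← wordBasis_apply, Module.Basis.constr_basis]

/-- The automorphism which is given by the signs of the degrees. -/
def parHom (K : Type u) [Field K] (ι : Type) : Alg K ι →ₐ[K] Alg K ι :=
  FreeAlgebra.lift K fun A => par K A.card • FreeAlgebra.ι K A

theorem parHom_ι (A : Finset ι) :
    parHom K ι (FreeAlgebra.ι K A) = par K A.card • FreeAlgebra.ι K A := by
  rw [parHom, FreeAlgebra.lift_ι_apply]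

theorem par_mul_self (n : ℕ) : par K n * par K n = 1 := by
  rw [par, ← pow_add]
  exact Even.neg_one_pow ⟨n + 1, rfl⟩

theorem parHom_parHom (x : Alg K ι) : parHom K ι (parHom K ι x) = x := by
  have : (parHom K ι).comp (parHom K ι) = AlgHom.id K _ := by
    refine FreeAlgebra.hom_ext (funext fun A => ?_)
    simp [parHom_ι, smul_smul, par_mul_self]
  exact DFunLike.congr_fun this x

variable (K) [LinearOrder ι]

/-- The letter of a subset, which is zero for the empty set. -/
def letter (A : Finset ι) : Alg K ι := if A = ∅ then 0 else FreeAlgebra.ι K A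

/-- The sign of the shuffle of `X` and `Y`. -/
def sgn (X Y : Finset ι) : K := (-1) ^ inversions X Y

variable {K}

@[simp] theorem letter_empty : letter K (∅ : Finset ι) = 0 := if_pos rfl

theorem letter_of_ne {A : Finset ι} (h : A ≠ ∅) : letter K A = FreeAlgebra.ι K A := if_neg h

theorem par_add (m n : ℕ) : par K (m + n) = -(par K m * par K n) := by
  simp only [par]; ring

theorem sgn_union_left {X Y : Finset ι} (Z : Finset ι) (h : Disjoint X Y) :
    sgn K (X ∪ Y) Z = sgn K X Z * sgn K Y Z := by
  rw [sgn, inversions_union_left Z h, pow_add, sgn, sgn]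

theorem sgn_union_right (X : Finset ι) {Y Z : Finset ι} (h : Disjoint Y Z) :
    sgn K X (Y ∪ Z) = sgn K X Y * sgn K X Z := by
  rw [sgn, inversions_union_right X h, pow_add, sgn, sgn]

/-- The differential of a letter. -/
def dLetter (A : Finset ι) : Alg K ι :=
  ∑ X ∈ A.powerset, (par K X.card * sgn K X (A \ X)) • (letter K X * letter K (A \ X))

theorem dLetter_empty : dLetter (K := K) (∅ : Finset ι) = 0 := by
  simp [dLetter]

theorem dLetter_singleton (e : ι) : dLetter (K := K) {e} = 0 := by
  refine Finset.sum_eq_zero fun X hX => ?_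
  rw [Finset.mem_powerset, Finset.subset_singleton_iff] at hX
  rcases hX with rfl | rfl <;> simp

theorem parHom_letter (A : Finset ι) :
    parHom K ι (letter K A) = par K A.card • letter K A := by
  by_cases hA : A = ∅
  · rw [hA, letter_empty, map_zero, smul_zero]
  · rw [letter_of_ne hA, parHom_ι]

theorem parHom_dLetter (A : Finset ι) :
    parHom K ι (dLetter A) = -par K A.card • dLetter A := by
  rw [dLetter, map_sum, Finset.smul_sum]
  refine Finset.sum_congr rfl fun X hX => ?_
  have h1 : A.card = X.card + (A \ X).card := by
    rw [add_comm, Finset.card_sdiff_add_card_eq_card (Finset.mem_powerset.1 hX)]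
  rw [map_smul, map_mul, parHom_letter, parHom_letter, h1, par_add, smul_mul_smul_comm,
    smul_smul, smul_smul]
  congr 1
  ring

/-- The differential on words. -/
def dWord : List (Finset ι) → Alg K ι
  | [] => 0
  | A :: L => dLetter A * word L + par K A.card • (FreeAlgebra.ι K A * dWord L)

/-- The differential: the derivation which extends `dLetter`. -/
noncomputable def d : Alg K ι →ₗ[K] Alg K ι := ofWords dWord

theorem d_one : d (1 : Alg K ι) = 0 := ofWords_word dWord []

theorem d_ι_mul (A : Finset ι) (y : Alg K ι) : d (FreeAlgebra.ι K A * y) =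
    dLetter A * y + par K A.card • (FreeAlgebra.ι K A * d y) := by
  have : d ∘ₗ LinearMap.mulLeft K (FreeAlgebra.ι K A) =
      LinearMap.mulLeft K (dLetter A) +
        par K A.card • (LinearMap.mulLeft K (FreeAlgebra.ι K A) ∘ₗ d) := by
    refine (wordBasis K ι).ext fun L => ?_
    have h := ofWords_word (K := K) dWord (A :: L)
    have h2 := ofWords_word (K := K) dWord L
    rw [wordBasis_apply]
    simp only [LinearMap.comp_apply, LinearMap.mulLeft_apply, LinearMap.add_apply,
      LinearMap.smul_apply]
    rw [← word_cons, d, h, h2, dWord]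
  exact DFunLike.congr_fun this y

theorem d_mul (x y : Alg K ι) : d (x * y) = d x * y + parHom K ι x * d y := by
  induction x using induction with
  | hone => rw [one_mul, d_one, zero_mul, map_one, one_mul, zero_add]
  | hmul A x ih =>
    rw [mul_assoc, d_ι_mul, d_ι_mul, ih, map_mul, parHom_ι]
    simp only [mul_add, add_mul, smul_add, smul_mul_assoc, mul_assoc]
    abel
  | hadd x x' h h' => simp only [add_mul, map_add, h, h']; abel
  | hsmul c x h => simp only [smul_mul_assoc, map_smul, h, smul_add]

theorem d_ι (A : Finset ι) : d (FreeAlgebra.ι K A) = dLetter A := by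
  have := d_ι_mul (K := K) A 1
  rwa [mul_one, mul_one, d_one, mul_zero, smul_zero, add_zero] at this

theorem d_letter (A : Finset ι) : d (letter K A) = dLetter A := by
  by_cases hA : A = ∅
  · rw [hA, letter_empty, map_zero, dLetter_empty]
  · rw [letter_of_ne hA, d_ι]

theorem parHom_d (x : Alg K ι) : parHom K ι (d x) = -d (parHom K ι x) := by
  induction x using induction with
  | hone => rw [map_one (parHom K ι), d_one, map_zero, neg_zero]
  | hmul A x ih =>
    rw [d_mul, map_add, map_mul, map_mul, map_mul, d_mul, d_ι, parHom_dLetter, parHom_parHom, ih,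
      parHom_ι, map_smul, d_ι]
    simp only [neg_smul, neg_mul, mul_neg]
    abel
  | hadd x x' h h' => simp only [map_add, h, h']; abel
  | hsmul c x h => simp only [map_smul, h, smul_neg]

/-- The splittings of `A` into three parts occur twice, once from the differential of each of the
two factors, with opposite signs. -/
theorem d_dLetter (A : Finset ι) : d (dLetter (K := K) A) = 0 := by
  have h1 : d (dLetter (K := K) A) = (∑ X ∈ A.powerset, ∑ X' ∈ X.powerset,
      (par K X.card * sgn K X (A \ X) * (par K X'.card * sgn K X' (X \ X'))) •
        (letter K X' * letter K (X \ X') * letter K (A \ X))) +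
      ∑ X ∈ A.powerset, ∑ Y ∈ (A \ X).powerset,
      (sgn K X (A \ X) * (par K Y.card * sgn K Y ((A \ X) \ Y))) •
        (letter K X * letter K Y * letter K ((A \ X) \ Y)) := by
    rw [dLetter, map_sum, ← Finset.sum_add_distrib]
    refine Finset.sum_congr rfl fun X hX => ?_
    rw [map_smul, d_mul, smul_add, d_letter, d_letter, parHom_letter, smul_mul_assoc, smul_smul,
      mul_right_comm, par_mul_self, one_mul]
    congr 1
    · rw [dLetter, Finset.sum_mul, Finset.smul_sum]
      refine Finset.sum_congr rfl fun X' _ => ?_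
      rw [smul_mul_assoc, smul_smul]
    · rw [dLetter, Finset.mul_sum, Finset.smul_sum]
      refine Finset.sum_congr rfl fun X' _ => ?_
      rw [mul_smul_comm, smul_smul, mul_assoc]
  -- the splitting `(X', X \ X', A \ X)` of the first sum corresponds to the pair `(X', X \ X')` in
  -- the second one
  rw [h1, Finset.sum_sigma', Finset.sum_sigma', add_eq_zero_iff_eq_neg, ← Finset.sum_neg_distrib]
  refine Finset.sum_bij' (fun p _ => ⟨p.2, p.1 \ p.2⟩) (fun p _ => ⟨p.1 ∪ p.2, p.1⟩) ?_ ?_ ?_ ?_ ?_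
  · rintro ⟨X, X'⟩ h
    simp only [Finset.mem_sigma, Finset.mem_powerset] at h ⊢
    exact ⟨h.2.trans h.1, Finset.sdiff_subset_sdiff h.1 subset_rfl⟩
  · rintro ⟨X, Y⟩ h
    simp only [Finset.mem_sigma, Finset.mem_powerset] at h ⊢
    exact ⟨Finset.union_subset h.1 (h.2.trans Finset.sdiff_subset), Finset.subset_union_left⟩
  · rintro ⟨X, X'⟩ h
    simp only [Finset.mem_sigma, Finset.mem_powerset] at h ⊢
    rw [Finset.union_sdiff_of_subset h.2]
  · rintro ⟨X, Y⟩ h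
    simp only [Finset.mem_sigma, Finset.mem_powerset] at h ⊢
    have hd : Disjoint Y X := Finset.disjoint_of_subset_left h.2 Finset.sdiff_disjoint
    rw [Finset.union_sdiff_cancel_left hd.symm]
  · rintro ⟨X, X'⟩ h
    simp only [Finset.mem_sigma, Finset.mem_powerset] at h ⊢
    have e1 : (A \ X') \ (X \ X') = A \ X := by
      ext i
      have := @h.2 i
      simp only [Finset.mem_sdiff]
      tauto
    have e2 : A \ X' = (X \ X') ∪ (A \ X) := by
      ext i
      have h3 := @h.2 i
      have h4 := @h.1 i
      simp only [Finset.mem_sdiff, Finset.mem_union]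
      tauto
    have hd : Disjoint (X \ X') (A \ X) :=
      Finset.disjoint_of_subset_left Finset.sdiff_subset Finset.disjoint_sdiff
    have e3 : sgn K X (A \ X) = sgn K X' (A \ X) * sgn K (X \ X') (A \ X) := by
      rw [← sgn_union_left _ Finset.disjoint_sdiff, Finset.union_sdiff_of_subset h.2]
    have e4 : par K X.card = -(par K X'.card * par K (X \ X').card) := by
      rw [← par_add, add_comm, Finset.card_sdiff_add_card_eq_card h.2]
    rw [e1, e2, sgn_union_right _ hd, e3, e4, ← neg_smul]
    congr 1
    linear_combination (-(sgn K X' (A \ X) * sgn K (X \ X') (A \ X) * sgn K X' (X \ X') *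
      par K (X \ X').card)) * par_mul_self (K := K) X'.card

theorem d_d (x : Alg K ι) : d (d x) = 0 := by
  induction x using induction with
  | hone => rw [d_one, map_zero]
  | hmul A x ih =>
    rw [d_mul, map_add, d_mul, d_mul, d_ι, d_dLetter, ih, ← d_ι, parHom_d]
    simp
  | hadd x x' h h' => rw [map_add, map_add, h, h', add_zero]
  | hsmul c x h => rw [map_smul, map_smul, h, smul_zero]

/-! ### Acyclicity -/

/-- The span of the words whose letters form an ordered partition of `U` into `k` blocks. -/
def partitions (K : Type u) [Field K] {ι : Type} [LinearOrder ι] :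
    ℕ → Finset ι → Submodule K (Alg K ι)
  | 0, U => if U = ∅ then Submodule.span K {1} else ⊥
  | k + 1, U => Submodule.span K {x | ∃ A ⊆ U, A.Nonempty ∧ ∃ y ∈ partitions K k (U \ A),
      x = FreeAlgebra.ι K A * y}

theorem one_mem_partitions : (1 : Alg K ι) ∈ partitions K 0 ∅ := by
  rw [partitions, if_pos rfl]
  exact Submodule.mem_span_singleton_self 1

theorem eq_zero_of_mem_partitions_zero {U : Finset ι} (hU : U.Nonempty) {x : Alg K ι}
    (h : x ∈ partitions K 0 U) : x = 0 := by
  rw [partitions, if_neg hU.ne_empty] at h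
  exact h

theorem ι_mul_mem_partitions {k : ℕ} {U A : Finset ι} (hA : A.Nonempty) (hd : Disjoint A U)
    {y : Alg K ι} (hy : y ∈ partitions K k U) :
    FreeAlgebra.ι K A * y ∈ partitions K (k + 1) (A ∪ U) := by
  refine Submodule.subset_span ⟨A, Finset.subset_union_left, hA, y, ?_, rfl⟩
  rwa [Finset.union_sdiff_cancel_left hd]

theorem partitions_induction {P : ℕ → Finset ι → Alg K ι → Prop} (hone : P 0 ∅ 1)
    (hmul : ∀ k U A y, A.Nonempty → Disjoint A U → y ∈ partitions K k U → P k U y →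
      P (k + 1) (A ∪ U) (FreeAlgebra.ι K A * y)) (hzero : ∀ k U, P k U 0)
    (hadd : ∀ k U x y, P k U x → P k U y → P k U (x + y))
    (hsmul : ∀ k U (c : K) x, P k U x → P k U (c • x)) {k : ℕ} {U : Finset ι} {x : Alg K ι}
    (hx : x ∈ partitions K k U) : P k U x := by
  induction k generalizing U x with
  | zero =>
    rw [partitions] at hx
    split_ifs at hx with hU
    · subst hU
      obtain ⟨c, rfl⟩ := Submodule.mem_span_singleton.1 hx
      exact hsmul _ _ _ _ hone
    · rw [Submodule.mem_bot] at hx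
      subst hx
      exact hzero _ _
  | succ k ih =>
    rw [partitions] at hx
    induction hx using Submodule.span_induction with
    | mem x hx =>
      obtain ⟨A, hAU, hA, y, hy, rfl⟩ := hx
      have := hmul k (U \ A) A y hA Finset.disjoint_sdiff hy (ih hy)
      rwa [Finset.union_sdiff_of_subset hAU] at this
    | zero => exact hzero _ _
    | add x y _ _ hx hy => exact hadd _ _ _ _ hx hy
    | smul c x _ hx => exact hsmul _ _ _ _ hx

theorem mul_mem_partitions {k l : ℕ} {U V : Finset ι} (hd : Disjoint U V) {x y : Alg K ι}
    (hx : x ∈ partitions K k U) (hy : y ∈ partitions K l V) :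
    x * y ∈ partitions K (k + l) (U ∪ V) := by
  revert hd
  refine partitions_induction (P := fun k U x => Disjoint U V →
    x * y ∈ partitions K (k + l) (U ∪ V)) ?_ ?_ ?_ ?_ ?_ hx
  · intro _
    rwa [one_mul, zero_add, Finset.empty_union]
  · intro k U A z hA hAU _ ih hd
    rw [Finset.disjoint_union_left] at hd
    rw [mul_assoc, Finset.union_assoc, add_right_comm]
    exact ι_mul_mem_partitions hA (Finset.disjoint_union_right.2 ⟨hAU, hd.1⟩) (ih hd.2)
  · intro k U _
    rw [zero_mul]
    exact Submodule.zero_mem _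
  · intro k U x z hx hz hd
    rw [add_mul]
    exact Submodule.add_mem _ (hx hd) (hz hd)
  · intro k U c x hx hd
    rw [smul_mul_assoc]
    exact Submodule.smul_mem _ _ (hx hd)

theorem ι_mem_partitions {A : Finset ι} (hA : A.Nonempty) :
    FreeAlgebra.ι K A ∈ partitions K 1 A := by
  have := ι_mul_mem_partitions hA (Finset.disjoint_empty_right A) (one_mem_partitions (K := K))
  rwa [mul_one, Finset.union_empty, zero_add] at this

section Homotopy

variable (e : ι)

/-- The operation which adds the element `e` to the first letter of a word. -/
noncomputable def merge : Alg K ι →ₗ[K] Alg K ι := ofWords fun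
  | [] => 0
  | A :: L => FreeAlgebra.ι K (insert e A) * word L

theorem merge_one : merge e (1 : Alg K ι) = 0 := ofWords_word _ []

theorem merge_ι_mul (A : Finset ι) (y : Alg K ι) :
    merge e (FreeAlgebra.ι K A * y) = FreeAlgebra.ι K (insert e A) * y := by
  have : merge e ∘ₗ LinearMap.mulLeft K (FreeAlgebra.ι K A) =
      LinearMap.mulLeft K (FreeAlgebra.ι K (insert e A)) := by
    refine (wordBasis K ι).ext fun L => ?_
    rw [wordBasis_apply]
    simp only [LinearMap.comp_apply, LinearMap.mulLeft_apply]
    rw [← word_cons]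
    exact ofWords_word _ (A :: L)
  exact DFunLike.congr_fun this y

/-- The homotopy on words: if `e` is a block of its own, it is merged with the next block; if `e`
lies in a larger block the result is zero. -/
noncomputable def homWord : List (Finset ι) → Alg K ι
  | [] => 0
  | A :: L => if e ∈ A then (if A = {e} then merge e (word L) else 0) else
      par K A.card • (FreeAlgebra.ι K A * homWord L)

/-- The homotopy. -/
noncomputable def hom : Alg K ι →ₗ[K] Alg K ι := ofWords (homWord e)

theorem hom_word_cons (A : Finset ι) (L : List (Finset ι)) :
    hom (K := K) e (FreeAlgebra.ι K A * word L) = homWord e (A :: L) := by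
  rw [← word_cons]
  exact ofWords_word _ (A :: L)

theorem hom_singleton_mul (y : Alg K ι) : hom e (FreeAlgebra.ι K {e} * y) = merge e y := by
  have : hom e ∘ₗ LinearMap.mulLeft K (FreeAlgebra.ι K {e}) = merge e := by
    refine (wordBasis K ι).ext fun L => ?_
    rw [wordBasis_apply]
    simp only [LinearMap.comp_apply, LinearMap.mulLeft_apply]
    rw [hom_word_cons, homWord, if_pos (Finset.mem_singleton_self e), if_pos rfl]
  exact DFunLike.congr_fun this y

theorem hom_mul_of_mem {A : Finset ι} (h : e ∈ A) (h' : A ≠ {e}) (y : Alg K ι) :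
    hom e (FreeAlgebra.ι K A * y) = 0 := by
  have : hom e ∘ₗ LinearMap.mulLeft K (FreeAlgebra.ι K A) = 0 := by
    refine (wordBasis K ι).ext fun L => ?_
    rw [wordBasis_apply]
    simp only [LinearMap.comp_apply, LinearMap.mulLeft_apply]
    rw [hom_word_cons, homWord, if_pos h, if_neg h', LinearMap.zero_apply]
  exact DFunLike.congr_fun this y

theorem hom_mul_of_notMem {A : Finset ι} (h : e ∉ A) (y : Alg K ι) :
    hom e (FreeAlgebra.ι K A * y) = par K A.card • (FreeAlgebra.ι K A * hom e y) := by
  have : hom e ∘ₗ LinearMap.mulLeft K (FreeAlgebra.ι K A) =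
      par K A.card • (LinearMap.mulLeft K (FreeAlgebra.ι K A) ∘ₗ hom e) := by
    refine (wordBasis K ι).ext fun L => ?_
    rw [wordBasis_apply]
    simp only [LinearMap.comp_apply, LinearMap.mulLeft_apply, LinearMap.smul_apply]
    rw [hom_word_cons, homWord, if_neg h, hom, ofWords_word]
  exact DFunLike.congr_fun this y

theorem hom_letter_mul_of_notMem {A : Finset ι} (h : e ∉ A) (y : Alg K ι) :
    hom e (letter K A * y) = par K A.card • (letter K A * hom e y) := by
  by_cases hA : A = ∅
  · rw [hA, letter_empty, zero_mul, zero_mul, map_zero, smul_zero]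
  · rw [letter_of_ne hA, hom_mul_of_notMem e h]

theorem hom_dLetter_mul {A : Finset ι} (h : e ∉ A) (y : Alg K ι) :
    hom e (dLetter A * y) = -par K A.card • (dLetter A * hom e y) := by
  rw [dLetter, Finset.sum_mul, Finset.sum_mul, map_sum, Finset.smul_sum]
  refine Finset.sum_congr rfl fun X hX => ?_
  rw [Finset.mem_powerset] at hX
  have h1 : A.card = X.card + (A \ X).card := by
    rw [add_comm, Finset.card_sdiff_add_card_eq_card hX]
  rw [smul_mul_assoc, map_smul, mul_assoc, hom_letter_mul_of_notMem e fun h' => h (hX h'),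
    hom_letter_mul_of_notMem e fun h' => h (Finset.mem_sdiff.1 h').1, smul_mul_assoc, smul_smul,
    mul_smul_comm, smul_smul, smul_smul, h1, par_add, ← mul_assoc (letter K X)]
  congr 1
  ring

/-- The map homotopic to the identity which moves the element `e` to the right. -/
noncomputable def move : Alg K ι →ₗ[K] Alg K ι := LinearMap.id - (d ∘ₗ hom e + hom e ∘ₗ d)

theorem move_apply (x : Alg K ι) : move e x = x - (d (hom e x) + hom e (d x)) := rfl

theorem move_mul_of_notMem {A : Finset ι} (h : e ∉ A) (y : Alg K ι) :
    move e (FreeAlgebra.ι K A * y) = FreeAlgebra.ι K A * move e y := by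
  rw [move_apply, move_apply, d_ι_mul, hom_mul_of_notMem e h, map_smul, d_ι_mul, map_add,
    hom_dLetter_mul e h, map_smul, hom_mul_of_notMem e h]
  simp only [smul_add, smul_smul, par_mul_self, one_smul, mul_sub, mul_add, neg_smul]
  abel

theorem move_singleton : move e (FreeAlgebra.ι K {e}) = FreeAlgebra.ι K {e} := by
  have h := hom_singleton_mul (K := K) e 1
  rw [mul_one, merge_one] at h
  rw [move_apply, d_ι, dLetter_singleton, h]
  simp

/-- The part of the differential of `{e} ∪ B` in which `e` lies in the second factor. -/
def dRight (B : Finset ι) : Alg K ι :=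
  ∑ X ∈ B.powerset, (par K X.card * sgn K X (insert e (B \ X))) •
    (letter K X * letter K (insert e (B \ X)))

/-- The part of the differential of `{e} ∪ B` in which `e` lies in the first factor, with the
opposite sign. -/
def dLeft (B : Finset ι) : Alg K ι :=
  ∑ X ∈ B.powerset, (par K X.card * sgn K X (B \ X)) •
    (letter K (insert e X) * letter K (B \ X))

theorem sgn_singleton_of_lt {Z : Finset ι} (h : ∀ z ∈ Z, e < z) : sgn K {e} Z = 1 := by
  have : inversions {e} Z = 0 := by
    rw [inversions, Finset.card_eq_zero, Finset.filter_eq_empty_iff]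
    rintro ⟨x, z⟩ hx
    simp only [Finset.mem_product, Finset.mem_singleton] at hx
    rw [hx.1]
    exact not_lt.2 (h z hx.2).le
  rw [sgn, this, pow_zero]

variable {e}

/-- The splittings of `{e} ∪ B` are sorted by the part which contains the least element `e`. -/
theorem dLetter_insert {B : Finset ι} (h : ∀ z ∈ B, e < z) :
    dLetter (K := K) (insert e B) = dRight e B - dLeft e B := by
  have he : e ∉ B := fun h' => lt_irrefl _ (h e h')
  rw [dLetter, Finset.sum_powerset_insert he, sub_eq_add_neg, dRight, dLeft,
    ← Finset.sum_neg_distrib]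
  congr 1
  · refine Finset.sum_congr rfl fun X hX => ?_
    rw [Finset.mem_powerset] at hX
    rw [Finset.insert_sdiff_of_notMem _ fun h' => he (hX h')]
  · refine Finset.sum_congr rfl fun X hX => ?_
    rw [Finset.mem_powerset] at hX
    have heX : e ∉ X := fun h' => he (hX h')
    have h1 : insert e B \ insert e X = B \ X := by
      rw [Finset.insert_sdiff_insert, Finset.sdiff_insert_of_notMem he]
    have h2 : sgn K (insert e X) (B \ X) = sgn K X (B \ X) := by
      rw [Finset.insert_eq, sgn_union_left _ (Finset.disjoint_singleton_left.2 heX),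
        sgn_singleton_of_lt e fun z hz => h z (Finset.mem_sdiff.1 hz).1, one_mul]
    rw [h1, h2, Finset.card_insert_of_notMem heX, par_add, ← neg_smul]
    congr 1
    simp [par]

theorem merge_letter_mul (A : Finset ι) (y : Alg K ι) : merge e (letter K A * y) =
    (if A = ∅ then 0 else letter K (insert e A) * y) := by
  split_ifs with h
  · rw [h, letter_empty, zero_mul, map_zero]
  · rw [letter_of_ne h, merge_ι_mul, letter_of_ne (Finset.insert_ne_empty _ _)]

theorem par_zero : par K 0 = -1 := by simp [par]

theorem sgn_empty_left (Z : Finset ι) : sgn K ∅ Z = 1 := by simp [sgn, inversions]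

theorem merge_dLetter_mul (B : Finset ι) (y : Alg K ι) :
    merge e (dLetter B * y) = dLeft e B * y + letter K {e} * (letter K B * y) := by
  have h : ∀ X ∈ B.powerset, (par K X.card * sgn K X (B \ X)) •
      merge e (letter K X * (letter K (B \ X) * y)) =
      (par K X.card * sgn K X (B \ X)) • (letter K (insert e X) * (letter K (B \ X) * y)) +
      (if X = ∅ then letter K {e} * (letter K B * y) else 0) := by
    intro X _
    rw [merge_letter_mul]
    split_ifs with hX
    · subst hX
      rw [Finset.card_empty, par_zero, sgn_empty_left, Finset.sdiff_empty,
        LawfulSingleton.insert_empty_eq]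
      simp
    · rw [add_zero]
  simp only [dLetter, dLeft, Finset.sum_mul, map_sum, smul_mul_assoc, map_smul, mul_assoc]
  rw [Finset.sum_congr rfl h, Finset.sum_add_distrib, Finset.sum_ite_eq',
    if_pos (Finset.empty_mem_powerset B)]

theorem hom_letter_mul_of_mem {A : Finset ι} (h : e ∈ A) (y : Alg K ι) :
    hom e (letter K A * y) = if A = {e} then merge e y else 0 := by
  rw [letter_of_ne (Finset.ne_empty_of_mem h)]
  split_ifs with h'
  · rw [h', hom_singleton_mul]
  · exact hom_mul_of_mem e h h' y

theorem hom_dLeft_mul {B : Finset ι} (he : e ∉ B) (y : Alg K ι) :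
    hom e (dLeft e B * y) = -merge e (letter K B * y) := by
  have h : ∀ X ∈ B.powerset, (par K X.card * sgn K X (B \ X)) •
      hom e (letter K (insert e X) * (letter K (B \ X) * y)) =
      (if X = ∅ then -merge e (letter K B * y) else 0) := by
    intro X hX
    rw [Finset.mem_powerset] at hX
    rw [hom_letter_mul_of_mem (Finset.mem_insert_self e X)]
    split_ifs with h1 h2 h2
    · subst h2
      rw [Finset.card_empty, par_zero, sgn_empty_left, Finset.sdiff_empty, mul_one, neg_smul,
        one_smul]
    · obtain ⟨x, hx⟩ := Finset.nonempty_iff_ne_empty.2 h2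
      have : x ∈ ({e} : Finset ι) := h1 ▸ Finset.mem_insert_of_mem hx
      rw [Finset.mem_singleton] at this
      exact absurd (hX (this ▸ hx)) he
    · exact absurd (by rw [h2, LawfulSingleton.insert_empty_eq]) h1
    · rw [smul_zero]
  simp only [dLeft, Finset.sum_mul, map_sum, smul_mul_assoc, map_smul, mul_assoc]
  rw [Finset.sum_congr rfl h, Finset.sum_ite_eq', if_pos (Finset.empty_mem_powerset B)]

theorem hom_dRight_mul {B : Finset ι} (he : e ∉ B) (y : Alg K ι) :
    hom e (dRight e B * y) = sgn K B {e} • (letter K B * merge e y) := by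
  have h : ∀ X ∈ B.powerset, (par K X.card * sgn K X (insert e (B \ X))) •
      hom e (letter K X * (letter K (insert e (B \ X)) * y)) =
      (if X = B then sgn K B {e} • (letter K B * merge e y) else 0) := by
    intro X hX
    rw [Finset.mem_powerset] at hX
    rw [hom_letter_mul_of_notMem e fun h' => he (hX h'),
      hom_letter_mul_of_mem (Finset.mem_insert_self e _)]
    split_ifs with h1 h2 h2
    · subst h2
      rw [Finset.sdiff_self, LawfulSingleton.insert_empty_eq, smul_smul, mul_right_comm,
        par_mul_self, one_mul]
    · refine absurd (Finset.Subset.antisymm hX fun x hx => ?_) h2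
      by_contra hxX
      have : x ∈ ({e} : Finset ι) :=
        h1 ▸ Finset.mem_insert_of_mem (Finset.mem_sdiff.2 ⟨hx, hxX⟩)
      rw [Finset.mem_singleton] at this
      exact he (this ▸ hx)
    · exact absurd (by rw [h2, Finset.sdiff_self, LawfulSingleton.insert_empty_eq]) h1
    · rw [mul_zero, smul_zero, smul_zero]
  simp only [dRight, Finset.sum_mul, map_sum, smul_mul_assoc, map_smul, mul_assoc]
  rw [Finset.sum_congr rfl h, Finset.sum_ite_eq', if_pos (Finset.mem_powerset_self B)]

theorem par_one : par K 1 = 1 := by simp [par]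

/-- A block `{e}` followed by `B` is replaced by words in which a part of `B` comes before `e`. -/
theorem move_singleton_mul {B : Finset ι} (hB : B.Nonempty) (h : ∀ z ∈ B, e < z) (y : Alg K ι) :
    move e (FreeAlgebra.ι K {e} * (FreeAlgebra.ι K B * y)) = -(dRight e B * y) := by
  have hc : par K (insert e B).card = -par K B.card := by
    rw [Finset.card_insert_of_notMem fun h' => lt_irrefl _ (h e h'), par_add, par_one, mul_one]
  have h1 : FreeAlgebra.ι K {e} = letter K {e} := (letter_of_ne (Finset.singleton_ne_empty e)).symm
  rw [move_apply, hom_singleton_mul, merge_ι_mul, d_ι_mul, dLetter_insert h, hc, d_ι_mul,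
    dLetter_singleton, zero_mul, zero_add, d_ι_mul, Finset.card_singleton, par_one, one_smul,
    hom_singleton_mul, map_add, merge_dLetter_mul, map_smul, merge_ι_mul,
    letter_of_ne hB.ne_empty, h1]
  simp only [sub_mul, neg_smul]
  abel

/-- If `e` lies in a larger block, then this block loses `e` to the next one, and the word becomes
zero if there is no next block. -/
theorem move_insert_mul {B : Finset ι} (hB : B.Nonempty) (h : ∀ z ∈ B, e < z) (y : Alg K ι) :
    move e (FreeAlgebra.ι K (insert e B) * y) =
      -(sgn K B {e} • (FreeAlgebra.ι K B * merge e y)) := by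
  have he : e ∉ B := fun h' => lt_irrefl _ (h e h')
  have hne : insert e B ≠ {e} := by
    obtain ⟨b, hb⟩ := hB
    intro h'
    have : b ∈ ({e} : Finset ι) := h' ▸ Finset.mem_insert_of_mem hb
    rw [Finset.mem_singleton] at this
    exact he (this ▸ hb)
  rw [move_apply, d_ι_mul, dLetter_insert h, map_add, map_smul,
    hom_mul_of_mem e (Finset.mem_insert_self e B) hne,
    hom_mul_of_mem e (Finset.mem_insert_self e B) hne, sub_mul, map_sub, hom_dRight_mul he,
    hom_dLeft_mul he, letter_of_ne hB.ne_empty, merge_ι_mul]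
  simp

theorem move_mul_of_mem_partitions {k : ℕ} {U : Finset ι} {x : Alg K ι}
    (hx : x ∈ partitions K k U) (he : e ∉ U) (y : Alg K ι) : move e (x * y) = x * move e y := by
  revert he
  refine partitions_induction (P := fun _ U x => e ∉ U → move e (x * y) = x * move e y)
    ?_ ?_ ?_ ?_ ?_ hx
  · intro _
    rw [one_mul, one_mul]
  · intro k U A z _ _ _ ih he
    rw [Finset.mem_union, not_or] at he
    rw [mul_assoc, move_mul_of_notMem e he.1, ih he.2, mul_assoc]
  · intro k U _
    rw [zero_mul, map_zero, zero_mul]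
  · intro k U x z hx hz he
    rw [add_mul, map_add, hx he, hz he, add_mul]
  · intro k U c x hx he
    rw [smul_mul_assoc, map_smul, hx he, smul_mul_assoc]

/-- The span of the ordered partitions of `{e} ∪ U` with at most `j` elements in the blocks after
that of `e`, where the other elements in the block of `e` count, too. -/
def filtration (K : Type u) [Field K] (e : ι) (U : Finset ι) (k j : ℕ) : Submodule K (Alg K ι) :=
  Submodule.span K {x | ∃ (i l : ℕ) (U₁ B U₂ : Finset ι), U₁ ∪ B ∪ U₂ = U ∧ Disjoint U₁ B ∧
    Disjoint (U₁ ∪ B) U₂ ∧ i + 1 + l = k ∧ B.card + U₂.card ≤ j ∧ ∃ p ∈ partitions K i U₁,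
    ∃ q ∈ partitions K l U₂, x = p * (FreeAlgebra.ι K (insert e B) * q)}

/-- Each application of `move` decreases the number of elements which are not in front of the least
element `e`. -/
theorem move_mem_filtration {U : Finset ι} (hU : ∀ z ∈ U, e < z) {k j : ℕ} {x : Alg K ι}
    (hx : x ∈ filtration K e U k j) : move e x ∈ filtration K e U k (j - 1) := by
  rw [filtration] at hx
  induction hx using Submodule.span_induction with
  | zero => rw [map_zero]; exact Submodule.zero_mem _
  | add x y _ _ hx hy => rw [map_add]; exact Submodule.add_mem _ hx hy
  | smul c x _ hx => rw [map_smul]; exact Submodule.smul_mem _ _ hx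
  | mem x hx =>
    obtain ⟨i, l, U₁, B, U₂, rfl, hd₁, hd₂, hk, hj, p, hp, q, hq, rfl⟩ := hx
    have he : ∀ {V : Finset ι}, V ⊆ U₁ ∪ B ∪ U₂ → e ∉ V := fun hV h => lt_irrefl _ (hU e (hV h))
    have hs1 : U₁ ⊆ U₁ ∪ B ∪ U₂ := Finset.subset_union_left.trans Finset.subset_union_left
    have hsB : B ⊆ U₁ ∪ B ∪ U₂ := Finset.subset_union_right.trans Finset.subset_union_left
    have hs2 : U₂ ⊆ U₁ ∪ B ∪ U₂ := Finset.subset_union_right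
    rw [move_mul_of_mem_partitions hp (he hs1)]
    cases l with
    | zero =>
      -- the block of `e` is the last one
      by_cases hU₂ : U₂ = ∅
      · rw [partitions, if_pos hU₂] at hq
        obtain ⟨c, rfl⟩ := Submodule.mem_span_singleton.1 hq
        rw [mul_smul_comm, map_smul, mul_smul_comm]
        refine Submodule.smul_mem _ _ ?_
        rcases Finset.eq_empty_or_nonempty B with rfl | hB
        · rw [LawfulSingleton.insert_empty_eq, mul_one, move_singleton]
          refine Submodule.subset_span ⟨i, 0, U₁, ∅, U₂, rfl, hd₁, hd₂, hk, ?_, p, hp, 1, ?_, ?_⟩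
          · simp [hU₂]
          · rw [hU₂]; exact one_mem_partitions
          · rw [mul_one, LawfulSingleton.insert_empty_eq]
        · rw [move_insert_mul hB fun z hz => hU z (hsB hz), merge_one]
          simp
      · rw [eq_zero_of_mem_partitions_zero (Finset.nonempty_iff_ne_empty.2 hU₂) hq]
        simp
    | succ l =>
      rw [partitions] at hq
      induction hq using Submodule.span_induction with
      | zero => simp
      | add x y _ _ hx hy => rw [mul_add, map_add, mul_add]; exact Submodule.add_mem _ hx hy
      | smul c x _ hx =>
        rw [mul_smul_comm, map_smul, mul_smul_comm]; exact Submodule.smul_mem _ _ hx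
      | mem x hx =>
        -- the block of `e` is followed by the block `A`
        obtain ⟨A, hA, hne, q, hq, rfl⟩ := hx
        have hcard := Finset.card_sdiff_add_card_eq_card hA
        have hpos := hne.card_pos
        rcases Finset.eq_empty_or_nonempty B with rfl | hB
        · rw [LawfulSingleton.insert_empty_eq,
            move_singleton_mul hne fun z hz => hU z (hs2 (hA hz)),
            dRight, Finset.sum_mul, mul_neg, Finset.mul_sum]
          refine Submodule.neg_mem _ (Submodule.sum_mem _ fun X hX => ?_)
          rw [Finset.mem_powerset] at hX
          rw [smul_mul_assoc, mul_smul_comm]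
          refine Submodule.smul_mem _ _ ?_
          rcases Finset.eq_empty_or_nonempty X with rfl | hXne
          · simp
          · have hcard' := Finset.card_sdiff_add_card_eq_card hX
            have hpos' := hXne.card_pos
            have hd3 : Disjoint U₁ X := Finset.disjoint_of_subset_right (hX.trans hA)
              (by simpa using hd₂)
            refine Submodule.subset_span ⟨i + 1, l, U₁ ∪ X, A \ X, U₂ \ A, ?_, ?_, ?_, by omega, ?_,
              p * FreeAlgebra.ι K X, mul_mem_partitions hd3 hp (ι_mem_partitions hXne), q, hq, ?_⟩
            · rw [Finset.union_assoc U₁, Finset.union_sdiff_of_subset hX, Finset.union_assoc,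
                Finset.union_sdiff_of_subset hA, Finset.union_empty]
            · rw [Finset.disjoint_union_left]
              exact ⟨Finset.disjoint_of_subset_right (Finset.sdiff_subset.trans hA)
                (by simpa using hd₂), Finset.disjoint_sdiff⟩
            · rw [Finset.union_assoc U₁, Finset.union_sdiff_of_subset hX,
                Finset.disjoint_union_left]
              exact ⟨Finset.disjoint_of_subset_right Finset.sdiff_subset (by simpa using hd₂),
                Finset.disjoint_sdiff⟩
            · rw [Finset.card_empty] at hj
              omega
            · rw [letter_of_ne hXne.ne_empty, letter_of_ne (Finset.insert_ne_empty _ _)]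
              simp only [mul_assoc]
        · rw [move_insert_mul hB fun z hz => hU z (hsB hz), merge_ι_mul, mul_neg, mul_smul_comm]
          refine Submodule.neg_mem _ (Submodule.smul_mem _ _ (Submodule.subset_span
            ⟨i + 1, l, U₁ ∪ B, A, U₂ \ A, ?_, ?_, ?_, by omega, ?_,
              p * FreeAlgebra.ι K B, mul_mem_partitions hd₁ hp (ι_mem_partitions hB), q, hq, ?_⟩))
          · rw [Finset.union_assoc, Finset.union_sdiff_of_subset hA]
          · exact Finset.disjoint_of_subset_right hA hd₂
          · rw [Finset.disjoint_union_left]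
            exact ⟨Finset.disjoint_of_subset_right Finset.sdiff_subset hd₂, Finset.disjoint_sdiff⟩
          · have := hB.card_pos
            omega
          · simp only [mul_assoc]

end Homotopy

end SetWord

namespace SetWord

variable {K : Type u} [Field K] {ι : Type} [LinearOrder ι]

/-- The last step of the filtration contains all ordered partitions. -/
theorem partitions_le_filtration {e : ι} {U : Finset ι} (he : e ∉ U) {k : ℕ} {x : Alg K ι}
    (hx : x ∈ partitions K k (insert e U)) : x ∈ filtration K e U k U.card := by
  -- the induction removes first blocks, so that it needs a variable ground set with `e ∈ V`
  have key : ∀ V, e ∈ V → V = insert e U → x ∈ filtration K e (V.erase e) k (V.erase e).card := by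
    intro V hV hVU
    rw [← hVU] at hx
    clear hVU he
    revert hV
    refine partitions_induction (P := fun k V x => e ∈ V →
      x ∈ filtration K e (V.erase e) k (V.erase e).card) ?_ ?_ ?_ ?_ ?_ hx
    · intro h
      exact absurd h (Finset.notMem_empty e)
    · intro k V A y hA hd hy ih he
      by_cases heA : e ∈ A
      · have heV : e ∉ V := Finset.disjoint_left.1 hd heA
        have h1 : (A ∪ V).erase e = A.erase e ∪ V := by
          rw [Finset.erase_union_distrib, Finset.erase_eq_of_notMem heV]
        have hd' : Disjoint (A.erase e) V :=
          Finset.disjoint_of_subset_left (Finset.erase_subset _ _) hd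
        refine Submodule.subset_span ⟨0, k, ∅, A.erase e, V, ?_, Finset.disjoint_empty_left _, ?_,
          by omega, ?_, 1, one_mem_partitions, y, hy, ?_⟩
        · rw [h1, Finset.empty_union]
        · rwa [Finset.empty_union]
        · rw [h1, Finset.card_union_of_disjoint hd']
        · rw [one_mul, Finset.insert_erase heA]
      · have heV : e ∈ V := (Finset.mem_union.1 he).resolve_left heA
        have h1 : (A ∪ V).erase e = A ∪ V.erase e := by
          rw [Finset.erase_union_distrib, Finset.erase_eq_of_notMem heA]
        have hd' : Disjoint A (V.erase e) :=
          Finset.disjoint_of_subset_right (Finset.erase_subset _ _) hd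
        rw [h1]
        have h2 := ih heV
        clear hy ih
        rw [filtration] at h2
        induction h2 using Submodule.span_induction with
        | zero => rw [mul_zero]; exact Submodule.zero_mem _
        | add x y _ _ hx hy => rw [mul_add]; exact Submodule.add_mem _ hx hy
        | smul c x _ hx => rw [mul_smul_comm]; exact Submodule.smul_mem _ _ hx
        | mem x hx =>
          obtain ⟨i, l, U₁, B, U₂, hU, hd₁, hd₂, hk, hj, p, hp, q, hq, rfl⟩ := hx
          rw [← hU, Finset.disjoint_union_right, Finset.disjoint_union_right] at hd'
          refine Submodule.subset_span ⟨i + 1, l, A ∪ U₁, B, U₂, ?_, ?_, ?_, by omega, ?_,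
            FreeAlgebra.ι K A * p, ι_mul_mem_partitions hA hd'.1.1 hp, q, hq, ?_⟩
          · rw [← hU, Finset.union_assoc A, Finset.union_assoc A]
          · rw [Finset.disjoint_union_left]
            exact ⟨hd'.1.2, hd₁⟩
          · rw [Finset.union_assoc, Finset.disjoint_union_left]
            exact ⟨hd'.2, hd₂⟩
          · exact hj.trans (Finset.card_le_card Finset.subset_union_right)
          · simp only [mul_assoc]
    · exact fun k V _ => Submodule.zero_mem _
    · exact fun k V x y hx hy he => Submodule.add_mem _ (hx he) (hy he)
    · exact fun k V c x hx he => Submodule.smul_mem _ _ (hx he)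
  have := key _ (Finset.mem_insert_self e U) rfl
  rwa [Finset.erase_insert he] at this

theorem merge_mem_partitions {e : ι} {k : ℕ} {U : Finset ι} (he : e ∉ U) {x : Alg K ι}
    (hx : x ∈ partitions K k U) : merge e x ∈ partitions K k (insert e U) := by
  revert he
  refine partitions_induction (P := fun k U x => e ∉ U → merge e x ∈ partitions K k (insert e U))
    ?_ ?_ ?_ ?_ ?_ hx
  · intro _
    rw [merge_one]
    exact Submodule.zero_mem _
  · intro k U A y hA hd hy _ he
    rw [Finset.mem_union, not_or] at he
    rw [merge_ι_mul, ← Finset.insert_union]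
    exact ι_mul_mem_partitions (Finset.insert_nonempty _ _)
      (Finset.disjoint_insert_left.2 ⟨he.2, hd⟩) hy
  · intro k U _
    rw [map_zero]
    exact Submodule.zero_mem _
  · intro k U x y hx hy he
    rw [map_add]
    exact Submodule.add_mem _ (hx he) (hy he)
  · intro k U c x hx he
    rw [map_smul]
    exact Submodule.smul_mem _ _ (hx he)

/-- The span of the ordered partitions of `U` into `k - 1` blocks. -/
def partitionsPred (K : Type u) [Field K] {ι : Type} [LinearOrder ι] (U : Finset ι) :
    ℕ → Submodule K (Alg K ι)
  | 0 => ⊥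
  | k + 1 => partitions K k U

theorem hom_mem_partitions {e : ι} {k : ℕ} {U : Finset ι} (he : e ∈ U) {x : Alg K ι}
    (hx : x ∈ partitions K k U) : hom e x ∈ partitionsPred K U k := by
  revert he
  refine partitions_induction (P := fun k U x => e ∈ U → hom e x ∈ partitionsPred K U k)
    ?_ ?_ ?_ ?_ ?_ hx
  · intro h
    exact absurd h (Finset.notMem_empty e)
  · intro k U A y hA hd hy ih he
    change _ ∈ partitions K k (A ∪ U)
    by_cases heA : e ∈ A
    · have heU : e ∉ U := Finset.disjoint_left.1 hd heA
      by_cases hA' : A = {e}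
      · rw [hA', hom_singleton_mul, ← Finset.insert_eq]
        exact merge_mem_partitions heU hy
      · rw [hom_mul_of_mem e heA hA']
        exact Submodule.zero_mem _
    · have heU : e ∈ U := (Finset.mem_union.1 he).resolve_left heA
      rw [hom_mul_of_notMem e heA]
      refine Submodule.smul_mem _ _ ?_
      cases k with
      | zero => 
        rw [eq_zero_of_mem_partitions_zero ⟨e, heU⟩ hy, map_zero, mul_zero]
        exact Submodule.zero_mem _
      | succ k => exact ι_mul_mem_partitions hA hd (ih heU)
  · intro k U _
    rw [map_zero]
    exact Submodule.zero_mem _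
  · intro k U x y hx hy he
    rw [map_add]
    exact Submodule.add_mem _ (hx he) (hy he)
  · intro k U c x hx he
    rw [map_smul]
    exact Submodule.smul_mem _ _ (hx he)

theorem filtration_le_partitions {e : ι} {U : Finset ι} (he : e ∉ U) {k j : ℕ} {x : Alg K ι}
    (hx : x ∈ filtration K e U k j) : x ∈ partitions K k (insert e U) := by
  rw [filtration] at hx
  induction hx using Submodule.span_induction with
  | zero => exact Submodule.zero_mem _
  | add x y _ _ hx hy => exact Submodule.add_mem _ hx hy
  | smul c x _ hx => exact Submodule.smul_mem _ _ hx
  | mem x hx =>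
    obtain ⟨i, l, U₁, B, U₂, rfl, hd₁, hd₂, rfl, hj, p, hp, q, hq, rfl⟩ := hx
    simp only [Finset.mem_union, not_or] at he
    rw [Finset.disjoint_union_left] at hd₂
    have h1 := ι_mul_mem_partitions (A := insert e B) (Finset.insert_nonempty _ _)
      (Finset.disjoint_insert_left.2 ⟨he.2, hd₂.2⟩) hq
    have h2 := mul_mem_partitions (U := U₁) (Finset.disjoint_union_right.2
      ⟨Finset.disjoint_insert_right.2 ⟨he.1.1, hd₁⟩, hd₂.1⟩) hp h1
    rw [show i + 1 + l = i + (l + 1) by omega]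
    rwa [← Finset.union_assoc, Finset.union_insert, Finset.insert_union] at h2

/-- Since `move` is homotopic to the identity, repeated application of it makes every cycle
homologous to one in the bottom step of the filtration. -/
theorem exists_homologous {e : ι} {U : Finset ι} (hU : ∀ z ∈ U, e < z) {k : ℕ} (j : ℕ)
    {z : Alg K ι} (hz : z ∈ filtration K e U k j) (hdz : d z = 0) :
    ∃ w ∈ partitionsPred K (insert e U) k, ∃ y ∈ filtration K e U k 0, z = d w + y := by
  have he : e ∉ U := fun h => lt_irrefl _ (hU e h)
  induction j generalizing z with
  | zero => exact ⟨0, Submodule.zero_mem _, z, hz, by rw [map_zero, zero_add]⟩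
  | succ j ih =>
    have h1 := move_mem_filtration hU hz
    have h2 : move e z = z - d (hom e z) := by
      rw [move_apply, hdz, map_zero, add_zero]
    obtain ⟨w, hw, y, hy, h⟩ := ih h1 (by rw [h2, map_sub, d_d, hdz, sub_zero])
    refine ⟨hom e z + w, Submodule.add_mem _ (hom_mem_partitions (Finset.mem_insert_self e U)
      (filtration_le_partitions he hz)) hw, y, hy, ?_⟩
    rw [map_add, add_assoc, ← h, h2]
    abel

theorem eq_zero_of_mem_partitions_succ_empty {k : ℕ} {q : Alg K ι}
    (hq : q ∈ partitions K (k + 1) ∅) : q = 0 := by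
  rw [partitions] at hq
  induction hq using Submodule.span_induction with
  | zero => rfl
  | add x y _ _ hx hy => rw [hx, hy, add_zero]
  | smul c x _ hx => rw [hx, smul_zero]
  | mem x hx =>
    obtain ⟨A, hA, hne, -⟩ := hx
    exact absurd (Finset.subset_empty.1 hA) hne.ne_empty

/-- In the bottom step of the filtration, the last block of every ordered partition is `{e}`. -/
theorem exists_of_mem_filtration_zero {e : ι} {U : Finset ι} {k : ℕ} {z : Alg K ι}
    (hz : z ∈ filtration K e U (k + 1) 0) :
    ∃ y ∈ partitions K k U, z = y * FreeAlgebra.ι K {e} := by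
  rw [filtration] at hz
  induction hz using Submodule.span_induction with
  | zero => exact ⟨0, Submodule.zero_mem _, by rw [zero_mul]⟩
  | add x y _ _ hx hy =>
    obtain ⟨x, hx, rfl⟩ := hx
    obtain ⟨y, hy, rfl⟩ := hy
    exact ⟨x + y, Submodule.add_mem _ hx hy, by rw [add_mul]⟩
  | smul c x _ hx =>
    obtain ⟨x, hx, rfl⟩ := hx
    exact ⟨c • x, Submodule.smul_mem _ _ hx, by rw [smul_mul_assoc]⟩
  | mem x hx =>
    obtain ⟨i, l, U₁, B, U₂, rfl, hd₁, hd₂, hk, hj, p, hp, q, hq, rfl⟩ := hx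
    obtain rfl : B = ∅ := Finset.card_eq_zero.1 (by omega)
    obtain rfl : U₂ = ∅ := Finset.card_eq_zero.1 (by omega)
    rw [Finset.union_empty, Finset.union_empty]
    cases l with
    | zero =>
      obtain rfl : i = k := by omega
      rw [partitions, if_pos rfl] at hq
      obtain ⟨c, rfl⟩ := Submodule.mem_span_singleton.1 hq
      refine ⟨c • p, Submodule.smul_mem _ _ hp, ?_⟩
      rw [mul_smul_comm, mul_one, mul_smul_comm, smul_mul_assoc, LawfulSingleton.insert_empty_eq]
    | succ l =>
      refine ⟨0, Submodule.zero_mem _, ?_⟩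
      rw [eq_zero_of_mem_partitions_succ_empty hq, mul_zero, mul_zero, zero_mul]

/-- The augmentation, which is `1` on the singletons and `0` on all other sets. -/
def aug (K : Type u) [Field K] (ι : Type) : Alg K ι →ₐ[K] K :=
  FreeAlgebra.lift K fun A => if A.card = 1 then 1 else 0

omit [LinearOrder ι] in
theorem aug_ι (A : Finset ι) : aug K ι (FreeAlgebra.ι K A) = if A.card = 1 then 1 else 0 := by
  rw [aug, FreeAlgebra.lift_ι_apply]

theorem aug_letter (A : Finset ι) : aug K ι (letter K A) = if A.card = 1 then 1 else 0 := by
  by_cases hA : A = ∅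
  · rw [hA, letter_empty, map_zero]
    simp
  · rw [letter_of_ne hA, aug_ι]

/-- Only sets with two elements split into singletons. They do so in two ways, with opposite
signs. -/
theorem aug_dLetter (A : Finset ι) : aug K ι (dLetter A) = 0 := by
  rw [dLetter, map_sum]
  by_cases hA : A.card = 2
  · obtain ⟨a, b, hab, rfl⟩ : ∃ a b : ι, a < b ∧ A = {a, b} := by
      obtain ⟨a, b, hab, rfl⟩ := Finset.card_eq_two.1 hA
      rcases lt_or_gt_of_ne hab with h | h
      · exact ⟨a, b, h, rfl⟩
      · exact ⟨b, a, h, Finset.pair_comm a b⟩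
    have h1 : ({a, b} : Finset ι) \ {a} = {b} := by
      ext x; simp; grind
    have h2 : ({a, b} : Finset ι) \ {b} = {a} := by
      ext x; simp; grind
    have h3 : (insert a {b} : Finset ι).powerset = {∅, {b}, {a}, {a, b}} := by
      ext X
      simp only [Finset.powerset_insert, Finset.mem_union, Finset.mem_image,
        Finset.mem_powerset, Finset.subset_singleton_iff, Finset.mem_insert, Finset.mem_singleton]
      simp [eq_comm, or_assoc]
    have h4 : sgn K {a} {b} = 1 := by
      simp [sgn, inversions, Finset.filter_singleton, not_lt.2 hab.le]
    have h5 : sgn K {b} {a} = -1 := by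
      simp [sgn, inversions, Finset.filter_singleton, hab]
    have h6 : ({a, b} : Finset ι) ≠ ∅ := Finset.insert_ne_empty _ _
    have h7 : ({b} : Finset ι) ≠ {a} := fun h => hab.ne (Finset.singleton_inj.1 h).symm
    have h8 : ({b} : Finset ι) ≠ {a, b} := fun h => by
      have := congrArg Finset.card h
      rw [hA, Finset.card_singleton] at this
      omega
    have h9 : ({a} : Finset ι) ≠ {a, b} := fun h => by
      have := congrArg Finset.card h
      rw [hA, Finset.card_singleton] at this
      omega
    rw [h3, Finset.sum_insert (by simp [h6.symm, (Finset.singleton_ne_empty _).symm]),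
      Finset.sum_insert (by simp only [Finset.mem_insert, Finset.mem_singleton]; tauto),
      Finset.sum_insert (by simp only [Finset.mem_singleton]; exact h9), Finset.sum_singleton]
    simp only [map_smul, map_mul, aug_letter, h1, h2, h4, h5, Finset.card_singleton,
      Finset.card_empty, Finset.sdiff_self]
    simp [par]
  · refine Finset.sum_eq_zero fun X hX => ?_
    have := Finset.card_sdiff_add_card_eq_card (Finset.mem_powerset.1 hX)
    rw [map_smul, map_mul, aug_letter, aug_letter]
    by_cases h1 : X.card = 1
    · rw [if_neg (c := (A \ X).card = 1) (by omega), mul_zero, smul_zero]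
    · rw [if_neg h1, zero_mul, smul_zero]

theorem aug_d (x : Alg K ι) : aug K ι (d x) = 0 := by
  induction x using induction with
  | hone => rw [d_one, map_zero]
  | hmul A x ih => rw [d_ι_mul, map_add, map_mul, map_smul, map_mul, aug_dLetter, ih]; simp
  | hadd x x' h h' => rw [map_add, map_add, h, h', add_zero]
  | hsmul c x h => rw [map_smul, map_smul, h, smul_zero]

/-- The complex of ordered partitions of `U` has the homology of a point: every cycle is homologous
to a multiple of one fixed ordered partition into singletons. -/
theorem exists_eq_d_add_smul (U : Finset ι) : ∃ v ∈ partitions K U.card U, aug K ι v = 1 ∧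
    ∀ k, ∀ z ∈ partitions K k U, d z = 0 → ∃ w ∈ partitionsPred K U k, ∃ c : K,
      z = d w + c • v ∧ (k ≠ U.card → c = 0) := by
  induction U using Finset.induction_on_min with
  | empty =>
    refine ⟨1, one_mem_partitions, map_one _, fun k z hz _ => ⟨0, Submodule.zero_mem _, ?_⟩⟩
    cases k with
    | zero =>
      rw [partitions, if_pos rfl] at hz
      obtain ⟨c, rfl⟩ := Submodule.mem_span_singleton.1 hz
      exact ⟨c, by rw [map_zero, zero_add], fun h => absurd rfl h⟩
    | succ k =>
      refine ⟨0, ?_, fun _ => rfl⟩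
      rw [map_zero, zero_smul, add_zero]
      exact eq_zero_of_mem_partitions_succ_empty hz
  | insert e U hU ih =>
    obtain ⟨v, hv, hv1, ih⟩ := ih
    have he : e ∉ U := fun h => lt_irrefl _ (hU e h)
    have hd : Disjoint U {e} := Finset.disjoint_singleton_right.2 he
    have hins : U ∪ {e} = insert e U := by rw [Finset.union_comm, ← Finset.insert_eq]
    have hmul : ∀ {l y}, y ∈ partitions K l U →
        y * FreeAlgebra.ι K {e} ∈ partitions K (l + 1) (insert e U) := by
      intro l y hy
      rw [← hins]
      exact mul_mem_partitions hd hy (ι_mem_partitions (Finset.singleton_nonempty e))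
    -- appending the block `{e}` commutes with the differential, so that the induction hypothesis
    -- can be applied to what precedes this block
    have hdmul : ∀ y : Alg K ι, d (y * FreeAlgebra.ι K {e}) = d y * FreeAlgebra.ι K {e} := by
      intro y
      rw [d_mul, d_ι, dLetter_singleton, mul_zero, add_zero]
    refine ⟨v * FreeAlgebra.ι K {e}, ?_, ?_, fun k z hz hdz => ?_⟩
    · rw [Finset.card_insert_of_notMem he]
      exact hmul hv
    · rw [map_mul, hv1, aug_ι, if_pos (Finset.card_singleton e), mul_one]
    · cases k with
      | zero =>
        refine ⟨0, Submodule.zero_mem _, 0, ?_, fun _ => rfl⟩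
        rw [eq_zero_of_mem_partitions_zero (Finset.insert_nonempty e U) hz]
        simp
      | succ k =>
        obtain ⟨w₁, hw₁, z', hz', rfl⟩ :=
          exists_homologous hU _ (partitions_le_filtration he hz) hdz
        obtain ⟨y, hy, rfl⟩ := exists_of_mem_filtration_zero hz'
        rw [map_add, d_d, zero_add, hdmul] at hdz
        -- the free algebra has no zero divisors, so that `y` is a cycle, too
        have hne : FreeAlgebra.ι K ({e} : Finset ι) ≠ 0 := FreeAlgebra.ι_ne_zero _
        obtain ⟨w₂, hw₂, c, rfl, hc⟩ := ih k y hy ((mul_eq_zero.1 hdz).resolve_right hne)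
        refine ⟨w₁ + w₂ * FreeAlgebra.ι K {e}, Submodule.add_mem _ hw₁ ?_, c, ?_, ?_⟩
        · cases k with
          | zero =>
            rw [(Submodule.mem_bot K).1 hw₂, zero_mul]
            exact Submodule.zero_mem _
          | succ k => exact hmul hw₂
        · rw [map_add, hdmul, add_mul, smul_mul_assoc, add_assoc]
        · rw [Finset.card_insert_of_notMem he]
          intro h
          exact hc (by omega)

end SetWord

/-! ### The free permutad on one generator in each arity -/

/-- The ordered set partitions of `{1, …, n}`, described recursively: either there is only one
block, or the first block is the first fibre of a shuffle, and the remaining blocks form an ordered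
set partition of the second fibre. -/
inductive OrderedPartition : ℕ+ → Type
  | top (n : ℕ+) : OrderedPartition n
  | cons {n a b : ℕ+} (r : Shuffle n a b) (c : OrderedPartition b) : OrderedPartition n

namespace OrderedPartition

/-- The dimension of the face of the permutohedron which belongs to an ordered partition: the
number of elements minus the number of blocks. -/
def deg : ∀ {n : ℕ+}, OrderedPartition n → ℤ
  | _, top n => n - 1
  | _, cons (a := a) _ c => a - 1 + deg c

/-- The number of blocks. -/
def len : ∀ {n : ℕ+}, OrderedPartition n → ℕ
  | _, top _ => 1
  | _, cons _ c => len c + 1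

theorem deg_add_len {n : ℕ+} (c : OrderedPartition n) : c.deg + c.len = n := by
  induction c with
  | top n => simp [deg, len]
  | cons r c ih =>
    rw [deg, len, r.card_eq]
    push_cast
    linarith

theorem deg_nonneg {n : ℕ+} (c : OrderedPartition n) : 0 ≤ c.deg := by
  induction c with
  | top n => have := n.pos; rw [deg]; omega
  | @cons n a b r c ih => have := a.pos; rw [deg]; omega

theorem len_pos {n : ℕ+} (c : OrderedPartition n) : 0 < c.len := by
  cases c <;> simp [len]

/-- The list of the blocks. -/
def blocks : ∀ {n : ℕ+}, OrderedPartition n → List (Finset (Fin n))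
  | _, top _ => [Finset.univ]
  | _, cons r c => r.fib₀ :: (blocks c).map fun A => A.map r.emb₁.toEmbedding

end OrderedPartition

theorem Shuffle.card_fib₀ {n a b : ℕ+} (r : Shuffle n a b) : r.fib₀.card = a := by
  rw [Shuffle.fib₀, Finset.card_map, Finset.card_univ, Fintype.card_fin]

theorem Shuffle.fib₀_ne_univ {n a b : ℕ+} (r : Shuffle n a b) : r.fib₀ ≠ Finset.univ := by
  intro h
  have h1 := congrArg Finset.card h
  have h2 := r.card_eq
  have h3 := b.pos
  rw [r.card_fib₀, Finset.card_univ, Fintype.card_fin] at h1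
  omega

theorem Shuffle.eq_of_fib₀ {n a b : ℕ+} {r r' : Shuffle n a b} (h : r.fib₀ = r'.fib₀) : r = r' :=
  Shuffle.ext_zero fun i => by rw [← r.mem_fib₀, h, r'.mem_fib₀]

/-- Shuffles of possibly different types with the same first fibre agree. -/
theorem Shuffle.cases_eq {n a b a' b' : ℕ+} {r : Shuffle n a b} {r' : Shuffle n a' b'}
    (h : r.fib₀ = r'.fib₀) : a = a' ∧ b = b' ∧ HEq r r' := by
  have h1 := congrArg Finset.card h
  rw [r.card_fib₀, r'.card_fib₀] at h1
  obtain rfl : a = a' := PNat.eq h1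
  have h2 := r.card_eq
  have h3 := r'.card_eq
  obtain rfl : b = b' := PNat.eq (by omega)
  exact ⟨rfl, rfl, heq_of_eq (Shuffle.eq_of_fib₀ h)⟩

theorem OrderedPartition.blocks_injective {n : ℕ+} :
    Function.Injective (blocks : OrderedPartition n → List (Finset (Fin n))) := by
  intro c c' h
  induction c with
  | top n =>
    cases c' with
    | top => rfl
    | cons r c' =>
      simp only [blocks, List.cons.injEq] at h
      exact absurd h.1.symm r.fib₀_ne_univ
  | cons r c ih =>
    cases c' with
    | top =>
      simp only [blocks, List.cons.injEq] at h
      exact absurd h.1 r.fib₀_ne_univ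
    | cons r' c' =>
      simp only [blocks, List.cons.injEq] at h
      obtain ⟨rfl, rfl, hr⟩ := Shuffle.cases_eq h.1
      obtain rfl := eq_of_heq hr
      rw [ih (List.map_injective_iff.2 (Finset.map_injective _) h.2)]

section

variable {K : Type u} [Field K]

/-- A collection which is spanned by one element `β` in each arity `n`, of degree `n - 1`, with the
coordinate `χ`. Both are extended by zero to the other degrees. -/
structure GeneratorBasis (B : Coll K) where
  β : ∀ n p, B.X n p
  χ : ∀ n p, B.X n p →ₗ[K] K
  χ_β : ∀ {n : ℕ+} {p : ℤ}, p + 1 = n → χ n p (β n p) = 1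
  eq_smul : ∀ {n p} (b : B.X n p), b = χ n p b • β n p
  β_eq_zero : ∀ {n : ℕ+} {p : ℤ}, p + 1 ≠ n → β n p = 0

namespace GeneratorBasis

variable {B : Coll K} (G : GeneratorBasis B)

/-- The generators of the free permutad. -/
def gen (n : ℕ+) (p : ℤ) : (freePermutad B).X n p := FreePermutad.ι B n p (G.β n p)

theorem gen_eq_zero {n : ℕ+} {p : ℤ} (h : p + 1 ≠ n) : G.gen n p = 0 := by
  rw [gen, G.β_eq_zero h, map_zero]

theorem ι_eq_smul {n : ℕ+} {p : ℤ} (b : B.X n p) :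
    FreePermutad.ι B n p b = G.χ n p b • G.gen n p := by
  rw [gen, ← map_smul, ← G.eq_smul]

/-- The product of generators which belongs to an ordered partition, extended by zero to all
degrees. -/
def monomial : ∀ {n : ℕ+}, OrderedPartition n → ∀ p : ℤ, (freePermutad B).X n p
  | _, .top n, p => G.gen n p
  | _, .cons (a := a) r c, p => (freePermutad B).op r (p := (a : ℤ) - 1) (q := p - (a - 1))
      (by omega) (G.gen a (a - 1)) (monomial c (p - (a - 1)))

theorem monomial_eq_zero {n : ℕ+} (c : OrderedPartition n) {p : ℤ} (h : p ≠ c.deg) :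
    G.monomial c p = 0 := by
  induction c generalizing p with
  | top n => exact G.gen_eq_zero fun h' => h (by rw [OrderedPartition.deg]; omega)
  | cons r c ih =>
    rw [monomial, ih, map_zero]
    intro h'
    apply h
    rw [OrderedPartition.deg]
    omega

theorem op_gen_monomial {n a b : ℕ+} (r : Shuffle n a b) (c : OrderedPartition b) {p q s : ℤ}
    (h : p + q = s) : (freePermutad B).op r h (G.gen a p) (G.monomial c q) =
      if p + 1 = a then G.monomial (.cons r c) s else 0 := by
  split_ifs with hp
  · obtain rfl : p = a - 1 := by omega
    obtain rfl : q = s - (a - 1) := by omega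
    rfl
  · rw [G.gen_eq_zero hp, map_zero, LinearMap.zero_apply]

/-- The span of the monomials. -/
def monomialSpan (n : ℕ+) (p : ℤ) : Submodule K ((freePermutad B).X n p) :=
  Submodule.span K (Set.range fun c => G.monomial c p)

theorem op_gen_mem {n a b : ℕ+} (r : Shuffle n a b) {p q s : ℤ}
    (h : p + q = s) {y : (freePermutad B).X b q} (hy : y ∈ G.monomialSpan b q) :
    (freePermutad B).op r h (G.gen a p) y ∈ G.monomialSpan n s := by
  induction hy using Submodule.span_induction with
  | zero => rw [map_zero]; exact Submodule.zero_mem _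
  | add x y _ _ hx hy => rw [map_add]; exact Submodule.add_mem _ hx hy
  | smul c x _ hx => rw [map_smul]; exact Submodule.smul_mem _ _ hx
  | mem y hy =>
    obtain ⟨c, rfl⟩ := hy
    simp only [op_gen_monomial]
    split_ifs
    · exact Submodule.subset_span ⟨_, rfl⟩
    · exact Submodule.zero_mem _

/-- By induction on the number of blocks of the left factor, whose first block is split off by
associativity. -/
theorem op_monomial_mem {n a b : ℕ+} (r : Shuffle n a b) {p q s : ℤ}
    (h : p + q = s) (c : OrderedPartition a) {y : (freePermutad B).X b q}
    (hy : y ∈ G.monomialSpan b q) :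
    (freePermutad B).op r h (G.monomial c p) y ∈ G.monomialSpan n s := by
  induction c generalizing n b p q s with
  | top a => exact G.op_gen_mem r h hy
  | cons v c ih =>
    obtain ⟨t, s', hts⟩ := Shuffle.exists_reassoc_right r v
    rw [monomial, FreePermutad.isPermutad B t s' r v hts _ rfl _ (by omega)]
    exact G.op_gen_mem _ _ (ih s' rfl hy)

/-- The free permutad is spanned by the products of generators which belong to ordered
partitions. -/
theorem mem_monomialSpan (n : ℕ+) (p : ℤ) (x : (freePermutad B).X n p) :
    x ∈ G.monomialSpan n p := by
  induction n, p, x using FreePermutad.induction with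
  | hι n p b =>
    rw [G.ι_eq_smul]
    exact Submodule.smul_mem _ _ (Submodule.subset_span ⟨.top n, rfl⟩)
  | hop r h x y hx hy =>
    induction hx using Submodule.span_induction with
    | zero => rw [map_zero, LinearMap.zero_apply]; exact Submodule.zero_mem _
    | add x x' _ _ hx hx' =>
      rw [map_add, LinearMap.add_apply]; exact Submodule.add_mem _ hx hx'
    | smul c x _ hx => rw [map_smul, LinearMap.smul_apply]; exact Submodule.smul_mem _ _ hx
    | mem x hx =>
      obtain ⟨c, rfl⟩ := hx
      exact G.op_monomial_mem r h c hy
  | hzero n p => exact Submodule.zero_mem _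
  | hadd n p x y hx hy => exact Submodule.add_mem _ hx hy
  | hsmul n p c x hx => exact Submodule.smul_mem _ _ hx

/-- An induction principle: a linear statement about the free permutad has to be checked for the
monomials of the right degree. -/
theorem monomial_induction {n : ℕ+} {p : ℤ} {P : (freePermutad B).X n p → Prop}
    (hm : ∀ c : OrderedPartition n, c.deg = p → P (G.monomial c p)) (hzero : P 0)
    (hadd : ∀ x y, P x → P y → P (x + y)) (hsmul : ∀ (c : K) x, P x → P (c • x))
    (x : (freePermutad B).X n p) : P x := by
  induction G.mem_monomialSpan n p x using Submodule.span_induction with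
  | zero => exact hzero
  | add x y _ _ hx hy => exact hadd x y hx hy
  | smul c x _ hx => exact hsmul c x hx
  | mem x hx =>
    obtain ⟨c, rfl⟩ := hx
    by_cases h : c.deg = p
    · exact hm c h
    · simp only [G.monomial_eq_zero c (Ne.symm h)]
      exact hzero

theorem eq_zero_of_degree (G : GeneratorBasis B) {n : ℕ+} {p : ℤ} (hp : p < 0 ∨ (n : ℤ) ≤ p)
    (x : (freePermutad B).X n p) : x = 0 := by
  refine G.monomial_induction (P := fun x => x = 0) (fun c hc => ?_) rfl
    (fun x y hx hy => by rw [hx, hy, add_zero]) (fun c x hx => by rw [hx, smul_zero]) x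
  have h1 := c.deg_add_len
  have h2 := c.deg_nonneg
  have h3 := c.len_pos
  omega

/-- A linear map on the free permutad is injective when the images of the monomials are linearly
independent. -/
theorem injective_of_linearIndependent {n : ℕ+} {p : ℤ} {V : Type*} [AddCommGroup V] [Module K V]
    (f : (freePermutad B).X n p →ₗ[K] V)
    (hf : LinearIndependent K fun c : {c : OrderedPartition n // c.deg = p} =>
      f (G.monomial c.1 p)) : Function.Injective f := by
  let g : ({c : OrderedPartition n // c.deg = p} →₀ K) →ₗ[K] (freePermutad B).X n p :=
    Finsupp.linearCombination K fun c => G.monomial c.1 p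
  have hg : ∀ x, ∃ y, g y = x := by
    intro x
    refine G.monomial_induction (P := fun x => ∃ y, g y = x) (fun c hc => ?_)
      ⟨0, map_zero _⟩ ?_ ?_ x
    · exact ⟨Finsupp.single ⟨c, hc⟩ 1, by
        rw [Finsupp.linearCombination_single, one_smul]⟩
    · rintro _ _ ⟨x, rfl⟩ ⟨y, rfl⟩
      exact ⟨x + y, map_add _ _ _⟩
    · rintro c _ ⟨x, rfl⟩
      exact ⟨c • x, map_smul _ _ _⟩
  have hfg : ∀ y, f (g y) =
      Finsupp.linearCombination K (fun c : {c : OrderedPartition n // c.deg = p} =>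
        f (G.monomial c.1 p)) y := by
    intro y
    have := Finsupp.apply_linearCombination K f
      (fun c : {c : OrderedPartition n // c.deg = p} => G.monomial c.1 p) y
    exact this
  rw [injective_iff_map_eq_zero]
  intro x hx
  obtain ⟨y, rfl⟩ := hg x
  rw [hfg] at hx
  rw [linearIndependent_iff.1 hf y hx, map_zero]

end GeneratorBasis

end

/-- Every proper nonempty subset is the first fibre of a shuffle. -/
theorem Shuffle.exists_fib₀_eq {n : ℕ+} {A : Finset (Fin n)} (h : A.Nonempty)
    (h' : A ≠ Finset.univ) : ∃ (a b : ℕ+) (r : Shuffle n a b), r.fib₀ = A := by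
  have hAc : 0 < (Aᶜ).card := Finset.card_pos.2 (by
    rwa [Finset.nonempty_iff_ne_empty, Ne, Finset.compl_eq_empty_iff])
  obtain ⟨a, ha⟩ : ∃ a : ℕ+, A.card = a := ⟨⟨A.card, h.card_pos⟩, rfl⟩
  obtain ⟨b, hb⟩ : ∃ b : ℕ+, Aᶜ.card = b := ⟨⟨Aᶜ.card, hAc⟩, rfl⟩
  refine ⟨a, b, Shuffle.ofFinset A ha hb, ?_⟩
  ext i
  rw [Shuffle.mem_fib₀]
  simp [Shuffle.ofFinset]

/-! ### The realization of the free permutad by words of subsets -/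

namespace SetWord

variable {K : Type u} [Field K]

section Relabel

variable {ι κ ν : Type}

/-- The map of algebras which is induced by an embedding of the underlying ordered sets. -/
def relabel (K : Type u) [Field K] (g : ι ↪ κ) : Alg K ι →ₐ[K] Alg K κ :=
  FreeAlgebra.lift K fun A => FreeAlgebra.ι K (A.map g)

theorem relabel_ι (g : ι ↪ κ) (A : Finset ι) :
    relabel K g (FreeAlgebra.ι K A) = FreeAlgebra.ι K (A.map g) := by
  rw [relabel, FreeAlgebra.lift_ι_apply]

theorem relabel_relabel (g : ι ↪ κ) (f : κ ↪ ν) (x : Alg K ι) :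
    relabel K f (relabel K g x) = relabel K (g.trans f) x := by
  have : (relabel K f).comp (relabel K g) = relabel K (g.trans f) := by
    refine FreeAlgebra.hom_ext (funext fun A => ?_)
    simp [relabel_ι, Finset.map_map]
  exact DFunLike.congr_fun this x

theorem relabel_word (g : ι ↪ κ) (L : List (Finset ι)) :
    relabel K g (word L) = word (L.map fun A => A.map g) := by
  induction L with
  | nil => exact map_one _
  | cons A L ih => rw [word_cons, map_mul, relabel_ι, ih, List.map_cons, word_cons]

theorem parHom_relabel (g : ι ↪ κ) (x : Alg K ι) :
    parHom K κ (relabel K g x) = relabel K g (parHom K ι x) := by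
  have : (parHom K κ).comp (relabel K g) = (relabel K g).comp (parHom K ι) := by
    refine FreeAlgebra.hom_ext (funext fun A => ?_)
    simp [relabel_ι, parHom_ι]
  exact DFunLike.congr_fun this x

theorem aug_relabel (g : ι ↪ κ) (x : Alg K ι) : aug K κ (relabel K g x) = aug K ι x := by
  have : (aug K κ).comp (relabel K g) = aug K ι := by
    refine FreeAlgebra.hom_ext (funext fun A => ?_)
    simp [relabel_ι, aug, FreeAlgebra.lift_ι_apply]
  exact DFunLike.congr_fun this x

variable [LinearOrder ι] [LinearOrder κ]

theorem relabel_letter (g : ι ↪ κ) (A : Finset ι) :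
    relabel K g (letter K A) = letter K (A.map g) := by
  by_cases hA : A = ∅
  · rw [hA, Finset.map_empty, letter_empty, letter_empty, map_zero]
  · rw [letter_of_ne hA, letter_of_ne (by simpa using hA), relabel_ι]

theorem relabel_dLetter (g : ι ↪o κ) (A : Finset ι) :
    relabel K g.toEmbedding (dLetter A) = dLetter (A.map g.toEmbedding) := by
  rw [dLetter, dLetter, map_sum]
  refine Finset.sum_bij' (fun X _ => X.map g.toEmbedding)
    (fun Y _ => A.filter fun i => g i ∈ Y) ?_ ?_ ?_ ?_ ?_
  · intro X hX
    rw [Finset.mem_powerset] at hX ⊢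
    exact Finset.map_subset_map.2 hX
  · intro Y hY
    rw [Finset.mem_powerset]
    exact Finset.filter_subset _ _
  · intro X hX
    rw [Finset.mem_powerset] at hX
    ext i
    simp only [Finset.mem_filter, Finset.mem_map, RelEmbedding.coe_toEmbedding,
      EmbeddingLike.apply_eq_iff_eq, exists_eq_right]
    exact ⟨fun h => h.2, fun h => ⟨hX h, h⟩⟩
  · intro Y hY
    rw [Finset.mem_powerset] at hY
    ext i
    simp only [Finset.mem_filter, Finset.mem_map, RelEmbedding.coe_toEmbedding]
    constructor
    · rintro ⟨j, ⟨-, hj⟩, rfl⟩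
      exact hj
    · intro hi
      obtain ⟨j, hj, rfl⟩ := Finset.mem_map.1 (hY hi)
      exact ⟨j, ⟨hj, hi⟩, rfl⟩
  · intro X _
    rw [map_smul, map_mul, relabel_letter, relabel_letter, Finset.card_map, ← Finset.map_sdiff, sgn,
      sgn, inversions_map]

theorem d_relabel (g : ι ↪o κ) (x : Alg K ι) :
    d (relabel K g.toEmbedding x) = relabel K g.toEmbedding (d x) := by
  induction x using induction with
  | hone => rw [map_one (relabel K g.toEmbedding), d_one, d_one, map_zero]
  | hmul A x ih =>
    rw [d_mul, map_mul, d_mul, map_add, map_mul, map_mul, ih, relabel_ι, d_ι, d_ι,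
      relabel_dLetter, ← relabel_ι, parHom_relabel]
  | hadd x x' h h' => simp only [map_add, h, h']
  | hsmul c x h => simp only [map_smul, h]

theorem relabel_mem_partitions (g : ι ↪ κ) {k : ℕ} {U : Finset ι} {x : Alg K ι}
    (hx : x ∈ partitions K k U) : relabel K g x ∈ partitions K k (U.map g) := by
  refine partitions_induction (P := fun k U x => relabel K g x ∈ partitions K k (U.map g))
    ?_ ?_ ?_ ?_ ?_ hx
  · rw [map_one, Finset.map_empty]
    exact one_mem_partitions
  · intro k U A y hA hd _ ih
    rw [map_mul, relabel_ι, Finset.map_union]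
    exact ι_mul_mem_partitions (by simpa using hA) ((Finset.disjoint_map g).2 hd) ih
  · intro k U
    rw [map_zero]
    exact Submodule.zero_mem _
  · intro k U x y hx hy
    rw [map_add]
    exact Submodule.add_mem _ hx hy
  · intro k U c x hx
    rw [map_smul]
    exact Submodule.smul_mem _ _ hx

theorem exists_relabel_eq (g : ι ↪ κ) {k : ℕ} {U : Finset ι} {x : Alg K κ}
    (hx : x ∈ partitions K k (U.map g)) : ∃ y ∈ partitions K k U, relabel K g y = x := by
  induction k generalizing U x with
  | zero =>
    rw [partitions] at hx
    split_ifs at hx with hU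
    · obtain ⟨c, rfl⟩ := Submodule.mem_span_singleton.1 hx
      rw [Finset.map_eq_empty] at hU
      subst hU
      exact ⟨c • 1, Submodule.smul_mem _ _ one_mem_partitions, by rw [map_smul, map_one]⟩
    · rw [Submodule.mem_bot] at hx
      exact ⟨0, Submodule.zero_mem _, by rw [map_zero, hx]⟩
  | succ k ih =>
    rw [partitions] at hx
    induction hx using Submodule.span_induction with
    | zero => exact ⟨0, Submodule.zero_mem _, map_zero _⟩
    | add x y _ _ hx hy =>
      obtain ⟨x, hx, rfl⟩ := hx
      obtain ⟨y, hy, rfl⟩ := hy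
      exact ⟨x + y, Submodule.add_mem _ hx hy, map_add _ _ _⟩
    | smul c x _ hx =>
      obtain ⟨x, hx, rfl⟩ := hx
      exact ⟨c • x, Submodule.smul_mem _ _ hx, map_smul _ _ _⟩
    | mem x hx =>
      obtain ⟨A, hA, hne, y, hy, rfl⟩ := hx
      obtain ⟨A, hA', rfl⟩ := Finset.subset_map_iff.1 hA
      rw [← Finset.map_sdiff] at hy
      obtain ⟨y, hy', rfl⟩ := ih hy
      refine ⟨FreeAlgebra.ι K A * y, Submodule.subset_span
        ⟨A, hA', by simpa using hne, y, hy', rfl⟩,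
        ?_⟩
      rw [map_mul, relabel_ι]

end Relabel

/-- The algebras of words as a permutad, which does not depend on the degree. -/
def wordPermutad (K : Type u) [Field K] : PrePermutad K where
  X n _ := Alg K (Fin n)
  op r _ _ _ _ := (LinearMap.mul K _).compl₁₂ (relabel K r.emb₀.toEmbedding).toLinearMap
    (relabel K r.emb₁.toEmbedding).toLinearMap

theorem wordPermutad_isPermutad : (wordPermutad K).IsPermutad := by
  intro m a b c e f t s u v huv i j k ij jk l hij hjk h h' x y z
  have h0 : v.emb₀.toEmbedding.trans u.emb₀.toEmbedding = t.emb₀.toEmbedding := by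
    rw [← Shuffle.emb_assoc_zero huv]; rfl
  have h1 : v.emb₁.toEmbedding.trans u.emb₀.toEmbedding =
      s.emb₀.toEmbedding.trans t.emb₁.toEmbedding :=
    congrArg RelEmbedding.toEmbedding (Shuffle.emb_assoc_one huv)
  have h2 : u.emb₁.toEmbedding = s.emb₁.toEmbedding.trans t.emb₁.toEmbedding :=
    congrArg RelEmbedding.toEmbedding (Shuffle.emb_assoc_two huv)
  have key : ∀ (x : Alg K (Fin a)) (y : Alg K (Fin b)) (z : Alg K (Fin c)),
      relabel K u.emb₀.toEmbedding (relabel K v.emb₀.toEmbedding x *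
        relabel K v.emb₁.toEmbedding y) * relabel K u.emb₁.toEmbedding z =
      relabel K t.emb₀.toEmbedding x * relabel K t.emb₁.toEmbedding
        (relabel K s.emb₀.toEmbedding y * relabel K s.emb₁.toEmbedding z) := by
    intro x y z
    rw [map_mul, map_mul, relabel_relabel, relabel_relabel, relabel_relabel, relabel_relabel, h0,
      h1, h2,
      mul_assoc]
  exact key x y z

end SetWord

open SetWord

namespace GeneratorBasis

variable {K : Type u} [Field K] {B : Coll K} (G : GeneratorBasis B)

/-- The realization of the free permutad: the generator in arity `n` goes to the one-letter word
`{1, …, n}`. -/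
noncomputable def toWord : PrePermutad.Hom (freePermutad B) (wordPermutad K) :=
  FreePermutad.lift _ wordPermutad_isPermutad fun n p =>
    (LinearMap.toSpanSingleton K (Alg K (Fin n)) (FreeAlgebra.ι K Finset.univ)) ∘ₗ G.χ n p

/-- The word of an element of the free permutad. -/
noncomputable def realize (n : ℕ+) (p : ℤ) : (freePermutad B).X n p →ₗ[K] Alg K (Fin n) :=
  G.toWord.map n p

theorem realize_op {n a b : ℕ+} (r : Shuffle n a b) {p q s : ℤ} (h : p + q = s)
    (x : (freePermutad B).X a p) (y : (freePermutad B).X b q) :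
    G.realize n s ((freePermutad B).op r h x y) =
      relabel K r.emb₀.toEmbedding (G.realize a p x) *
        relabel K r.emb₁.toEmbedding (G.realize b q y) :=
  G.toWord.map_op r h x y

theorem realize_gen {n : ℕ+} {p : ℤ} (h : p + 1 = n) :
    G.realize n p (G.gen n p) = FreeAlgebra.ι K Finset.univ := by
  refine Eq.trans ?_ (one_smul K _)
  rw [← G.χ_β h]
  rfl

theorem realize_monomial {n : ℕ+} (c : OrderedPartition n) {p : ℤ} (h : c.deg = p) :
    G.realize n p (G.monomial c p) = word c.blocks := by
  induction c generalizing p with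
  | top n =>
    rw [monomial, G.realize_gen (by rw [← h, OrderedPartition.deg]; ring), OrderedPartition.blocks,
      word_cons, word_nil, mul_one]
  | cons r c ih =>
    rw [OrderedPartition.deg] at h
    rw [monomial, realize_op, G.realize_gen (by ring), ih (by omega), relabel_ι, relabel_word,
      OrderedPartition.blocks, word_cons]
    rfl

/-- Different ordered partitions give different words, so that the monomials are a basis of the free
permutad and it is a subspace of the algebra of words. -/
theorem realize_injective (n : ℕ+) (p : ℤ) : Function.Injective (G.realize n p) := by
  refine G.injective_of_linearIndependent _ ?_
  have := (linearIndependent_word (K := K) (ι := Fin n)).comp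
    (fun c : {c : OrderedPartition n // c.deg = p} => c.1.blocks) fun c c' h =>
      Subtype.ext (OrderedPartition.blocks_injective h)
  have h : (fun c : {c : OrderedPartition n // c.deg = p} => G.realize n p (G.monomial c.1 p)) =
      word ∘ fun c => c.1.blocks := funext fun c => G.realize_monomial c.1 c.2
  rw [h]
  exact this

theorem word_blocks_mem {n : ℕ+} (c : OrderedPartition n) :
    word c.blocks ∈ partitions K c.len (Finset.univ : Finset (Fin n)) := by
  induction c with
  | top n =>
    rw [OrderedPartition.blocks, word_cons, word_nil, mul_one]
    exact ι_mem_partitions ⟨⟨0, n.pos⟩, Finset.mem_univ _⟩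
  | @cons n a b r c ih =>
    rw [OrderedPartition.blocks, word_cons, ← relabel_word, ← r.fib_union]
    refine ι_mul_mem_partitions (Finset.card_pos.1 ?_) r.disjoint_fib
      (relabel_mem_partitions _ ih)
    rw [r.card_fib₀]
    exact a.pos

theorem realize_mem_partitions {n : ℕ+} {p : ℤ} (x : (freePermutad B).X n p) {k : ℕ}
    (hk : p + k = n) : G.realize n p x ∈ partitions K k (Finset.univ : Finset (Fin n)) := by
  refine G.monomial_induction (P := fun x => G.realize n p x ∈ partitions K k Finset.univ)
    (fun c hc => ?_) ?_ (fun x y hx hy => ?_) (fun c x hx => ?_) x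
  · rw [G.realize_monomial c hc]
    have := c.deg_add_len
    obtain rfl : k = c.len := by omega
    exact word_blocks_mem c
  · rw [map_zero]
    exact Submodule.zero_mem _
  · rw [map_add]
    exact Submodule.add_mem _ hx hy
  · rw [map_smul]
    exact Submodule.smul_mem _ _ hx

theorem exists_realize_eq {n : ℕ+} {p : ℤ} {k : ℕ} (hk : p + k = n) {x : Alg K (Fin n)}
    (hx : x ∈ partitions K k (Finset.univ : Finset (Fin n))) :
    ∃ y, G.realize n p y = x := by
  induction k generalizing n p x with
  | zero =>
    rw [eq_zero_of_mem_partitions_zero ⟨⟨0, n.pos⟩, Finset.mem_univ _⟩ hx]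
    exact ⟨0, map_zero _⟩
  | succ k ih =>
    rw [partitions] at hx
    induction hx using Submodule.span_induction with
    | zero => exact ⟨0, map_zero _⟩
    | add x y _ _ hx hy =>
      obtain ⟨x, rfl⟩ := hx
      obtain ⟨y, rfl⟩ := hy
      exact ⟨x + y, map_add _ _ _⟩
    | smul c x _ hx =>
      obtain ⟨x, rfl⟩ := hx
      exact ⟨c • x, map_smul _ _ _⟩
    | mem x hx =>
      obtain ⟨A, -, hne, y, hy, rfl⟩ := hx
      by_cases hA : A = Finset.univ
      · subst hA
        rw [Finset.sdiff_self] at hy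
        cases k with
        | zero =>
          rw [partitions, if_pos rfl] at hy
          obtain ⟨c, rfl⟩ := Submodule.mem_span_singleton.1 hy
          refine ⟨c • G.gen n p, ?_⟩
          rw [map_smul, G.realize_gen (by simpa using hk), mul_smul_comm, mul_one]
        | succ k =>
          rw [eq_zero_of_mem_partitions_succ_empty hy, mul_zero]
          exact ⟨0, map_zero _⟩
      -- a proper first block is the first fibre of a shuffle
      · obtain ⟨a, b, r, rfl⟩ := Shuffle.exists_fib₀_eq hne hA
        have h1 : Finset.univ \ r.fib₀ = r.fib₁ := by
          rw [← r.fib_union, Finset.union_sdiff_cancel_left r.disjoint_fib]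
        rw [h1] at hy
        obtain ⟨y, hy', rfl⟩ := exists_relabel_eq r.emb₁.toEmbedding hy
        have hcard := r.card_eq
        obtain ⟨z, rfl⟩ := ih (p := p - (a - 1)) (by omega) hy'
        refine ⟨(freePermutad B).op r (p := (a : ℤ) - 1) (by omega) (G.gen _ _) z, ?_⟩
        rw [realize_op, G.realize_gen (by simp), relabel_ι]
        rfl

/-! ### The differential -/

/-- The differential of the generator of arity `n`. -/
noncomputable def dGen (n : ℕ+) (q : ℤ) : (freePermutad B).X n q :=
  ∑ r : Surj₂ n, (par K (r.fibre 0) * (-1) ^ r.toShuffle.inv) •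
    (freePermutad B).op r.toShuffle (p := (r.fibre 0 : ℤ) - 1) (q := q - (r.fibre 0 - 1)) (by omega)
      (G.gen _ _) (G.gen _ _)

/-- The surjections onto two elements are the splittings of `{1, …, n}` into two nonempty parts. -/
theorem realize_dGen {n : ℕ+} {q : ℤ} (hq : q + 2 = n) :
    G.realize n q (G.dGen n q) = dLetter Finset.univ := by
  rw [dGen, map_sum, dLetter]
  refine Finset.sum_of_injOn (fun r => r.toShuffle.fib₀) ?_ ?_ ?_ ?_
  · intro r _ r' _ h
    refine Subtype.ext (funext fun i => ?_)
    have h1 := r.toShuffle.mem_fib₀ i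
    have h2 := r'.toShuffle.mem_fib₀ i
    simp only at h
    rw [h, h2] at h1
    have h3 : r'.1 i = 0 ↔ r.1 i = 0 := h1
    omega
  · intro r _
    simp
  · intro A _ hA
    by_cases h0 : A = ∅
    · rw [h0, letter_empty, zero_mul, smul_zero]
    · by_cases h1 : A = Finset.univ
      · rw [h1, Finset.sdiff_self, letter_empty, mul_zero, smul_zero]
      · refine absurd ⟨⟨fun i => if i ∈ A then 0 else 1, ?_⟩,
          Finset.mem_coe.2 (Finset.mem_univ _), ?_⟩ hA
        · obtain ⟨x, hx⟩ := Finset.nonempty_iff_ne_empty.2 h0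
          obtain ⟨y, hy⟩ : ∃ y, y ∉ A := by
            by_contra! h
            exact h1 (Finset.eq_univ_iff_forall.2 h)
          intro j
          by_cases hj : j = 0
          · exact ⟨x, by simp [hx, hj]⟩
          · exact ⟨y, by simp [hy]; omega⟩
        · ext i
          simp [Surj₂.toShuffle]
  · intro r _
    have h1 : Finset.univ \ r.toShuffle.fib₀ = r.toShuffle.fib₁ := by
      rw [← r.toShuffle.fib_union, Finset.union_sdiff_cancel_left r.toShuffle.disjoint_fib]
    have hcard := r.toShuffle.card_eq
    have hne0 : r.toShuffle.fib₀ ≠ ∅ := by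
      rw [← Finset.nonempty_iff_ne_empty, ← Finset.card_pos, r.toShuffle.card_fib₀]
      exact PNat.pos _
    have hne1 : r.toShuffle.fib₁ ≠ ∅ := by
      rw [← Finset.nonempty_iff_ne_empty, ← Finset.card_pos, Shuffle.fib₁, Finset.card_map,
        Finset.card_univ, Fintype.card_fin]
      exact PNat.pos _
    rw [map_smul, realize_op, G.realize_gen (by ring), G.realize_gen (by omega), relabel_ι,
      relabel_ι, h1, r.toShuffle.card_fib₀, letter_of_ne hne0, letter_of_ne hne1]
    rfl

end GeneratorBasis

/-! ### Derivations of the free permutad -/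

section

variable {K : Type u} [Field K]

namespace FreePermutad

variable {B : Coll K}
  (σ : ∀ (n : ℕ+) {p q : ℤ}, q + 1 = p → B.X n p →ₗ[K] (freePermutad B).X n q)

theorem deriv_ι (n : ℕ+) {p q : ℤ} (h : q + 1 = p) (b : B.X n p) :
    deriv σ h (ι B n p b) = σ n h b := rfl

theorem deriv_op {n a b : ℕ+} (r : Shuffle n a b) {p q s s' p' q' : ℤ} (h : p + q = s)
    (hs : s' + 1 = s) (hp : p' + 1 = p) (hq : q' + 1 = q) (h₁ : p' + q = s') (h₂ : p + q' = s')
    (x : (freePermutad B).X a p) (y : (freePermutad B).X b q) :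
    deriv σ hs ((freePermutad B).op r h x y) =
      (freePermutad B).op r h₁ (deriv σ hp x) y +
        ((-1 : K) ^ p) • (freePermutad B).op r h₂ x (deriv σ hq y) := by
  obtain rfl : p' = p - 1 := by omega
  obtain rfl : q' = q - 1 := by omega
  obtain ⟨x⟩ := x
  obtain ⟨y⟩ := y
  rfl

end FreePermutad

open SetWord

namespace GeneratorBasis

variable {B : Coll K} (G : GeneratorBasis B)

theorem dGen_eq_zero {n : ℕ+} {q : ℤ} (hq : q + 2 ≠ n) : G.dGen n q = 0 := by
  refine Finset.sum_eq_zero fun r _ => ?_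
  have hcard := r.toShuffle.card_eq
  rw [G.gen_eq_zero (n := r.fibre 1) (by omega), map_zero, smul_zero]

theorem realize_ι {n : ℕ+} {p : ℤ} (b : B.X n p) :
    G.realize n p (FreePermutad.ι B n p b) = G.χ n p b • FreeAlgebra.ι K Finset.univ := by
  by_cases h : p + 1 = n
  · rw [G.ι_eq_smul, map_smul, G.realize_gen h]
  · have : b = 0 := by rw [G.eq_smul b, G.β_eq_zero h, smul_zero]
    rw [this, map_zero, map_zero, map_zero, zero_smul]

theorem χ_eq_zero {n : ℕ+} {p : ℤ} (h : p + 1 ≠ n) (b : B.X n p) : G.χ n p b = 0 := by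
  rw [G.eq_smul b, G.β_eq_zero h, smul_zero, map_zero]

/-- The parity automorphism gives the degree of an element of the free permutad. -/
theorem parHom_realize {n : ℕ+} {p : ℤ} (x : (freePermutad B).X n p) :
    parHom K (Fin n) (G.realize n p x) = ((-1 : K) ^ p) • G.realize n p x := by
  induction n, p, x using FreePermutad.induction with
  | hι n p b =>
    rw [realize_ι, map_smul, parHom_ι, smul_comm]
    by_cases h : p + 1 = n
    · congr 1
      have h1 : p = ((n + 1 : ℕ) : ℤ) - 2 := by push_cast; omega
      rw [Finset.card_univ, Fintype.card_fin, par, h1, zpow_sub₀ (by simp), zpow_natCast]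
      simp
    · rw [G.χ_eq_zero h, zero_smul, smul_zero, smul_zero]
  | hop r h x y hx hy =>
    rw [realize_op, map_mul, parHom_relabel, parHom_relabel, hx, hy, map_smul, map_smul,
      smul_mul_smul_comm, ← h, zpow_add₀ (by simp)]
  | hzero => rw [map_zero, map_zero, smul_zero]
  | hadd n p x y hx hy => rw [map_add, map_add, hx, hy, smul_add]
  | hsmul n p c x hx => rw [map_smul, map_smul, hx, smul_comm]

variable {σ : ∀ (n : ℕ+) {p q : ℤ}, q + 1 = p → B.X n p →ₗ[K] (freePermutad B).X n q}
  (hσ : ∀ (n : ℕ+) {p q : ℤ} (h : q + 1 = p), σ n h (G.β n p) = G.dGen n q)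

include hσ

/-- The derivation of the free permutad is the restriction of the differential on words. -/
theorem realize_deriv {n : ℕ+} {p q : ℤ} (h : q + 1 = p) (x : (freePermutad B).X n p) :
    G.realize n q (FreePermutad.deriv σ h x) = d (G.realize n p x) := by
  induction n, p, x using FreePermutad.induction generalizing q with
  | hι n p b =>
    rw [FreePermutad.deriv_ι, realize_ι, map_smul, d_ι]
    conv_lhs => rw [G.eq_smul b, map_smul, hσ, map_smul]
    by_cases hn : p + 1 = n
    · rw [G.realize_dGen (by omega)]
    · rw [G.χ_eq_zero hn, zero_smul, zero_smul]
  | @hop n a b r i j s hs x y hx hy =>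
    rw [FreePermutad.deriv_op σ r hs h (p' := i - 1) (q' := j - 1) (by ring) (by ring) (by omega)
      (by omega), map_add, map_smul, realize_op, realize_op, realize_op, d_mul, hx, hy, d_relabel,
      d_relabel, parHom_relabel, parHom_realize, map_smul, smul_mul_assoc]
  | hzero => rw [map_zero, map_zero, map_zero, map_zero]
  | hadd n p x y hx hy => rw [map_add, map_add, map_add, map_add, hx, hy]
  | hsmul n p c x hx => rw [map_smul, map_smul, map_smul, map_smul, hx]

theorem isDGPermutad :
    PreDGPermutad.IsDGPermutad ⟨freePermutad B, FreePermutad.deriv σ⟩ where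
  assoc := FreePermutad.isPermutad B
  d_d h h' x := G.realize_injective _ _ (by
    rw [G.realize_deriv hσ, G.realize_deriv hσ, d_d, map_zero])
  leibniz r _ _ _ _ _ _ h hs hp hq h₁ h₂ x y := FreePermutad.deriv_op σ r h hs hp hq h₁ h₂ x y

/-- Every cycle which the augmentation does not see is a boundary. -/
theorem exists_eq_deriv {n : ℕ+} {p q s : ℤ} (hq : q + 1 = p) (hs : p + 1 = s)
    (x : (freePermutad B).X n p) (hx : FreePermutad.deriv σ hq x = 0)
    (h0 : p = 0 → aug K (Fin n) (G.realize n p x) = 0) :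
    ∃ w : (freePermutad B).X n s, x = FreePermutad.deriv σ hs w := by
  by_cases hp : p < 0 ∨ (n : ℤ) ≤ p
  · exact ⟨0, by rw [map_zero, G.eq_zero_of_degree hp x]⟩
  push Not at hp
  obtain ⟨k, hk⟩ : ∃ k : ℕ, p + k = n := ⟨(n - p).toNat, by omega⟩
  obtain ⟨v, hv, hv1, hz⟩ := exists_eq_d_add_smul (K := K) (Finset.univ : Finset (Fin n))
  obtain ⟨w, hw, c, hxw, hc⟩ := hz k (G.realize n p x) (G.realize_mem_partitions x hk)
    (by rw [← G.realize_deriv hσ hq, hx, map_zero])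
  have hc0 : c = 0 := by
    by_cases hk' : k = (Finset.univ : Finset (Fin n)).card
    · have h1 := h0 (by rw [Finset.card_univ, Fintype.card_fin] at hk'; omega)
      rwa [hxw, map_add, map_smul, aug_d, hv1, zero_add, smul_eq_mul, mul_one] at h1
    · exact hc hk'
  rw [hc0, zero_smul, add_zero] at hxw
  cases k with
  | zero => omega
  | succ k =>
    obtain ⟨w, rfl⟩ := G.exists_realize_eq (p := s) (k := k) (by push_cast at hk; omega) hw
    exact ⟨w, G.realize_injective _ _ (by rw [hxw, G.realize_deriv hσ])⟩

omit hσ in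
theorem exists_aug_eq_one (n : ℕ+) :
    ∃ v : (freePermutad B).X n 0, aug K (Fin n) (G.realize n 0 v) = 1 := by
  obtain ⟨v, hv, hv1, -⟩ := exists_eq_d_add_smul (K := K) (Finset.univ : Finset (Fin n))
  obtain ⟨v, rfl⟩ := G.exists_realize_eq (p := 0) (by simp) hv
  exact ⟨v, hv1⟩

end GeneratorBasis

end

section

variable {K : Type u} [Field K]

/-! ### Composition and inversion of morphisms -/

namespace PrePermutad.Hom

/-- The composition of morphisms of permutads. -/
def comp {A B C : PrePermutad K} (g : Hom B C) (f : Hom A B) : Hom A C where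
  map n p := g.map n p ∘ₗ f.map n p
  map_op r _ _ _ h x y := by
    rw [LinearMap.comp_apply, f.map_op, g.map_op]
    rfl

theorem comp_apply {A B C : PrePermutad K} (g : Hom B C) (f : Hom A B) {n : ℕ+} {p : ℤ}
    (x : A.X n p) : (g.comp f).map n p x = g.map n p (f.map n p x) := rfl

/-- The inverse of an isomorphism of permutads. -/
noncomputable def inverse {A B : PrePermutad K} (f : Hom A B) (hf : f.IsIso) : Hom B A where
  map n p := (LinearEquiv.ofBijective (f.map n p) (hf n p)).symm.toLinearMap
  map_op {n a b} r p q s h x y := by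
    obtain ⟨x, rfl⟩ := (hf a p).2 x
    obtain ⟨y, rfl⟩ := (hf b q).2 y
    have key : ∀ {n p} (z : A.X n p),
        (LinearEquiv.ofBijective (f.map n p) (hf n p)).symm (f.map n p z) = z :=
      fun {n p} z => (LinearEquiv.ofBijective (f.map n p) (hf n p)).symm_apply_apply z
    rw [← f.map_op, LinearEquiv.coe_coe, LinearEquiv.coe_coe, LinearEquiv.coe_coe, key, key, key]

theorem inverse_apply {A B : PrePermutad K} (f : Hom A B) (hf : f.IsIso) {n : ℕ+} {p : ℤ}
    (x : A.X n p) : (f.inverse hf).map n p (f.map n p x) = x :=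
  (LinearEquiv.ofBijective (f.map n p) (hf n p)).symm_apply_apply x

theorem apply_inverse {A B : PrePermutad K} (f : Hom A B) (hf : f.IsIso) {n : ℕ+} {p : ℤ}
    (y : B.X n p) : f.map n p ((f.inverse hf).map n p y) = y :=
  (LinearEquiv.ofBijective (f.map n p) (hf n p)).apply_symm_apply y

theorem inverse_isIso {A B : PrePermutad K} (f : Hom A B) (hf : f.IsIso) :
    (f.inverse hf).IsIso := fun n p =>
  ⟨fun x y h => by rw [← f.apply_inverse hf x, h, f.apply_inverse hf],
    fun x => ⟨f.map n p x, f.inverse_apply hf x⟩⟩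

theorem IsIso.comp {A B C : PrePermutad K} {g : Hom B C} {f : Hom A B} (hg : g.IsIso)
    (hf : f.IsIso) : (g.comp f).IsIso := fun n p => (hg n p).comp (hf n p)

end PrePermutad.Hom

open PrePermutad

namespace PreDGPermutad

theorem IsDGHom.comp {A B C : PreDGPermutad K} {g : Hom B.toPrePermutad C.toPrePermutad}
    {f : Hom A.toPrePermutad B.toPrePermutad} (hg : IsDGHom B C g) (hf : IsDGHom A B f) :
    IsDGHom A C (g.comp f) := fun n _ _ h x => by
  rw [Hom.comp_apply, hf, hg, Hom.comp_apply]

theorem IsDGHom.inverse {A B : PreDGPermutad K} {f : Hom A.toPrePermutad B.toPrePermutad}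
    (hf : IsDGHom A B f) (hf' : f.IsIso) : IsDGHom B A (f.inverse hf') := fun n p q h x => by
  apply (hf' n q).1
  rw [hf, f.apply_inverse, f.apply_inverse]

/-- A quasi-isomorphism stays one when it is composed with an isomorphism on the right. -/
theorem IsQuasiIso.comp_iso {A B C : PreDGPermutad K} {g : Hom B.toPrePermutad C.toPrePermutad}
    {f : Hom A.toPrePermutad B.toPrePermutad} (hg : IsQuasiIso B C g) (hf : IsDGHom A B f)
    (hf' : f.IsIso) : IsQuasiIso A C (g.comp f) := by
  intro n p q s hq hs
  refine ⟨fun y hy => ?_, fun x hx => ?_⟩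
  · obtain ⟨x, hx, hz⟩ := (hg n hq hs).1 y hy
    obtain ⟨x, rfl⟩ := (hf' n p).2 x
    exact ⟨x, (hf' n q).1 (by rw [hf, hx, map_zero]), hz⟩
  · intro hz
    obtain ⟨w, hw⟩ := (hg n hq hs).2 (f.map n p x) (by rw [← hf, hx, map_zero]) hz
    obtain ⟨w, rfl⟩ := (hf' n s).2 w
    exact ⟨w, (hf' n p).1 (by rw [hw, hf])⟩

/-- A quasi-isomorphism stays one when it is composed with an isomorphism on the left. -/
theorem IsQuasiIso.iso_comp {A B C : PreDGPermutad K} {g : Hom B.toPrePermutad C.toPrePermutad}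
    {f : Hom A.toPrePermutad B.toPrePermutad} (hg : IsDGHom B C g) (hg' : g.IsIso)
    (hf : IsQuasiIso A B f) : IsQuasiIso A C (g.comp f) := by
  intro n p q s hq hs
  refine ⟨fun y hy => ?_, fun x hx => ?_⟩
  · obtain ⟨y, rfl⟩ := (hg' n p).2 y
    obtain ⟨x, hx, z, hz⟩ := (hf n hq hs).1 y ((hg' n q).1 (by rw [hg, hy, map_zero]))
    exact ⟨x, hx, g.map n s z, by rw [← hg, ← hz, map_sub, Hom.comp_apply]⟩
  · rintro ⟨z, hz⟩
    obtain ⟨z, rfl⟩ := (hg' n s).2 z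
    exact (hf n hq hs).2 x hx ⟨z, (hg' n p).1 (by rw [hg, ← hz, Hom.comp_apply])⟩

end PreDGPermutad

/-! ### Presentations with one generator and one-dimensional components -/

namespace BinaryQuadratic

/-- A coordinate `coord` on the generators of a quadratic permutad which has one generator `v`, such
that the relations are spanned by `v ⋄_(21) v - ε v ⋄_id v`. -/
structure SignPresentation (Q : BinaryQuadratic K) (ε : K) where
  coord : Q.V ≃ₗ[K] K
  sum_eq_zero : ∀ x ∈ Q.S, ∑ r : Shuffle 2 1 1, ε ^ r.inv *
    LinearMap.mul' K K (TensorProduct.map coord.toLinearMap coord.toLinearMap (x r)) = 0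
  sub_mem : Pi.single swapShuffle (coord.symm 1 ⊗ₜ[K] coord.symm 1) -
    ε • (Pi.single idShuffle (coord.symm 1 ⊗ₜ[K] coord.symm 1) : Shuffle 2 1 1 → Q.V ⊗[K] Q.V) ∈ Q.S

namespace SignPresentation

variable {Q : BinaryQuadratic K} {ε : K} (H : Q.SignPresentation ε)

/-- The induced isomorphism. -/
noncomputable def iso : Hom Q.permutad (signAs K ε Q.deg) := Q.toSign H.coord H.sum_eq_zero

theorem iso_isIso : H.iso.IsIso := toSign_isIso H.sum_eq_zero H.sub_mem

/-- The coordinate on the components of the quadratic permutad. -/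
noncomputable def κ (n : ℕ+) (p : ℤ) : Q.permutad.X n p →ₗ[K] K :=
  signAs.coord ε Q.deg n p ∘ₗ H.iso.map n p

theorem κ_injective (n : ℕ+) (p : ℤ) : Function.Injective (H.κ n p) :=
  (signAs.coord_injective ε Q.deg n p).comp (H.iso_isIso n p).1

theorem κ_op {n a b : ℕ+} (r : Shuffle n a b) {p q s : ℤ} (h : p + q = s) (x : Q.permutad.X a p)
    (y : Q.permutad.X b q) : H.κ n s (Q.permutad.op r h x y) =
      ε ^ r.inv * (H.κ a p x * H.κ b q y) := by
  refine (congrArg (signAs.coord ε Q.deg n s) (H.iso.map_op r h x y)).trans ?_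
  exact signAs.coord_op ε Q.deg r h _ _

theorem κ_gen (v : Q.V) : H.κ 1 Q.deg (Q.gen 1 Q.deg v) = H.coord v :=
  coord_toSign_gen H.sum_eq_zero v

theorem κ_eq_zero {n : ℕ+} {p : ℤ} (h : p ≠ n * Q.deg) (x : Q.permutad.X n p) : H.κ n p x = 0 :=
  (H.iso.map n p x).2 h

/-- The basis of a component. -/
noncomputable def basis (n : ℕ+) (p : ℤ) : Q.permutad.X n p := Q.power (H.coord.symm 1) n p

theorem κ_basis {n : ℕ+} {p : ℤ} (h : p = n * Q.deg) : H.κ n p (H.basis n p) = 1 := by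
  refine (coord_toSign_power H.sum_eq_zero n h).trans ?_
  rw [LinearEquiv.apply_symm_apply, one_pow]

theorem eq_smul_basis {n : ℕ+} {p : ℤ} (x : Q.permutad.X n p) :
    x = H.κ n p x • H.basis n p := by
  apply H.κ_injective
  rw [map_smul]
  by_cases h : p = n * Q.deg
  · rw [H.κ_basis h, smul_eq_mul, mul_one]
  · rw [H.κ_eq_zero h, H.κ_eq_zero h, smul_zero]

include H in
theorem finite (n : ℕ+) (p : ℤ) : Module.Finite K (Q.permutad.X n p) :=
  Module.Finite.of_injective (H.κ n p) (H.κ_injective n p)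

/-! ### The cobar construction of a sign presentation -/

/-- The coordinate on a component, as an element of the dual. -/
noncomputable def functional (n : ℕ+) (p : ℤ) : Q.permutad.dual.X n p := H.κ n p

/-- The generators of the dual bar construction of a permutad with one-dimensional components in
degree `n`. -/
noncomputable def generatorBasis (hdeg : Q.deg = 1) :
    GeneratorBasis Q.permutad.dual.toColl.desuspension where
  β n p := H.functional n (p + 1)
  χ n p := LinearMap.applyₗ (H.basis n (p + 1))
  χ_β {n p} h := H.κ_basis (by rw [hdeg, mul_one]; exact h)
  eq_smul {n p} b := by
    refine LinearMap.ext fun (x : Q.permutad.X n (p + 1)) => ?_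
    have key : ∀ b : Module.Dual K (Q.permutad.X n (p + 1)), b x =
        b (H.basis n (p + 1)) • H.κ n (p + 1) x := by
      intro b
      conv_lhs => rw [H.eq_smul_basis x, map_smul, smul_eq_mul, mul_comm]
      rfl
    exact key b
  β_eq_zero {n p} h := LinearMap.ext fun x => H.κ_eq_zero (by rw [hdeg, mul_one]; exact h) x

theorem coop_functional {n a b : ℕ+} (r : Shuffle n a b) {p q s : ℤ} (h : p + q = s) :
    Q.permutad.dual.coop r h (H.functional n s) =
      ε ^ r.inv • (H.functional a p ⊗ₜ[K] H.functional b q) := by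
  have h1 := H.finite a p
  have h2 := H.finite b q
  have h3 : Q.permutad.dual.coop r h =
      (TensorProduct.dualDistribEquiv K (Q.permutad.X a p) (Q.permutad.X b q)).symm.toLinearMap ∘ₗ
        (TensorProduct.lift (Q.permutad.op r h)).dualMap := dif_pos ⟨h1, h2⟩
  have h4 : (TensorProduct.dualDistribEquiv K (Q.permutad.X a p) (Q.permutad.X b q)).symm
      ((TensorProduct.lift (Q.permutad.op r h)).dualMap (H.κ n s)) =
      ε ^ r.inv • (H.κ a p ⊗ₜ[K] H.κ b q) := by
    rw [LinearEquiv.symm_apply_eq]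
    refine TensorProduct.ext' fun x y => ?_
    rw [LinearMap.dualMap_apply, TensorProduct.lift.tmul, H.κ_op]
    rw [map_smul]
    rfl
  exact (congrArg (fun f => f (H.κ n s)) h3).trans h4

end SignPresentation

end BinaryQuadratic

end

section

variable {K : Type u} [Field K]

open PrePermutad SetWord

theorem sum_shuffle_two {M : Type*} [AddCommMonoid M] (f : Shuffle 2 1 1 → M) :
    ∑ r, f r = f idShuffle + f swapShuffle := by
  have : (Finset.univ : Finset (Shuffle 2 1 1)) = {idShuffle, swapShuffle} := by
    ext r
    simpa using eq_idShuffle_or r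
  rw [this, Finset.sum_insert (by decide), Finset.sum_singleton]

theorem PreCopermutad.mulGen_tmul (C : PreCopermutad K) {n a b : ℕ+} (r : Shuffle n a b)
    {i j q : ℤ} (h : i + j = q) (x : C.X a (i + 1)) (y : C.X b (j + 1)) :
    C.mulGen r h (x ⊗ₜ[K] y) = (freePermutad C.toColl.desuspension).op r h
      (FreePermutad.ι C.toColl.desuspension a i x)
      (FreePermutad.ι C.toColl.desuspension b j y) := rfl

/-- The differential of the cobar construction on an element whose coproducts are decomposable
tensors of elements in prescribed degrees. -/
theorem PreCopermutad.sigma_eq_sum (C : PreCopermutad K) (n : ℕ+) {p q : ℤ} (h : q + 1 = p)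
    (x : C.X n (p + 1)) (e : ∀ n p, C.X n p) (c : Surj₂ n → K)
    (hx : ∀ (r : Surj₂ n) {i j : ℤ} (hij : i + j = p + 1), C.coop r.toShuffle hij x =
      c r • (e (r.fibre 0) i ⊗ₜ[K] e (r.fibre 1) j))
    (hC : ∀ {n : ℕ+} {p : ℤ}, p ≠ n → ∀ x : C.X n p, x = 0) :
    C.sigma n h x = ∑ r : Surj₂ n, (par K (r.fibre 0) * c r) •
      (freePermutad C.toColl.desuspension).op r.toShuffle
        (p := (r.fibre 0 : ℤ) - 1) (q := q - (r.fibre 0 - 1)) (by omega)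
        (FreePermutad.ι C.toColl.desuspension _ _ (e (r.fibre 0) _))
        (FreePermutad.ι C.toColl.desuspension _ _ (e (r.fibre 1) _)) := by
  have h0 : C.sigma n h x = (∑ r : Surj₂ n, ∑ᶠ i : ℤ, ((-1 : K) ^ i) •
      (C.mulGen r.toShuffle (i := i) (j := q - i) (by omega) ∘ₗ
      C.coop r.toShuffle (p := i + 1) (q := q - i + 1) (s := p + 1) (by omega)) :
      C.X n (p + 1) →ₗ[K] (freePermutad C.toColl.desuspension).X n q) x := rfl
  rw [h0, LinearMap.sum_apply]
  refine Finset.sum_congr rfl fun r _ => ?_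
  have hzero : ∀ i : ℤ, i ≠ r.fibre 0 - 1 →
      ((-1 : K) ^ i) • (C.mulGen r.toShuffle (i := i) (j := q - i) (q := q) (by omega)
      ∘ₗ C.coop r.toShuffle (p := i + 1) (q := q - i + 1) (s := p + 1) (by omega)) = 0 := by
    intro i hi
    have : C.mulGen r.toShuffle (i := i) (j := q - i) (q := q) (by omega) = 0 :=
      TensorProduct.ext' fun y z => by
        rw [hC (by omega) y, TensorProduct.zero_tmul, map_zero, map_zero]
    rw [this, LinearMap.zero_comp, smul_zero]
  rw [finsum_eq_single _ _ hzero, LinearMap.smul_apply, LinearMap.comp_apply, hx, map_smul,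
    C.mulGen_tmul, smul_smul]
  have hpar : (-1 : K) ^ ((r.fibre 0 : ℤ) - 1) = par K (r.fibre 0) := by
    rw [par, zpow_sub₀ (by simp), zpow_natCast]
    simp [pow_succ, div_neg]
  rw [hpar]

namespace BinaryQuadratic

namespace SignPresentation

variable {Q : BinaryQuadratic K} (H : Q.SignPresentation (-1))

/-- The dual bar construction of a sign presentation in degree `1`: the derivation of the generator
of arity `n` is the signed sum over all surjections onto two elements. -/
theorem sigma_β (hdeg : Q.deg = 1) (n : ℕ+) {p q : ℤ} (h : q + 1 = p) :
    Q.permutad.dual.sigma n h ((H.generatorBasis hdeg).β n p) =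
      (H.generatorBasis hdeg).dGen n q :=
  Q.permutad.dual.sigma_eq_sum n h (H.functional n (p + 1)) H.functional _
    (fun r _ _ hij => H.coop_functional r.toShuffle hij)
    (fun {n p} hp (x : Module.Dual K (Q.permutad.X n p)) => LinearMap.ext fun y => by
      rw [H.eq_smul_basis y, H.κ_eq_zero (by rwa [hdeg, mul_one]), zero_smul, map_zero]
      rfl)

end SignPresentation

variable {Q : BinaryQuadratic K}

/-- The annihilator of the commutativity relation `v ⋄_id v - v ⋄_(21) v`. -/
theorem mem_annihilator_iff {v : Q.V} (hS : Q.S = Submodule.span K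
    {Pi.single idShuffle (v ⊗ₜ[K] v) - Pi.single swapShuffle (v ⊗ₜ[K] v)})
    (φ : Shuffle 2 1 1 → Module.Dual K Q.V ⊗[K] Module.Dual K Q.V) :
    φ ∈ Q.annihilator ↔
      TensorProduct.dualDistrib K Q.V Q.V (φ idShuffle) (v ⊗ₜ[K] v) =
        TensorProduct.dualDistrib K Q.V Q.V (φ swapShuffle) (v ⊗ₜ[K] v) := by
  have hne : idShuffle ≠ swapShuffle := by decide
  have key : Q.pairing φ (Pi.single idShuffle (v ⊗ₜ[K] v) - Pi.single swapShuffle (v ⊗ₜ[K] v)) =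
      TensorProduct.dualDistrib K Q.V Q.V (φ idShuffle) (v ⊗ₜ[K] v) -
        TensorProduct.dualDistrib K Q.V Q.V (φ swapShuffle) (v ⊗ₜ[K] v) := by
    rw [pairing, sum_shuffle_two]
    simp [hne, hne.symm, sub_eq_add_neg]
  constructor
  · intro h
    rw [← sub_eq_zero, ← key]
    exact h _ (hS ▸ Submodule.mem_span_singleton_self _)
  · intro h x hx
    rw [hS] at hx
    obtain ⟨c, rfl⟩ := Submodule.mem_span_singleton.1 hx
    have : Q.pairing φ (c • (Pi.single idShuffle (v ⊗ₜ[K] v) - Pi.single swapShuffle (v ⊗ₜ[K] v))) =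
        c * Q.pairing φ (Pi.single idShuffle (v ⊗ₜ[K] v) - Pi.single swapShuffle (v ⊗ₜ[K] v)) := by
      simp only [pairing, Finset.mul_sum, Pi.smul_apply, map_smul, smul_eq_mul]
    rw [this, key, h, sub_self, mul_zero]

/-- A generator `v` whose products `v ⋄_id v` and `v ⋄_(21) v` are identified. -/
noncomputable def SignPresentation.ofSpan (e : Q.V ≃ₗ[K] K) (hS : Q.S = Submodule.span K
    {Pi.single idShuffle (e.symm 1 ⊗ₜ[K] e.symm 1) -
      Pi.single swapShuffle (e.symm 1 ⊗ₜ[K] e.symm 1)}) : Q.SignPresentation 1 where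
  coord := e
  sum_eq_zero x hx := by
    rw [hS] at hx
    obtain ⟨c, rfl⟩ := Submodule.mem_span_singleton.1 hx
    have hne : idShuffle ≠ swapShuffle := by decide
    rw [sum_shuffle_two]
    simp [hne, hne.symm]
  sub_mem := by
    rw [one_smul, ← neg_sub, hS]
    exact Submodule.neg_mem _ (Submodule.mem_span_singleton_self _)

/-- The coordinate on the dual of a one-dimensional space which is given by evaluation at the basis
vector. -/
noncomputable def dualCoord {V : Type*} [AddCommGroup V] [Module K V] (e : V ≃ₗ[K] K) :
    Module.Dual K V ≃ₗ[K] K := e.symm.dualMap ≪≫ₗ LinearMap.ringLmapEquivSelf K K K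

theorem dualCoord_apply {V : Type*} [AddCommGroup V] [Module K V] (e : V ≃ₗ[K] K)
    (f : Module.Dual K V) : dualCoord e f = f (e.symm 1) := by
  simp [dualCoord]

theorem mul'_map_dualCoord {V : Type*} [AddCommGroup V] [Module K V] (e : V ≃ₗ[K] K)
    (t : Module.Dual K V ⊗[K] Module.Dual K V) : LinearMap.mul' K K
      (TensorProduct.map (dualCoord e).toLinearMap (dualCoord e).toLinearMap t) =
      TensorProduct.dualDistrib K V V t (e.symm 1 ⊗ₜ[K] e.symm 1) := by
  induction t using TensorProduct.induction_on with
  | zero => simp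
  | add y z hy hz => simp only [map_add, hy, hz, LinearMap.add_apply]
  | tmul v w => simp [dualCoord_apply]

theorem single_sub_neg_single {M : Type*} [AddCommGroup M] [Module K M] (m : M) :
    Pi.single swapShuffle m - (-1 : K) • (Pi.single idShuffle m : Shuffle 2 1 1 → M) =
      fun _ => m := by
  have hne : idShuffle ≠ swapShuffle := by decide
  funext r
  obtain rfl | rfl := eq_idShuffle_or r
  · simp [hne]
  · simp [hne.symm]

/-- In the Koszul dual of such a presentation, the two products of the dual generator differ by the
sign. -/
theorem SignPresentation.exists_koszulDual (e : Q.V ≃ₗ[K] K) (hS : Q.S = Submodule.span K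
    {Pi.single idShuffle (e.symm 1 ⊗ₜ[K] e.symm 1) -
      Pi.single swapShuffle (e.symm 1 ⊗ₜ[K] e.symm 1)}) :
    ∃ H' : Q.koszulDual.SignPresentation (-1), ∀ f : Module.Dual K Q.V,
      H'.coord f = f (e.symm 1) := by
  refine ⟨⟨dualCoord e, fun φ hφ => ?_, ?_⟩, dualCoord_apply e⟩
  · have h1 := (mem_annihilator_iff hS φ).1 hφ
    have h2 := (mul'_map_dualCoord e _).trans (h1.trans (mul'_map_dualCoord e _).symm)
    rw [sum_shuffle_two, inv_idShuffle, inv_swapShuffle, pow_zero, one_mul, pow_one, neg_one_mul,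
      ← sub_eq_add_neg]
    exact sub_eq_zero.2 h2
  · refine (mem_annihilator_iff hS _).2 ?_
    have h3 := single_sub_neg_single (K := K) ((dualCoord e).symm 1 ⊗ₜ[K] (dualCoord e).symm 1)
    have h4 : ∀ φ : Shuffle 2 1 1 → Module.Dual K Q.V ⊗[K] Module.Dual K Q.V,
        φ idShuffle = φ swapShuffle →
        TensorProduct.dualDistrib K Q.V Q.V (φ idShuffle) (e.symm 1 ⊗ₜ[K] e.symm 1) =
        TensorProduct.dualDistrib K Q.V Q.V (φ swapShuffle) (e.symm 1 ⊗ₜ[K] e.symm 1) := by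
      intro φ h
      rw [h]
    exact h4 _ ((congrFun h3 _).trans (congrFun h3 _).symm)

/-! ### The canonical map from the dual bar construction -/

section Koszul

variable (H : Q.SignPresentation 1) (H' : Q.koszulDual.SignPresentation (-1))
  (hH : ∀ f : Module.Dual K Q.V, H'.coord f = f (H.coord.symm 1)) (h0 : Q.deg = 0)

theorem koszulDual_deg (h0 : Q.deg = 0) : Q.koszulDual.deg = 1 := by
  change Q.deg + 1 = 1
  rw [h0, zero_add]

theorem SignPresentation.κ_gen' {p : ℤ} (h : p = Q.deg) (v : Q.V) :
    H.κ 1 p (Q.gen 1 p v) = H.coord v := by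
  subst h
  exact H.κ_gen v

include hH in
theorem dualCoord_symm_one : H'.coord.symm 1 = H.coord.toLinearMap := by
  refine (LinearEquiv.symm_apply_eq _).2 ?_
  exact ((hH H.coord.toLinearMap).trans (H.coord.apply_symm_apply 1)).symm

include hH in
/-- The twisting morphism is nonzero only on the generator of arity one, like the augmentation. -/
theorem κ_twisting (n : ℕ+) (p : ℤ) (b : Q.koszulDual.permutad.dual.toColl.desuspension.X n p) :
    H.κ n p (Q.twisting n p b) = aug K (Fin n) (((H'.generatorBasis (koszulDual_deg h0)).χ n p b) •
      FreeAlgebra.ι K Finset.univ) := by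
  rw [map_smul, aug_ι, Finset.card_univ, Fintype.card_fin]
  by_cases hn : n = 1 ∧ p = 0
  · obtain ⟨rfl, rfl⟩ := hn
    rw [if_pos PNat.one_coe, smul_eq_mul, mul_one]
    refine (H.κ_gen' h0.symm _).trans ?_
    have h1 : ∀ g : Module.Dual K (Module.Dual K Q.V),
        H.coord ((Module.evalEquiv K Q.V).symm g) = g H.coord.toLinearMap := by
      intro g
      obtain ⟨v, rfl⟩ := (Module.evalEquiv K Q.V).surjective g
      rw [LinearEquiv.symm_apply_apply]
      rfl
    refine (h1 _).trans ?_
    have h2 : Q.koszulDual.gen 1 (0 + 1) (H'.coord.symm 1) = H'.basis 1 (0 + 1) :=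
      (Q.koszulDual.power_one _ _).symm
    rw [dualCoord_symm_one H H' hH] at h2
    exact congrArg (fun x => (show Module.Dual K (Q.koszulDual.permutad.X 1 (0 + 1)) from b) x) h2
  · have h1 : H.κ n p (Q.twisting n p b) = 0 := by
      refine (congrArg (H.κ n p) (Q.gen_eq_zero (by rwa [h0]) _)).trans (map_zero _)
    rw [h1]
    by_cases hp : p + 1 = n
    · rw [if_neg, smul_zero]
      intro h
      have h2 : n = 1 := PNat.eq h
      subst h2
      exact hn ⟨rfl, by simpa using hp⟩
    · rw [GeneratorBasis.χ_eq_zero _ hp, zero_smul]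

/-- The canonical map, as a morphism on the free permutad. -/
noncomputable def canonicalHom (Q : BinaryQuadratic K) :
    Hom (freePermutad Q.koszulDual.permutad.dual.toColl.desuspension) Q.permutad := Q.canonicalMap

include hH in
/-- The canonical map is the augmentation on words. -/
theorem κ_canonicalHom {n : ℕ+} {p : ℤ}
    (x : (freePermutad Q.koszulDual.permutad.dual.toColl.desuspension).X n p) :
    H.κ n p (Q.canonicalHom.map n p x) =
      aug K (Fin n) ((H'.generatorBasis (koszulDual_deg h0)).realize n p x) := by
  induction n, p, x using FreePermutad.induction with
  | hι n p b =>
    rw [GeneratorBasis.realize_ι]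
    exact κ_twisting H H' hH h0 n p b
  | @hop n a b r p q s h x y hx hy =>
    rw [Hom.map_op, H.κ_op, hx, hy, GeneratorBasis.realize_op, map_mul, aug_relabel, aug_relabel,
      one_pow, one_mul]
  | hzero n p => simp only [map_zero]
  | hadd n p x y hx hy => simp only [map_add, hx, hy]
  | hsmul n p c x hx => simp only [map_smul, hx]

include H' h0 in
theorem dualBar_isDGPermutad : Q.koszulDual.permutad.dualBar.IsDGPermutad :=
  (H'.generatorBasis (koszulDual_deg h0)).isDGPermutad (fun n _ _ h => H'.sigma_β _ n h)

include H H' hH h0 in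
/-- Under the realization by words, the canonical map is the augmentation, so that it is a
quasi-isomorphism because the cycles on which the augmentation vanishes are boundaries. -/
theorem isKoszul : Q.IsKoszul := by
  let G := H'.generatorBasis (koszulDual_deg h0)
  have hσ : ∀ (n : ℕ+) {p q : ℤ} (h : q + 1 = p),
      Q.koszulDual.permutad.dual.sigma n h (G.β n p) = G.dGen n q := fun n _ _ h => H'.sigma_β _ n h
  refine ⟨fun n p q h x => H.κ_injective n q ?_,
    fun n p q s hq hs => ⟨fun (y : Q.permutad.X n p) _ => ?_, fun x hx hz => ?_⟩⟩
  · refine (κ_canonicalHom H H' hH h0 _).trans ?_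
    refine (congrArg (aug K (Fin n)) (G.realize_deriv hσ h x)).trans ?_
    rw [aug_d]
    exact (map_zero (H.κ n q)).symm
  · by_cases hp : p = 0
    · subst hp
      obtain ⟨v, hv⟩ := G.exists_aug_eq_one n
      refine ⟨H.κ n 0 y • v, G.eq_zero_of_degree (Or.inl (by omega)) _, 0, ?_⟩
      refine Eq.trans (sub_eq_zero.2 (H.κ_injective n 0 ?_)) (map_zero _).symm
      refine (κ_canonicalHom H H' hH h0 (H.κ n 0 y • v)).trans ?_
      rw [map_smul, map_smul]
      refine (congrArg (H.κ n 0 y • ·) hv).trans ?_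
      rw [smul_eq_mul, mul_one]
    · have hy : y = 0 := H.κ_injective n p
        ((H.κ_eq_zero (by rw [h0, mul_zero]; exact hp) y).trans (map_zero _).symm)
      subst hy
      exact ⟨0, map_zero _, 0, (congrArg (· - 0) (map_zero (Q.canonicalMap.map n p))).trans
        ((sub_zero _).trans (map_zero _).symm)⟩
  · obtain ⟨z, hz⟩ := hz
    refine G.exists_eq_deriv hσ hq hs x hx fun _ => ?_
    refine (κ_canonicalHom H H' hH h0 x).symm.trans ?_
    exact (congrArg (H.κ n p) hz).trans (map_zero (H.κ n p))

end Koszul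

end BinaryQuadratic

/-! ### The terminal permutad -/

theorem conc_mul_zero_le (n : ℕ+) (p : ℤ) : conc K K (p = n * 0) ≤ conc K K (p = 0) :=
  fun _ hx hp => hx (by rwa [mul_zero])

/-- The components of `signAs` and of the terminal permutad agree for `ε = 1` and `δ = 0`. -/
def signAsToPerAs (K : Type u) [Field K] : Hom (signAs K 1 0) (perAs K) where
  map n p := Submodule.inclusion (conc_mul_zero_le n p)
  map_op r _ _ _ h x y := Subtype.ext (by
    change 1 ^ r.inv * (x.1 * y.1) = x.1 * y.1
    rw [one_pow, one_mul])

theorem signAsToPerAs_isIso : (signAsToPerAs K).IsIso := fun n p =>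
  ⟨Submodule.inclusion_injective (conc_mul_zero_le n p), fun y =>
    ⟨⟨y.1, fun hp => y.2 (by rwa [mul_zero] at hp)⟩, rfl⟩⟩

/-- The presentation of the terminal permutad. -/
noncomputable def perAsPresentation.sign (K : Type u) [Field K] :
    (perAsPresentation K).SignPresentation 1 :=
  BinaryQuadratic.SignPresentation.ofSpan (LinearEquiv.refl K K) rfl

theorem perAsPresentation.exists_dual (K : Type u) [Field K] :
    ∃ H' : (perAsPresentation K).koszulDual.SignPresentation (-1),
      ∀ f : Module.Dual K (perAsPresentation K).V,
      H'.coord f = f ((perAsPresentation.sign K).coord.symm 1) :=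
  BinaryQuadratic.SignPresentation.exists_koszulDual _ rfl

theorem perAsPresentation.isKoszul (K : Type u) [Field K] : (perAsPresentation K).IsKoszul := by
  obtain ⟨H', hH⟩ := perAsPresentation.exists_dual K
  exact BinaryQuadratic.isKoszul (perAsPresentation.sign K) H' hH rfl

/-- The presentation of the terminal permutad, as an isomorphism. -/
noncomputable def perAsPresentation.toPerAs (K : Type u) [Field K] :
    Hom (perAsPresentation K).permutad (perAs K) :=
  (signAsToPerAs K).comp (perAsPresentation.sign K).iso

theorem perAsPresentation.toPerAs_isIso (K : Type u) [Field K] :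
    (perAsPresentation.toPerAs K).IsIso :=
  signAsToPerAs_isIso.comp (perAsPresentation.sign K).iso_isIso

end

/-! ### Faces of polytopes -/

section Faces

variable {N : ℕ}

/-- The face of `P` on which the linear functional with the coefficients `l` is maximal. -/
def maxFace (P : Set (Fin N → ℝ)) (l : Fin N → ℝ) : Set (Fin N → ℝ) :=
  {x ∈ P | ∀ y ∈ P, l ⬝ᵥ y ≤ l ⬝ᵥ x}

theorem maxFace_subset (P : Set (Fin N → ℝ)) (l : Fin N → ℝ) : maxFace P l ⊆ P := fun _ h => h.1

/-- A vector of coefficients as a continuous functional. -/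
noncomputable def dotCLM (l : Fin N → ℝ) : StrongDual ℝ (Fin N → ℝ) :=
  LinearMap.toContinuousLinearMap (∑ i, l i • LinearMap.proj i)

theorem dotCLM_apply (l x : Fin N → ℝ) : dotCLM l x = l ⬝ᵥ x := by
  simp [dotCLM, dotProduct]

theorem isExposed_maxFace (P : Set (Fin N → ℝ)) (l : Fin N → ℝ) : IsExposed ℝ P (maxFace P l) :=
  fun _ => ⟨dotCLM l, by simp only [dotCLM_apply]; rfl⟩

theorem exists_dotCLM_eq (f : StrongDual ℝ (Fin N → ℝ)) : ∃ l, f = dotCLM l := by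
  refine ⟨fun i => f (Pi.single i 1), ?_⟩
  ext x
  rw [dotCLM_apply, dotProduct]
  conv_lhs => rw [← Finset.univ_sum_single x, map_sum]
  refine Finset.sum_congr rfl fun i _ => ?_
  rw [show Pi.single i (x i) = x i • Pi.single i (1 : ℝ) by
    rw [← Pi.single_smul', smul_eq_mul, mul_one], map_smul, smul_eq_mul, mul_comm]

theorem IsExposed.exists_eq_maxFace {P F : Set (Fin N → ℝ)} (h : IsExposed ℝ P F)
    (hF : F.Nonempty) : ∃ l, F = maxFace P l := by
  obtain ⟨f, hf⟩ := h hF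
  obtain ⟨l, rfl⟩ := exists_dotCLM_eq f
  exact ⟨l, hf.trans (by simp only [dotCLM_apply]; rfl)⟩

theorem maxFace_congr {P : Set (Fin N → ℝ)} {l l' : Fin N → ℝ} (c : ℝ)
    (h : ∀ x ∈ P, l' ⬝ᵥ x = l ⬝ᵥ x + c) : maxFace P l' = maxFace P l := by
  ext x
  refine and_congr_right fun hx => forall₂_congr fun y hy => ?_
  rw [h x hx, h y hy, add_le_add_iff_right]

/-- A nonempty face which is contained in a smaller subset is a face of the latter. -/
theorem maxFace_eq_of_subset {P Q : Set (Fin N → ℝ)} {l : Fin N → ℝ} (hQ : Q ⊆ P)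
    (h : maxFace P l ⊆ Q) (hne : (maxFace P l).Nonempty) : maxFace P l = maxFace Q l := by
  obtain ⟨z, hz⟩ := hne
  ext x
  exact ⟨fun hx => ⟨h hx, fun y hy => hx.2 y (hQ hy)⟩,
    fun hx => ⟨hQ hx.1, fun y hy => (hz.2 y hy).trans (hx.2 z (h hz))⟩⟩

/-- A face of the convex hull of `V` is the convex hull of the elements of `V` which it contains. -/
theorem maxFace_convexHull (V : Set (Fin N → ℝ)) (l : Fin N → ℝ) :
    maxFace (convexHull ℝ V) l ⊆ convexHull ℝ (V ∩ maxFace (convexHull ℝ V) l) := by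
  intro x hx
  set A := V ∩ maxFace (convexHull ℝ V) l with hA
  set B := V \ maxFace (convexHull ℝ V) l with hB
  have hAB : A ∪ B = V := Set.inter_union_sdiff V _
  have hconv : Convex ℝ {y : Fin N → ℝ | l ⬝ᵥ y < l ⬝ᵥ x} := by
    simp only [← dotCLM_apply]
    exact convex_halfSpace_lt (dotCLM l).isLinear _
  -- a point of the face has no share in the points outside of it, where `l` is smaller
  have hlt : ∀ y ∈ convexHull ℝ B, l ⬝ᵥ y < l ⬝ᵥ x := by
    refine fun y hy => convexHull_min (fun z hz => ?_) hconv hy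
    change l ⬝ᵥ z < l ⬝ᵥ x
    refine lt_of_not_ge fun h => hz.2 ⟨subset_convexHull ℝ V hz.1, fun y hy => ?_⟩
    exact (hx.2 y hy).trans h
  by_cases hB0 : B.Nonempty
  · by_cases hA0 : A.Nonempty
    · have hx1 := hx.1
      rw [← hAB, convexHull_union hA0 hB0, mem_convexJoin] at hx1
      obtain ⟨y, hy, z, hz, s, t, hs, ht, hst, rfl⟩ := hx1
      rcases ht.eq_or_lt with rfl | ht
      · obtain rfl : s = 1 := by linarith
        simpa using hy
      · exfalso
        have h1 := hlt z hz
        have h2 := hx.2 y (convexHull_mono Set.inter_subset_left hy)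
        simp only [dotProduct_add, dotProduct_smul, smul_eq_mul] at h1 h2
        obtain rfl : s = 1 - t := by linarith
        have h3 : l ⬝ᵥ y ≤ l ⬝ᵥ z := le_of_mul_le_mul_left (by linarith) ht
        linarith [mul_nonneg hs (sub_nonneg.2 h3)]
    · rw [Set.not_nonempty_iff_eq_empty.1 hA0, Set.empty_union] at hAB
      rw [← hAB] at hx
      exact absurd (hlt x hx.1) (lt_irrefl _)
  · rw [Set.not_nonempty_iff_eq_empty.1 hB0, Set.union_empty] at hAB
    rw [hAB]
    exact hx.1

theorem convex_maxFace {P : Set (Fin N → ℝ)} (hP : Convex ℝ P) (l : Fin N → ℝ) :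
    Convex ℝ (maxFace P l) := by
  intro x hx y hy s t hs ht hst
  refine ⟨hP hx.1 hy.1 hs ht hst, fun z hz => ?_⟩
  have h1 := hx.2 z hz
  have h2 := hy.2 z hz
  simp only [dotProduct_add, dotProduct_smul, smul_eq_mul]
  have h3 : l ⬝ᵥ z = s * l ⬝ᵥ z + t * l ⬝ᵥ z := by rw [← add_mul, hst, one_mul]
  linarith [mul_le_mul_of_nonneg_left h1 hs, mul_le_mul_of_nonneg_left h2 ht]

theorem maxFace_convexHull_eq (V : Set (Fin N → ℝ)) (l : Fin N → ℝ) :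
    maxFace (convexHull ℝ V) l = convexHull ℝ (V ∩ maxFace (convexHull ℝ V) l) :=
  (maxFace_convexHull V l).antisymm
    (convexHull_min Set.inter_subset_right (convex_maxFace (convex_convexHull ℝ V) l))

theorem maxFace_nonempty {V : Set (Fin N → ℝ)} (hV : V.Finite) (hne : V.Nonempty)
    (l : Fin N → ℝ) : (maxFace (convexHull ℝ V) l).Nonempty := by
  obtain ⟨x, hx, hmax⟩ := hV.exists_maximalFor (fun y => l ⬝ᵥ y) V hne
  have hle : ∀ y ∈ V, l ⬝ᵥ y ≤ l ⬝ᵥ x := fun y hy =>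
    (le_total (l ⬝ᵥ y) (l ⬝ᵥ x)).elim id fun h => hmax hy h
  refine ⟨x, subset_convexHull ℝ V hx, fun y hy => ?_⟩
  have hconv : Convex ℝ {y : Fin N → ℝ | l ⬝ᵥ y ≤ l ⬝ᵥ x} := by
    simp only [← dotCLM_apply]
    exact convex_halfSpace_le (dotCLM l).isLinear _
  exact convexHull_min hle hconv hy

/-- A polytope has finitely many cells. -/
theorem finite_cell {V : Set (Fin N → ℝ)} (hV : V.Finite) (p : ℤ) :
    Finite (Cell (convexHull ℝ V) p) := by
  have h : Set.Finite {F | IsCell (convexHull ℝ V) p F} := by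
    refine (hV.finite_subsets.image (convexHull ℝ)).subset ?_
    rintro F ⟨hne, hF, -⟩
    obtain ⟨l, rfl⟩ := hF.exists_eq_maxFace hne
    exact ⟨_, Set.inter_subset_left, (maxFace_convexHull_eq V l).symm⟩
  exact h.to_subtype

end Faces

/-! ### Products of permutohedra -/

namespace Shuffle

variable {n a b : ℕ+} (r : Shuffle n a b)

@[simp] theorem combine_emb₀ (c : ℝ) (x : Fin a → ℝ) (y : Fin b → ℝ) (j : Fin a) :
    r.combine c x y (r.emb₀ j) = x j := by
  simp [combine]

@[simp] theorem combine_emb₁ (c : ℝ) (x : Fin a → ℝ) (y : Fin b → ℝ) (j : Fin b) :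
    r.combine c x y (r.emb₁ j) = y j + c := by
  simp [combine]

theorem combine_ext {x y : Fin n → ℝ} (h0 : ∀ j, x (r.emb₀ j) = y (r.emb₀ j))
    (h1 : ∀ j, x (r.emb₁ j) = y (r.emb₁ j)) : x = y :=
  funext fun i => r.emb_cases (P := fun i => x i = y i) h0 h1 i

theorem combine_injective {c : ℝ} {x x' : Fin a → ℝ} {y y' : Fin b → ℝ}
    (h : r.combine c x y = r.combine c x' y') : x = x' ∧ y = y' := by
  constructor <;> funext j
  · simpa using congrFun h (r.emb₀ j)
  · simpa using congrFun h (r.emb₁ j)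

theorem sum_eq {M : Type*} [AddCommMonoid M] (f : Fin n → M) :
    ∑ i, f i = ∑ j, f (r.emb₀ j) + ∑ j, f (r.emb₁ j) := by
  rw [← r.fib_union, Finset.sum_union r.disjoint_fib, fib₀, fib₁, Finset.sum_map, Finset.sum_map]
  rfl

theorem dotProduct_combine (l : Fin n → ℝ) (c : ℝ) (x : Fin a → ℝ) (y : Fin b → ℝ) :
    l ⬝ᵥ r.combine c x y =
      (l ∘ r.emb₀) ⬝ᵥ x + (l ∘ r.emb₁) ⬝ᵥ y + c * ∑ j, l (r.emb₁ j) := by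
  rw [dotProduct, r.sum_eq]
  simp only [combine_emb₀, combine_emb₁, dotProduct, mul_add, Finset.sum_add_distrib,
    Function.comp_apply, ← Finset.sum_mul]
  ring

theorem combine_convex (c : ℝ) {s t : ℝ} (h : s + t = 1) (x x' : Fin a → ℝ) (y y' : Fin b → ℝ) :
    r.combine c (s • x + t • x') (s • y + t • y') =
      s • r.combine c x y + t • r.combine c x' y' := by
  refine r.combine_ext (fun j => by simp) fun j => ?_
  simp only [combine_emb₁, Pi.add_apply, Pi.smul_apply, smul_eq_mul]
  linear_combination (-c) * h

theorem combine_mem_prodCell {F : Set (Fin a → ℝ)} {G : Set (Fin b → ℝ)} {x : Fin a → ℝ}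
    {y : Fin b → ℝ} : r.combine (a : ℕ) x y ∈ r.prodCell F G ↔ x ∈ F ∧ y ∈ G := by
  constructor
  · rintro ⟨x', hx', y', hy', h⟩
    obtain ⟨rfl, rfl⟩ := r.combine_injective h
    exact ⟨hx', hy'⟩
  · exact fun h => ⟨x, h.1, y, h.2, rfl⟩

theorem convex_prodCell {F : Set (Fin a → ℝ)} {G : Set (Fin b → ℝ)} (hF : Convex ℝ F)
    (hG : Convex ℝ G) : Convex ℝ (r.prodCell F G) := by
  rintro _ ⟨x, hx, y, hy, rfl⟩ _ ⟨x', hx', y', hy', rfl⟩ s t hs ht hst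
  rw [← r.combine_convex _ hst]
  exact ⟨_, hF hx hx' hs ht hst, _, hG hy hy' hs ht hst, rfl⟩

theorem prodCell_nonempty {F : Set (Fin a → ℝ)} {G : Set (Fin b → ℝ)} (hF : F.Nonempty)
    (hG : G.Nonempty) : (r.prodCell F G).Nonempty := hF.image2 hG

theorem prodCell_mono {F F' : Set (Fin a → ℝ)} {G G' : Set (Fin b → ℝ)} (hF : F ⊆ F')
    (hG : G ⊆ G') : r.prodCell F G ⊆ r.prodCell F' G' := Set.image2_subset hF hG

theorem prodCell_subset_iff {F F' : Set (Fin a → ℝ)} {G G' : Set (Fin b → ℝ)} (hF : F.Nonempty)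
    (hG : G.Nonempty) : r.prodCell F G ⊆ r.prodCell F' G' ↔ F ⊆ F' ∧ G ⊆ G' := by
  refine ⟨fun h => ⟨fun x hx => ?_, fun y hy => ?_⟩, fun h => r.prodCell_mono h.1 h.2⟩
  · obtain ⟨y, hy⟩ := hG
    exact (r.combine_mem_prodCell.1 (h (r.combine_mem_prodCell.2 ⟨hx, hy⟩))).1
  · obtain ⟨x, hx⟩ := hF
    exact (r.combine_mem_prodCell.1 (h (r.combine_mem_prodCell.2 ⟨hx, hy⟩))).2

theorem prodCell_injective {F F' : Set (Fin a → ℝ)} {G G' : Set (Fin b → ℝ)} (hF : F.Nonempty)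
    (hG : G.Nonempty) (h : r.prodCell F G = r.prodCell F' G') : F = F' ∧ G = G' := by
  have hne : (r.prodCell F' G').Nonempty := h ▸ r.prodCell_nonempty hF hG
  obtain ⟨_, x, hx, y, hy, -⟩ := hne
  have h1 := (r.prodCell_subset_iff hF hG).1 h.subset
  have h2 := (r.prodCell_subset_iff ⟨x, hx⟩ ⟨y, hy⟩).1 h.symm.subset
  exact ⟨h1.1.antisymm h2.1, h1.2.antisymm h2.2⟩

/-- A face of a product is the product of the faces. -/
theorem maxFace_prodCell (F : Set (Fin a → ℝ)) (G : Set (Fin b → ℝ)) (l : Fin n → ℝ) :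
    maxFace (r.prodCell F G) l = r.prodCell (maxFace F (l ∘ r.emb₀)) (maxFace G (l ∘ r.emb₁)) := by
  ext z
  constructor
  · rintro ⟨⟨x, hx, y, hy, rfl⟩, hmax⟩
    refine r.combine_mem_prodCell.2 ⟨⟨hx, fun x' hx' => ?_⟩, ⟨hy, fun y' hy' => ?_⟩⟩
    · have := hmax _ (r.combine_mem_prodCell.2 ⟨hx', hy⟩)
      rw [dotProduct_combine, dotProduct_combine] at this
      linarith
    · have := hmax _ (r.combine_mem_prodCell.2 ⟨hx, hy'⟩)
      rw [dotProduct_combine, dotProduct_combine] at this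
      linarith
  · rintro ⟨x, hx, y, hy, rfl⟩
    refine ⟨r.combine_mem_prodCell.2 ⟨hx.1, hy.1⟩, ?_⟩
    rintro _ ⟨x', hx', y', hy', rfl⟩
    rw [dotProduct_combine, dotProduct_combine]
    have h1 := hx.2 x' hx'
    have h2 := hy.2 y' hy'
    linarith

end Shuffle

namespace Permutohedron

/-- The permutations of `(1, …, n)`. -/
def vertices (n : ℕ+) : Set (Fin n → ℝ) :=
  Set.range fun (σ : Equiv.Perm (Fin n)) (i : Fin n) => ((σ i : ℕ) : ℝ) + 1

theorem finite_vertices (n : ℕ+) : (vertices n).Finite := Set.finite_range _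

theorem vertices_nonempty (n : ℕ+) : (vertices n).Nonempty := Set.range_nonempty _

theorem nonempty (n : ℕ+) : (permutohedron n).Nonempty := (vertices_nonempty n).convexHull

theorem convex (n : ℕ+) : Convex ℝ (permutohedron n) := convex_convexHull ℝ _

theorem nonempty_maxFace {n : ℕ+} (l : Fin n → ℝ) : (maxFace (permutohedron n) l).Nonempty :=
  maxFace_nonempty (finite_vertices n) (vertices_nonempty n) l

theorem mem_vertices {n : ℕ+} {f : Fin n → ℕ} (hf : Function.Injective f) (hlt : ∀ i, f i < n) :
    (fun i => (f i : ℝ) + 1) ∈ vertices n := by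
  let g : Fin n → Fin n := fun i => ⟨f i, hlt i⟩
  have hg : Function.Injective g := fun i j h => hf (congrArg Fin.val h)
  exact ⟨Equiv.ofBijective g (Finite.injective_iff_bijective.1 hg), rfl⟩

variable {n a b : ℕ+} (r : Shuffle n a b)

theorem combine_mem_vertices {x : Fin a → ℝ} {y : Fin b → ℝ} (hx : x ∈ vertices a)
    (hy : y ∈ vertices b) : r.combine (a : ℕ) x y ∈ vertices n := by
  obtain ⟨σ, rfl⟩ := hx
  obtain ⟨τ, rfl⟩ := hy
  let f : Fin n → ℕ := fun i => if h : r.1 i = 0 then σ (r.idx₀ i h) else τ (r.idx₁ i h) + a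
  have f0 : ∀ j, f (r.emb₀ j) = σ j := fun j => by simp [f]
  have f1 : ∀ j, f (r.emb₁ j) = τ j + a := fun j => by simp [f]
  have hcard := r.card_eq
  have : r.combine (a : ℕ) (fun i => ((σ i : ℕ) : ℝ) + 1) (fun i => ((τ i : ℕ) : ℝ) + 1) =
      fun i => (f i : ℝ) + 1 := by
    refine r.combine_ext (fun j => ?_) fun j => ?_
    · rw [r.combine_emb₀, f0]
    · rw [r.combine_emb₁, f1]
      push_cast
      ring
  rw [this]
  refine mem_vertices (fun i => ?_) fun i => ?_
  · induction i using r.emb_cases with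
    | h0 i =>
      intro i' h
      induction i' using r.emb_cases with
      | h0 i' =>
        rw [f0, f0] at h
        rw [σ.injective (Fin.ext h)]
      | h1 i' =>
        rw [f0, f1] at h
        have := (σ i).2
        omega
    | h1 i =>
      intro i' h
      induction i' using r.emb_cases with
      | h0 i' =>
        rw [f0, f1] at h
        have := (σ i').2
        omega
      | h1 i' =>
        rw [f1, f1, Nat.add_right_cancel_iff] at h
        rw [τ.injective (Fin.ext h)]
  · induction i using r.emb_cases with
    | h0 i =>
      rw [f0]
      have := (σ i).2
      omega
    | h1 i =>
      rw [f1]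
      have := (τ i).2
      omega

theorem prodCell_subset : r.prodCell (permutohedron a) (permutohedron b) ⊆ permutohedron n := by
  have h1 : ∀ x ∈ vertices a, ∀ y ∈ permutohedron b, r.combine (a : ℕ) x y ∈ permutohedron n := by
    intro x hx y hy
    refine convexHull_min (t := {y | r.combine (a : ℕ) x y ∈ permutohedron n})
      (fun y hy => subset_convexHull ℝ _ (combine_mem_vertices r hx hy)) ?_ hy
    intro y hy y' hy' s t hs ht hst
    have := convex n hy hy' hs ht hst
    rwa [← r.combine_convex _ hst, ← add_smul, hst, one_smul] at this
  rintro _ ⟨x, hx, y, hy, rfl⟩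
  refine convexHull_min (t := {x | r.combine (a : ℕ) x y ∈ permutohedron n})
      (fun x hx => h1 x hx y hy) ?_ hx
  intro x hx x' hx' s t hs ht hst
  have := convex n hx hx' hs ht hst
  rwa [← r.combine_convex _ hst, ← add_smul, hst, one_smul] at this

/-- The permutations which are smaller on the first fibre than on the second lie in the facet of the
shuffle. -/
theorem mem_prodCell_of_lt (σ : Equiv.Perm (Fin n)) (h : ∀ i j, σ (r.emb₀ i) < σ (r.emb₁ j)) :
    (fun i => ((σ i : ℕ) : ℝ) + 1) ∈ r.prodCell (permutohedron a) (permutohedron b) := by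
  have hcard := r.card_eq
  -- the `b` values on the second fibre lie above `σ (r.emb₀ i)`
  have h0 : ∀ i, (σ (r.emb₀ i) : ℕ) < a := by
    intro i
    have h1 : (Finset.univ.map (r.emb₁.toEmbedding.trans σ.toEmbedding)) ⊆
        Finset.Ioi (σ (r.emb₀ i)) := by
      intro k hk
      obtain ⟨j, -, rfl⟩ := Finset.mem_map.1 hk
      exact Finset.mem_Ioi.2 (h i j)
    have h2 := Finset.card_le_card h1
    rw [Finset.card_map, Finset.card_univ, Fintype.card_fin, Fin.card_Ioi] at h2
    have := (σ (r.emb₀ i)).2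
    have := b.pos
    omega
  -- the `a` values on the first fibre lie below `σ (r.emb₁ j)`
  have h1 : ∀ j, (a : ℕ) ≤ σ (r.emb₁ j) := by
    intro j
    have h1 : (Finset.univ.map (r.emb₀.toEmbedding.trans σ.toEmbedding)) ⊆
        Finset.Iio (σ (r.emb₁ j)) := by
      intro k hk
      obtain ⟨i, -, rfl⟩ := Finset.mem_map.1 hk
      exact Finset.mem_Iio.2 (h i j)
    have h2 := Finset.card_le_card h1
    rwa [Finset.card_map, Finset.card_univ, Fintype.card_fin, Fin.card_Iio] at h2
  refine ⟨fun i => ((σ (r.emb₀ i) : ℕ) : ℝ) + 1, subset_convexHull ℝ _ (mem_vertices ?_ h0),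
    fun j => (((σ (r.emb₁ j) : ℕ) - a : ℕ) : ℝ) + 1, subset_convexHull ℝ _ (mem_vertices ?_ ?_), ?_⟩
  · intro i i' hi
    exact r.emb₀.injective (σ.injective (Fin.ext hi))
  · intro j j' hj
    have := h1 j
    have := h1 j'
    exact r.emb₁.injective (σ.injective (Fin.ext (by simp only at hj; omega)))
  · intro j
    have := h1 j
    have := (σ (r.emb₁ j)).2
    omega
  · refine r.combine_ext (fun j => by rw [r.combine_emb₀]) fun j => ?_
    rw [r.combine_emb₁, Nat.cast_sub (h1 j)]
    ring

/-- A linear form with larger coefficients on the second fibre than on the first attains its maximum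
only on the facet of the shuffle: by rearrangement, a maximal vertex is smaller on the first
fibre. -/
theorem maxFace_subset_prodCell {l : Fin n → ℝ} (hl : ∀ i j, l (r.emb₀ i) < l (r.emb₁ j)) :
    maxFace (permutohedron n) l ⊆ r.prodCell (permutohedron a) (permutohedron b) := by
  refine (maxFace_convexHull (vertices n) l).trans
    (convexHull_min ?_ (r.convex_prodCell (convex a) (convex b)))
  rintro _ ⟨⟨σ, rfl⟩, hσ⟩
  refine mem_prodCell_of_lt r σ fun i j => ?_
  by_contra! hle
  have hne : σ (r.emb₀ i) ≠ σ (r.emb₁ j) := fun h => r.emb₀_ne_emb₁ i j (σ.injective h)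
  have hlt : ((σ (r.emb₁ j) : ℕ) : ℝ) < (σ (r.emb₀ i) : ℕ) := by
    exact_mod_cast lt_of_le_of_ne hle hne.symm
  -- exchanging the two values increases the functional
  set i' := r.emb₀ i with hi'
  set j' := r.emb₁ j with hj'
  have hij : i' ≠ j' := r.emb₀_ne_emb₁ i j
  have h1 := hσ.2 _ (subset_convexHull ℝ _ ⟨(Equiv.swap i' j').trans σ, rfl⟩)
  have h2 : (l ⬝ᵥ fun k => ((((Equiv.swap i' j').trans σ) k : ℕ) : ℝ) + 1) -
      (l ⬝ᵥ fun k => ((σ k : ℕ) : ℝ) + 1) =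
      (l j' - l i') * (((σ i' : ℕ) : ℝ) - (σ j' : ℕ)) := by
    rw [← dotProduct_sub, dotProduct, Finset.sum_eq_add i' j' hij]
    · simp
      ring
    · intro k _ hk
      simp [Equiv.swap_apply_of_ne_of_ne hk.1 hk.2]
    · simp
    · simp
  have h3 := hl i j
  nlinarith [mul_pos (sub_pos.2 h3) (sub_pos.2 hlt)]

/-- The faces on which a functional with `l_i < l_j` for all `i` in the first and `j` in the second
fibre is maximal. -/
theorem maxFace_eq_prodCell {l : Fin n → ℝ} (hl : ∀ i j, l (r.emb₀ i) < l (r.emb₁ j)) :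
    maxFace (permutohedron n) l = r.prodCell (maxFace (permutohedron a) (l ∘ r.emb₀))
      (maxFace (permutohedron b) (l ∘ r.emb₁)) := by
  rw [maxFace_eq_of_subset (prodCell_subset r) (maxFace_subset_prodCell r hl) (nonempty_maxFace l),
    r.maxFace_prodCell]

/-- Every face of the permutohedron which is contained in a product of permutohedra is a product of
faces. -/
theorem maxFace_eq_prodCell_of_subset {l : Fin n → ℝ}
    (h : maxFace (permutohedron n) l ⊆ r.prodCell (permutohedron a) (permutohedron b)) :
    maxFace (permutohedron n) l = r.prodCell (maxFace (permutohedron a) (l ∘ r.emb₀))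
      (maxFace (permutohedron b) (l ∘ r.emb₁)) := by
  rw [maxFace_eq_of_subset (prodCell_subset r) h (nonempty_maxFace l),
    r.maxFace_prodCell]

theorem sum_eq_of_mem {x : Fin n → ℝ} (hx : x ∈ permutohedron n) :
    ∑ i, x i = ∑ i : Fin n, (((i : ℕ) : ℝ) + 1) := by
  refine convexHull_min (t := {x : Fin n → ℝ | ∑ i, x i = ∑ i : Fin n, (((i : ℕ) : ℝ) + 1)})
    ?_ ?_ hx
  · rintro _ ⟨σ, rfl⟩
    exact Equiv.sum_comp σ fun i => (((i : ℕ) : ℝ) + 1)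
  · intro x hx y hy s t hs ht hst
    simp only [Set.mem_ofPred_eq] at hx hy ⊢
    simp only [Pi.add_apply, Pi.smul_apply, smul_eq_mul, Finset.sum_add_distrib, ← Finset.mul_sum,
      hx, hy, ← add_mul, hst, one_mul]

theorem one_le_of_mem {x : Fin n → ℝ} (hx : x ∈ permutohedron n) (i : Fin n) : 1 ≤ x i := by
  refine convexHull_min (t := {x : Fin n → ℝ | 1 ≤ x i}) ?_ ?_ hx
  · rintro _ ⟨σ, rfl⟩
    simp
  · exact convex_halfSpace_ge (LinearMap.proj (R := ℝ) (φ := fun _ : Fin n => ℝ) i).isLinear 1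

theorem exists_eq_one (i : Fin n) : ∃ x ∈ permutohedron n, x i = 1 := by
  refine ⟨_, subset_convexHull ℝ _ ⟨Equiv.swap i ⟨0, n.pos⟩, rfl⟩, ?_⟩
  simp

theorem maxFace_add_const (l : Fin n → ℝ) (c : ℝ) :
    maxFace (permutohedron n) (fun i => l i + c) = maxFace (permutohedron n) l := by
  refine maxFace_congr (c * ∑ i : Fin n, (((i : ℕ) : ℝ) + 1)) fun x hx => ?_
  rw [← sum_eq_of_mem hx]
  simp only [dotProduct, add_mul, Finset.sum_add_distrib, Finset.mul_sum]

/-- A product of faces is a face. -/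
theorem exists_prodCell_eq (l₀ : Fin a → ℝ) (l₁ : Fin b → ℝ) :
    ∃ l, r.prodCell (maxFace (permutohedron a) l₀) (maxFace (permutohedron b) l₁) =
      maxFace (permutohedron n) l := by
  -- a large constant makes the functional bigger on the second fibre
  obtain ⟨c, hc⟩ : ∃ c : ℝ, ∀ i j, l₀ i < l₁ j + c := by
    obtain ⟨c, hc⟩ := (Set.finite_range fun x : Fin a × Fin b => l₀ x.1 - l₁ x.2).bddAbove
    refine ⟨c + 1, fun i j => ?_⟩
    have := hc ⟨(i, j), rfl⟩
    simp only at this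
    linarith
  refine ⟨r.combine c l₀ l₁, ?_⟩
  have h0 : r.combine c l₀ l₁ ∘ r.emb₀ = l₀ := funext fun j => r.combine_emb₀ c l₀ l₁ j
  have h1 : r.combine c l₀ l₁ ∘ r.emb₁ = fun j => l₁ j + c :=
    funext fun j => r.combine_emb₁ c l₀ l₁ j
  rw [maxFace_eq_prodCell r, h0, h1, maxFace_add_const]
  intro i j
  rw [r.combine_emb₀, r.combine_emb₁]
  exact hc i j

theorem maxFace_zero : maxFace (permutohedron n) 0 = permutohedron n := by
  ext x
  simp [maxFace]

end Permutohedron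

/-! ### The cells of the permutohedra -/

open Permutohedron

/-- The face of the permutohedron which belongs to an ordered partition. -/
def OrderedPartition.cell : ∀ {n : ℕ+}, OrderedPartition n → Set (Fin n → ℝ)
  | _, .top n => permutohedron n
  | _, .cons (a := a) r c => r.prodCell (permutohedron a) c.cell

namespace OrderedPartition

theorem exists_cell_eq_maxFace {n : ℕ+} (c : OrderedPartition n) :
    ∃ l, c.cell = maxFace (permutohedron n) l := by
  induction c with
  | top n => exact ⟨0, maxFace_zero.symm⟩
  | cons r c ih =>
    obtain ⟨l, hl⟩ := ih
    rw [cell, hl, ← maxFace_zero]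
    exact exists_prodCell_eq r 0 l

theorem cell_nonempty {n : ℕ+} (c : OrderedPartition n) : c.cell.Nonempty := by
  obtain ⟨l, hl⟩ := c.exists_cell_eq_maxFace
  rw [hl]
  exact nonempty_maxFace l

/-- Every face is the cell of an ordered partition, namely of the one into the level sets of the
linear form, in increasing order of its values. -/
theorem exists_maxFace_eq {n : ℕ+} (l : Fin n → ℝ) :
    ∃ c : OrderedPartition n, maxFace (permutohedron n) l = c.cell := by
  obtain ⟨N, hN⟩ : ∃ N : ℕ, (n : ℕ) = N := ⟨n, rfl⟩
  induction N using Nat.strong_induction_on generalizing n with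
  | _ N ih =>
    obtain ⟨i₀, hi₀⟩ := Finite.exists_min l
    by_cases h : ∀ i, l i = l i₀
    · refine ⟨.top n, ?_⟩
      have : l = fun i => (0 : Fin n → ℝ) i + l i₀ := funext fun i => by rw [h i]; simp
      rw [this, maxFace_add_const, maxFace_zero, cell]
    · push Not at h
      obtain ⟨i₁, hi₁⟩ := h
      -- the first block consists of the indices with minimal coefficients
      obtain ⟨a, b, r, hr⟩ := Shuffle.exists_fib₀_eq
        (A := Finset.univ.filter fun i => l i = l i₀) ⟨i₀, by simp⟩
        fun h => hi₁ (by have := Finset.mem_univ i₁; rw [← h] at this; simpa using this)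
      have h0 : ∀ j, l (r.emb₀ j) = l i₀ := fun j => by
        have : r.emb₀ j ∈ r.fib₀ := (r.mem_fib₀ _).2 (r.apply_emb₀ j)
        rw [hr] at this
        simpa using this
      have h1 : ∀ j, l i₀ < l (r.emb₁ j) := fun j => by
        refine lt_of_le_of_ne (hi₀ _) fun h => ?_
        have h2 : r.emb₁ j ∈ r.fib₀ := by rw [hr]; simpa using h.symm
        rw [r.mem_fib₀, r.apply_emb₁] at h2
        exact one_ne_zero h2
      have hcard := r.card_eq
      have ha := a.pos
      obtain ⟨c, hc⟩ := ih b (by omega) (l ∘ r.emb₁) rfl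
      refine ⟨.cons r c, ?_⟩
      have h2 : l ∘ r.emb₀ = fun i => (0 : Fin a → ℝ) i + l i₀ := funext fun i => by
        simp [h0 i]
      rw [maxFace_eq_prodCell r fun i j => by rw [h0]; exact h1 j, hc, h2, maxFace_add_const,
        maxFace_zero, cell]

/-- The cell of an ordered partition determines its first block, by the coordinates which take the
value `1`. -/
theorem cell_injective {n : ℕ+} :
    Function.Injective (cell : OrderedPartition n → Set (Fin n → ℝ)) := by
  -- the first block consists of the coordinates which take the value `1`
  have htop : ∀ {n a b : ℕ+} (r : Shuffle n a b) (G : Set (Fin b → ℝ)), G ⊆ permutohedron b →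
      ∀ i, (∃ x ∈ r.prodCell (permutohedron a) G, x i = 1) → r.1 i = 0 := by
    rintro n a b r G hG i ⟨_, ⟨x, hx, y, hy, rfl⟩, h⟩
    induction i using r.emb_cases with
    | h0 i => exact r.apply_emb₀ i
    | h1 i =>
      rw [r.combine_emb₁] at h
      have h1 := one_le_of_mem (hG hy) i
      have h2 : (0 : ℝ) < (a : ℕ) := by exact_mod_cast a.pos
      linarith
  have hzero : ∀ {n a b : ℕ+} (r : Shuffle n a b) (G : Set (Fin b → ℝ)), G.Nonempty →
      ∀ i, r.1 i = 0 → (∃ x ∈ r.prodCell (permutohedron a) G, x i = 1) := by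
    rintro n a b r G ⟨y, hy⟩ i h
    obtain ⟨j, rfl⟩ := r.exists_emb₀ h
    obtain ⟨x, hx, h1⟩ := exists_eq_one j
    exact ⟨_, r.combine_mem_prodCell.2 ⟨hx, hy⟩, by rw [r.combine_emb₀, h1]⟩
  have hsub : ∀ {n : ℕ+} (c : OrderedPartition n), c.cell ⊆ permutohedron n := fun c => by
    obtain ⟨l, hl⟩ := c.exists_cell_eq_maxFace
    rw [hl]
    exact maxFace_subset _ _
  have hne : ∀ {n a b : ℕ+} (r : Shuffle n a b) (c : OrderedPartition b),
      (cons r c).cell ≠ permutohedron n := by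
    intro n a b r c h
    have h1 : r.1 (r.emb₁ ⟨0, b.pos⟩) = 0 := by
      refine htop r c.cell (hsub c) _ ?_
      rw [cell] at h
      rw [h]
      exact exists_eq_one _
    rw [r.apply_emb₁] at h1
    exact one_ne_zero h1
  intro c c' h
  induction c with
  | top n =>
    cases c' with
    | top => rfl
    | cons r c' => exact absurd h.symm (hne r c')
  | @cons n a b r c ih =>
    cases c' with
    | top => exact absurd h (hne r c)
    | @cons _ a' b' r' c' =>
      have hfib : r.fib₀ = r'.fib₀ := by
        ext i
        rw [r.mem_fib₀, r'.mem_fib₀]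
        rw [cell, cell] at h
        constructor
        · intro hi
          have := hzero r c.cell c.cell_nonempty i hi
          rw [h] at this
          exact htop r' c'.cell (hsub c') i this
        · intro hi
          have := hzero r' c'.cell c'.cell_nonempty i hi
          rw [← h] at this
          exact htop r c.cell (hsub c) i this
      obtain ⟨rfl, rfl, hr⟩ := Shuffle.cases_eq hfib
      obtain rfl := eq_of_heq hr
      rw [cell, cell] at h
      rw [ih (r.prodCell_injective (nonempty a) c.cell_nonempty h).2]

end OrderedPartition

/-! ### The directions of the cells -/

open Permutohedron

namespace Shuffle

variable {n a b : ℕ+} (r : Shuffle n a b)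

/-- The inclusion of the first factor. -/
noncomputable def inl : (Fin a → ℝ) →ₗ[ℝ] (Fin n → ℝ) where
  toFun x := r.combine 0 x 0
  map_add' x x' := r.combine_ext (fun j => by simp) fun j => by simp
  map_smul' c x := r.combine_ext (fun j => by simp) fun j => by simp

/-- The inclusion of the second factor. -/
noncomputable def inr : (Fin b → ℝ) →ₗ[ℝ] (Fin n → ℝ) where
  toFun y := r.combine 0 0 y
  map_add' x x' := r.combine_ext (fun j => by simp) fun j => by simp
  map_smul' c x := r.combine_ext (fun j => by simp) fun j => by simp

@[simp] theorem inl_emb₀ (x : Fin a → ℝ) (j : Fin a) : r.inl x (r.emb₀ j) = x j :=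
  r.combine_emb₀ 0 x 0 j

@[simp] theorem inl_emb₁ (x : Fin a → ℝ) (j : Fin b) : r.inl x (r.emb₁ j) = 0 :=
  (r.combine_emb₁ 0 x 0 j).trans (by simp)

@[simp] theorem inr_emb₀ (y : Fin b → ℝ) (j : Fin a) : r.inr y (r.emb₀ j) = 0 :=
  r.combine_emb₀ 0 0 y j

@[simp] theorem inr_emb₁ (y : Fin b → ℝ) (j : Fin b) : r.inr y (r.emb₁ j) = y j :=
  (r.combine_emb₁ 0 0 y j).trans (by simp)

theorem combine_sub_combine (c : ℝ) (x x' : Fin a → ℝ) (y y' : Fin b → ℝ) :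
    r.combine c x y - r.combine c x' y' = r.inl (x - x') + r.inr (y - y') :=
  r.combine_ext (fun j => by simp) fun j => by simp

theorem inl_single (j : Fin a) (c : ℝ) : r.inl (Pi.single j c) = Pi.single (r.emb₀ j) c := by
  refine r.combine_ext (fun i => ?_) fun i => ?_
  · simp [Pi.single_apply]
  · rw [inl_emb₁, Pi.single_eq_of_ne (r.emb₀_ne_emb₁ j i).symm]

theorem inr_single (j : Fin b) (c : ℝ) : r.inr (Pi.single j c) = Pi.single (r.emb₁ j) c := by
  refine r.combine_ext (fun i => ?_) fun i => ?_
  · rw [inr_emb₀, Pi.single_eq_of_ne (r.emb₀_ne_emb₁ i j)]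
  · simp [Pi.single_apply]

theorem eq_inl_add_inr (z : Fin n → ℝ) : z = r.inl (z ∘ r.emb₀) + r.inr (z ∘ r.emb₁) :=
  r.combine_ext (fun j => by simp) fun j => by simp

/-- The directions of a product of cells are the sum of the directions of its factors. -/
theorem vectorSpan_prodCell {F : Set (Fin a → ℝ)} {G : Set (Fin b → ℝ)} (hF : F.Nonempty)
    (hG : G.Nonempty) : vectorSpan ℝ (r.prodCell F G) =
      (vectorSpan ℝ F).map r.inl ⊔ (vectorSpan ℝ G).map r.inr := by
  refine le_antisymm ?_ (sup_le ?_ ?_)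
  · rw [vectorSpan_def, Submodule.span_le]
    rintro _ ⟨_, ⟨x, hx, y, hy, rfl⟩, _, ⟨x', hx', y', hy', rfl⟩, rfl⟩
    simp only [vsub_eq_sub]
    rw [combine_sub_combine]
    exact Submodule.add_mem_sup (Submodule.mem_map_of_mem (vsub_mem_vectorSpan ℝ hx hx'))
      (Submodule.mem_map_of_mem (vsub_mem_vectorSpan ℝ hy hy'))
  · obtain ⟨y, hy⟩ := hG
    rw [vectorSpan_def ℝ F, Submodule.map_span_le]
    rintro _ ⟨x, hx, x', hx', rfl⟩
    have := vsub_mem_vectorSpan ℝ (r.combine_mem_prodCell.2 ⟨hx, hy⟩)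
      (r.combine_mem_prodCell.2 ⟨hx', hy⟩)
    rwa [vsub_eq_sub, combine_sub_combine, sub_self, map_zero, add_zero] at this
  · obtain ⟨x, hx⟩ := hF
    rw [vectorSpan_def ℝ G, Submodule.map_span_le]
    rintro _ ⟨y, hy, y', hy', rfl⟩
    have := vsub_mem_vectorSpan ℝ (r.combine_mem_prodCell.2 ⟨hx, hy⟩)
      (r.combine_mem_prodCell.2 ⟨hx, hy'⟩)
    rwa [vsub_eq_sub, combine_sub_combine, sub_self, map_zero, zero_add] at this

end Shuffle

section CellBasis

variable {N : ℕ}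

theorem cellBasis_linearIndependent (F : Set (Fin N → ℝ)) :
    LinearIndependent ℝ (cellBasis F) := by
  have h := (Module.finBasis ℝ (vectorSpan ℝ F)).linearIndependent.map' (vectorSpan ℝ F).subtype
    (Submodule.ker_subtype _)
  exact h

theorem span_cellBasis (F : Set (Fin N → ℝ)) :
    Submodule.span ℝ (Set.range (cellBasis F)) = vectorSpan ℝ F := by
  have : Set.range (cellBasis F) =
      (vectorSpan ℝ F).subtype '' Set.range (Module.finBasis ℝ (vectorSpan ℝ F)) := by
    rw [← Set.range_comp]
    rfl
  rw [this, ← Submodule.map_span, Module.Basis.span_eq, Submodule.map_subtype_top]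

end CellBasis

namespace Shuffle

variable {n a b : ℕ+} (r : Shuffle n a b)

theorem prodBasis_eq (F : Set (Fin a → ℝ)) (G : Set (Fin b → ℝ)) : r.prodBasis F G =
    Fin.append (r.inl ∘ cellBasis F) (r.inr ∘ cellBasis G) := rfl

theorem prodBasis_linearIndependent (F : Set (Fin a → ℝ)) (G : Set (Fin b → ℝ)) :
    LinearIndependent ℝ (r.prodBasis F G) := by
  have h2 := linearIndependent_inl_union_inr' (cellBasis_linearIndependent F)
    (cellBasis_linearIndependent G)
  have h3 := h2.map' (r.inl.coprod r.inr) (LinearMap.ker_eq_bot.2 fun x y h => by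
    rw [LinearMap.coprod_apply, LinearMap.coprod_apply] at h
    refine Prod.ext (funext fun j => ?_) (funext fun j => ?_)
    · simpa using congrFun h (r.emb₀ j)
    · simpa using congrFun h (r.emb₁ j))
  refine (linearIndependent_equiv finSumFinEquiv).1 ?_
  have h4 : r.prodBasis F G ∘ finSumFinEquiv = (r.inl.coprod r.inr) ∘
      Sum.elim (LinearMap.inl ℝ (Fin a → ℝ) (Fin b → ℝ) ∘ cellBasis F)
        (LinearMap.inr ℝ (Fin a → ℝ) (Fin b → ℝ) ∘ cellBasis G) := by
    funext i
    rw [prodBasis_eq]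
    cases i <;> simp
  rw [h4]
  exact h3

theorem span_prodBasis {F : Set (Fin a → ℝ)} {G : Set (Fin b → ℝ)} (hF : F.Nonempty)
    (hG : G.Nonempty) :
    Submodule.span ℝ (Set.range (r.prodBasis F G)) = vectorSpan ℝ (r.prodCell F G) := by
  have h : Set.range (r.prodBasis F G) =
      r.inl '' Set.range (cellBasis F) ∪ r.inr '' Set.range (cellBasis G) := by
    rw [prodBasis_eq, ← Set.range_comp, ← Set.range_comp, ← Set.Sum.elim_range,
      ← (finSumFinEquiv.surjective).range_comp]
    congr 1
    funext i
    cases i <;> simp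
  rw [h, Submodule.span_union, ← Submodule.map_span, ← Submodule.map_span, span_cellBasis,
    span_cellBasis, r.vectorSpan_prodCell hF hG]

theorem finrank_prodCell {F : Set (Fin a → ℝ)} {G : Set (Fin b → ℝ)} (hF : F.Nonempty)
    (hG : G.Nonempty) : Module.finrank ℝ (vectorSpan ℝ (r.prodCell F G)) =
      Module.finrank ℝ (vectorSpan ℝ F) + Module.finrank ℝ (vectorSpan ℝ G) := by
  rw [← r.span_prodBasis hF hG, finrank_span_eq_card (r.prodBasis_linearIndependent F G),
    Fintype.card_fin]

end Shuffle

namespace Permutohedron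

variable {n a b : ℕ+}

theorem single_sub_single_mem (i j : Fin n) :
    Pi.single i 1 - Pi.single j 1 ∈ vectorSpan ℝ (permutohedron n) := by
  by_cases hij : i = j
  · rw [hij, sub_self]
    exact Submodule.zero_mem _
  have h1 := vsub_mem_vectorSpan ℝ
    (subset_convexHull ℝ (vertices n) ⟨Equiv.refl _, rfl⟩)
    (subset_convexHull ℝ (vertices n) ⟨Equiv.swap i j, rfl⟩)
  have h2 : ((i : ℕ) : ℝ) - (j : ℕ) ≠ 0 := fun h => hij (Fin.ext (by
    rw [sub_eq_zero] at h; exact_mod_cast h))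
  have h3 : (fun k : Fin n => (((Equiv.refl (Fin n)) k : ℕ) : ℝ) + 1) -ᵥ
      (fun k : Fin n => (((Equiv.swap i j) k : ℕ) : ℝ) + 1) =
      (((i : ℕ) : ℝ) - (j : ℕ)) • (Pi.single i 1 - Pi.single j 1 : Fin n → ℝ) := by
    funext k
    by_cases hi : k = i
    · subst hi
      simp [hij]
    · by_cases hj : k = j
      · subst hj
        simp [hi]
      · simp [Equiv.swap_apply_of_ne_of_ne hi hj, hi, hj]
  simp only at h1
  rw [h3] at h1
  exact (Submodule.smul_mem_iff _ h2).1 h1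

/-- The permutohedron is full-dimensional in the hyperplane of vectors with the coordinate sum
`1 + ⋯ + n`. -/
theorem mem_vectorSpan_iff (x : Fin n → ℝ) :
    x ∈ vectorSpan ℝ (permutohedron n) ↔ ∑ i, x i = 0 := by
  constructor
  · intro hx
    rw [vectorSpan_def] at hx
    induction hx using Submodule.span_induction with
    | zero => simp
    | add x y _ _ hx hy => simp [Finset.sum_add_distrib, hx, hy]
    | smul c x _ hx => simp [← Finset.mul_sum, hx]
    | mem z hz =>
      obtain ⟨x, hx, y, hy, rfl⟩ := hz
      simp [Finset.sum_sub_distrib, sum_eq_of_mem hx, sum_eq_of_mem hy]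
  · intro hx
    let i₀ : Fin n := ⟨0, n.pos⟩
    have : x = ∑ i, x i • (Pi.single i 1 - Pi.single i₀ 1 : Fin n → ℝ) := by
      simp only [smul_sub, Finset.sum_sub_distrib, ← Finset.sum_smul, hx, zero_smul, sub_zero]
      funext k
      simp [Finset.sum_apply, Pi.single_apply]
    rw [this]
    exact Submodule.sum_mem _ fun i _ => Submodule.smul_mem _ _ (single_sub_single_mem i i₀)

theorem finrank_permutohedron (n : ℕ+) :
    (Module.finrank ℝ (vectorSpan ℝ (permutohedron n)) : ℤ) = n - 1 := by
  let f : (Fin n → ℝ) →ₗ[ℝ] ℝ := ∑ i, LinearMap.proj i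
  have hf : ∀ x, f x = ∑ i, x i := fun x => by simp [f]
  have h1 : vectorSpan ℝ (permutohedron n) = LinearMap.ker f := by
    ext x
    rw [mem_vectorSpan_iff, LinearMap.mem_ker, hf]
  have h2 : Function.Surjective f := fun c => ⟨Pi.single ⟨0, n.pos⟩ c, by simp [hf]⟩
  have h3 := f.finrank_range_add_finrank_ker
  rw [LinearMap.range_eq_top.2 h2, finrank_top, Module.finrank_self, Module.finrank_fin_fun] at h3
  rw [h1]
  omega

theorem isCell_permutohedron (n : ℕ+) {p : ℤ} (hp : p + 1 = n) :
    IsCell (permutohedron n) p (permutohedron n) :=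
  ⟨nonempty n, IsExposed.refl _, by rw [finrank_permutohedron]; omega⟩

theorem isCell_prodCell (r : Shuffle n a b) {F : Set (Fin a → ℝ)} {G : Set (Fin b → ℝ)}
    {p q s : ℤ} (h : p + q = s) (hF : IsCell (permutohedron a) p F)
    (hG : IsCell (permutohedron b) q G) : IsCell (permutohedron n) s (r.prodCell F G) := by
  refine ⟨r.prodCell_nonempty hF.1 hG.1, ?_, ?_⟩
  · obtain ⟨l, rfl⟩ := hF.2.1.exists_eq_maxFace hF.1
    obtain ⟨l', rfl⟩ := hG.2.1.exists_eq_maxFace hG.1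
    obtain ⟨l'', h⟩ := exists_prodCell_eq r l l'
    rw [h]
    exact isExposed_maxFace _ _
  · rw [r.finrank_prodCell hF.1 hG.1, ← h, ← hF.2.2, ← hG.2.2]
    push_cast
    ring

/-- Cells which are contained in a product of permutohedra. -/
theorem exists_prodCell_eq_of_subset (r : Shuffle n a b) {s : ℤ} {H : Set (Fin n → ℝ)}
    (hH : IsCell (permutohedron n) s H)
    (h : H ⊆ r.prodCell (permutohedron a) (permutohedron b)) :
    ∃ (p q : ℤ) (F : Set (Fin a → ℝ)) (G : Set (Fin b → ℝ)), p + q = s ∧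
      IsCell (permutohedron a) p F ∧ IsCell (permutohedron b) q G ∧ H = r.prodCell F G := by
  obtain ⟨l, rfl⟩ := hH.2.1.exists_eq_maxFace hH.1
  have h1 := maxFace_eq_prodCell_of_subset r h
  refine ⟨_, _, _, _, ?_, ⟨nonempty_maxFace _, isExposed_maxFace _ _, rfl⟩,
    ⟨nonempty_maxFace _, isExposed_maxFace _ _, rfl⟩, h1⟩
  rw [← hH.2.2, h1, r.finrank_prodCell (nonempty_maxFace _) (nonempty_maxFace _)]
  push_cast
  rfl

end Permutohedron

namespace OrderedPartition

theorem isCell_cell {n : ℕ+} (c : OrderedPartition n) {p : ℤ} (h : c.deg = p) :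
    IsCell (permutohedron n) p c.cell := by
  induction c generalizing p with
  | top n => exact isCell_permutohedron n (by rw [← h, deg]; ring)
  | cons r c ih =>
    rw [deg] at h
    exact isCell_prodCell r h (isCell_permutohedron _ (by ring)) (ih rfl)

/-- The cells of the permutohedron are the faces which belong to ordered partitions. -/
theorem exists_eq_cell {n : ℕ+} {p : ℤ} {F : Set (Fin n → ℝ)} (hF : IsCell (permutohedron n) p F) :
    ∃ c : OrderedPartition n, c.deg = p ∧ F = c.cell := by
  obtain ⟨l, rfl⟩ := hF.2.1.exists_eq_maxFace hF.1
  obtain ⟨c, hc⟩ := exists_maxFace_eq l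
  exact ⟨c, by rw [← (c.isCell_cell rfl).2.2, ← hF.2.2, hc], hc⟩

end OrderedPartition

section Dimension

variable {N : ℕ} {P F G : Set (Fin N → ℝ)}

theorem dotProduct_eq_zero_of_mem {l v : Fin N → ℝ} (hv : v ∈ vectorSpan ℝ (maxFace P l)) :
    l ⬝ᵥ v = 0 := by
  rw [vectorSpan_def] at hv
  induction hv using Submodule.span_induction with
  | zero => simp
  | add x y _ _ hx hy => rw [dotProduct_add, hx, hy, add_zero]
  | smul c x _ hx => rw [dotProduct_smul, hx, smul_zero]
  | mem z hz =>
    obtain ⟨x, hx, y, hy, rfl⟩ := hz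
    simp only [vsub_eq_sub]
    rw [dotProduct_sub, sub_eq_zero]
    exact le_antisymm (hy.2 x hx.1) (hx.2 y hy.1)

theorem dotProduct_pos {l x y : Fin N → ℝ} (hx : x ∈ maxFace P l) (hy : y ∈ P)
    (hy' : y ∉ maxFace P l) : 0 < l ⬝ᵥ (x - y) := by
  rw [dotProduct_sub, sub_pos]
  refine lt_of_not_ge fun h => hy' ⟨hy, fun z hz => (hx.2 z hz).trans h⟩

/-- A cell does not contain another cell of the same dimension. -/
theorem IsCell.eq_of_subset {p : ℤ} (hF : IsCell P p F) (hG : IsCell P p G) (h : G ⊆ F) :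
    G = F := by
  refine h.antisymm fun y hy => ?_
  obtain ⟨l, rfl⟩ := hG.2.1.exists_eq_maxFace hG.1
  have h1 : vectorSpan ℝ (maxFace P l) = vectorSpan ℝ F := by
    refine Submodule.eq_of_le_of_finrank_eq (vectorSpan_mono ℝ h) ?_
    have := hF.2.2
    have := hG.2.2
    omega
  by_contra hy'
  obtain ⟨x, hx⟩ := hG.1
  have h2 := dotProduct_pos hx (hF.2.1.subset hy) hy'
  have h3 : x - y ∈ vectorSpan ℝ (maxFace P l) := by
    rw [h1]
    exact vsub_mem_vectorSpan ℝ (h hx) hy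
  rw [dotProduct_eq_zero_of_mem h3] at h2
  exact lt_irrefl _ h2

theorem IsCell.finrank_le {p q : ℤ} (hF : IsCell P p F) (hG : IsCell P q G) (h : G ⊆ F) :
    q ≤ p := by
  have := Submodule.finrank_mono (vectorSpan_mono ℝ h)
  rw [← hF.2.2, ← hG.2.2]
  exact_mod_cast this

end Dimension

/-! ### Orientations and the exterior algebra -/

/-- `x` is a positive multiple of `ε y`, where `ε` is a sign. -/
def SignRel {M : Type*} [AddCommGroup M] [Module ℝ M] (ε : ℤˣ) (x y : M) : Prop :=
  ∃ c : ℝ, 0 < c ∧ x = (c * ((ε : ℤ) : ℝ)) • y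

namespace SignRel

variable {M : Type*} [AddCommGroup M] [Module ℝ M] {ε ε' : ℤˣ} {x y z : M}

theorem refl (x : M) : SignRel 1 x x := ⟨1, one_pos, by simp⟩

theorem pos_smul {c : ℝ} (hc : 0 < c) (x : M) : SignRel 1 (c • x) x := ⟨c, hc, by simp⟩

theorem units_smul (ε : ℤˣ) (x : M) : SignRel ε (((ε : ℤ) : ℝ) • x) x := ⟨1, one_pos, by simp⟩

theorem cast_mul_self (ε : ℤˣ) : ((ε : ℤ) : ℝ) * ((ε : ℤ) : ℝ) = 1 := by
  obtain rfl | rfl := Int.units_eq_one_or ε <;> simp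

theorem symm (h : SignRel ε x y) : SignRel ε y x := by
  obtain ⟨c, hc, rfl⟩ := h
  refine ⟨c⁻¹, inv_pos.2 hc, ?_⟩
  rw [smul_smul, mul_mul_mul_comm, cast_mul_self, inv_mul_cancel₀ hc.ne', one_mul, one_smul]

theorem trans (h : SignRel ε x y) (h' : SignRel ε' y z) : SignRel (ε * ε') x z := by
  obtain ⟨c, hc, rfl⟩ := h
  obtain ⟨c', hc', rfl⟩ := h'
  refine ⟨c * c', mul_pos hc hc', ?_⟩
  rw [smul_smul]
  push_cast
  congr 1
  ring

theorem map {M' : Type*} [AddCommGroup M'] [Module ℝ M'] (f : M →ₗ[ℝ] M') (h : SignRel ε x y) :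
    SignRel ε (f x) (f y) := by
  obtain ⟨c, hc, rfl⟩ := h
  exact ⟨c, hc, map_smul _ _ _⟩

theorem mul {A : Type*} [Ring A] [Algebra ℝ A] {x y x' y' : A} (h : SignRel ε x y)
    (h' : SignRel ε' x' y') : SignRel (ε * ε') (x * x') (y * y') := by
  obtain ⟨c, hc, rfl⟩ := h
  obtain ⟨c', hc', rfl⟩ := h'
  refine ⟨c * c', mul_pos hc hc', ?_⟩
  rw [smul_mul_smul_comm]
  push_cast
  congr 1
  ring

theorem mul_left {A : Type*} [Ring A] [Algebra ℝ A] {x y : A} (z : A) (h : SignRel ε x y) :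
    SignRel ε (z * x) (z * y) := by
  simpa using (SignRel.refl z).mul h

theorem mul_right {A : Type*} [Ring A] [Algebra ℝ A] {x y : A} (z : A) (h : SignRel ε x y) :
    SignRel ε (x * z) (y * z) := by
  simpa using h.mul (SignRel.refl z)

/-- The sign is determined by nonzero vectors. -/
theorem unique (h : SignRel ε x y) (h' : SignRel ε' x y) (hy : y ≠ 0) : ε = ε' := by
  obtain ⟨c, hc, rfl⟩ := h
  obtain ⟨c', hc', h⟩ := h'
  have h1 := smul_left_injective ℝ hy h
  beta_reduce at h1
  obtain rfl | rfl := Int.units_eq_one_or ε <;> obtain rfl | rfl := Int.units_eq_one_or ε'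
  · rfl
  · push_cast at h1
    linarith
  · push_cast at h1
    linarith
  · rfl

end SignRel

section Volume

open ExteriorAlgebra

variable {N d : ℕ}

theorem ιMulti_ne_zero {v : Fin d → (Fin N → ℝ)} (hv : LinearIndependent ℝ v) :
    ιMulti ℝ d v ≠ 0 := by
  have hinj : LinearMap.ker (Fintype.linearCombination ℝ v) = ⊥ :=
    LinearMap.ker_eq_bot.2 (linearIndependent_iff_injective_fintypeLinearCombination.1 hv)
  obtain ⟨g, hg⟩ := LinearMap.exists_leftInverse_of_injective _ hinj
  have hgv : ∀ i, g (v i) = Pi.single i 1 := by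
    intro i
    have := LinearMap.congr_fun hg (Pi.single i 1)
    rwa [LinearMap.comp_apply, Fintype.linearCombination_apply_single, one_smul,
      LinearMap.id_apply] at this
  let A : (Fin N → ℝ) [⋀^Fin d]→ₗ[ℝ] ℝ := Matrix.detRowAlternating.compLinearMap g
  intro h
  have h1 := liftAlternating_apply_ιMulti (R := ℝ) (Function.update 0 d A) v
  rw [h, map_zero, Function.update_self] at h1
  have h2 : A v = Matrix.det (1 : Matrix (Fin d) (Fin d) ℝ) := by
    change Matrix.det (fun i => g (v i)) = _
    congr 1
    funext i j
    rw [hgv, Matrix.one_apply, Pi.single_apply]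
    simp [eq_comm]
  rw [h2, Matrix.det_one] at h1
  exact zero_ne_one h1

/-- A change of basis multiplies the volume element by the determinant. -/
theorem ιMulti_eq_det_smul (M : Matrix (Fin d) (Fin d) ℝ) (v : Fin d → (Fin N → ℝ)) :
    ιMulti ℝ d (fun i => ∑ j, M i j • v j) = M.det • ιMulti ℝ d v := by
  have h : (ιMulti ℝ d).compLinearMap (Fintype.linearCombination ℝ v) =
      (LinearMap.toSpanSingleton ℝ _ (ιMulti ℝ d v)).compAlternatingMap
        Matrix.detRowAlternating := by
    refine Module.Basis.ext_alternating (Pi.basisFun ℝ (Fin d)) fun i hi => ?_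
    let σ : Equiv.Perm (Fin d) := Equiv.ofBijective i (Finite.injective_iff_bijective.1 hi)
    have h1 : (fun k => Pi.basisFun ℝ (Fin d) (i k)) =
        (fun k => Pi.basisFun ℝ (Fin d) k) ∘ σ := rfl
    rw [h1, AlternatingMap.map_perm, AlternatingMap.map_perm]
    congr 1
    have h2 : Matrix.detRowAlternating (fun k => Pi.basisFun ℝ (Fin d) k) = (1 : ℝ) := by
      change Matrix.det _ = 1
      rw [← Matrix.det_one (n := Fin d)]
      congr 1
      funext i j
      simp [Matrix.one_apply, Pi.single_apply, eq_comm]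
    rw [LinearMap.compAlternatingMap_apply, h2, AlternatingMap.compLinearMap_apply,
      LinearMap.toSpanSingleton_apply, one_smul]
    congr 1
    funext k
    simp
  exact DFunLike.congr_fun h M

theorem ιMulti_cons (x : Fin N → ℝ) (v : Fin d → (Fin N → ℝ)) :
    ιMulti ℝ (d + 1) (Fin.cons x v : Fin (d + 1) → (Fin N → ℝ)) = ι ℝ x * ιMulti ℝ d v := by
  rw [ιMulti_succ_apply]
  rfl

theorem ιMulti_append {e : ℕ} (v : Fin d → (Fin N → ℝ)) (w : Fin e → (Fin N → ℝ)) :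
    ιMulti ℝ (d + e) (Fin.append v w) = ιMulti ℝ d v * ιMulti ℝ e w := by
  rw [ιMulti_apply, ιMulti_apply, ιMulti_apply, ← List.prod_append, ← List.ofFn_fin_append]
  congr 2
  funext i
  refine Fin.addCases (fun i => ?_) (fun i => ?_) i <;> simp

theorem ι_mul_ιMulti_eq_zero {v : Fin d → (Fin N → ℝ)} {x : Fin N → ℝ}
    (hx : x ∈ Submodule.span ℝ (Set.range v)) : ι ℝ x * ιMulti ℝ d v = 0 := by
  rw [← ιMulti_cons]
  refine AlternatingMap.map_linearDependent _ _ fun h => ?_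
  exact (linearIndependent_finCons.1 h).2 hx

/-- A vector anticommutes with every factor of a product of vectors. -/
theorem ιMulti_mul_ι (v : Fin d → (Fin N → ℝ)) (x : Fin N → ℝ) :
    ιMulti ℝ d v * ι ℝ x = (-1 : ℝ) ^ d • (ι ℝ x * ιMulti ℝ d v) := by
  induction d with
  | zero => simp
  | succ d ih =>
    rw [ιMulti_succ_apply, mul_assoc, ih, mul_smul_comm, ← mul_assoc, ← mul_assoc, pow_succ,
      mul_smul, neg_one_smul, ← neg_mul]
    congr 2
    rw [eq_neg_iff_add_eq_zero]
    exact ι_add_mul_swap _ _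

open Classical in
/-- The sign which compares the orientations of two bases. -/
noncomputable def orientSign {e : ℕ} (v : Fin d → (Fin N → ℝ)) (w : Fin e → (Fin N → ℝ)) : ℤˣ :=
  if SameOrientation v w then 1 else -1

/-- The sign which compares the orientations of two bases of the same space is the sign of the ratio
of their volume elements. -/
theorem orientSign_rel {e : ℕ} {v : Fin d → (Fin N → ℝ)} {w : Fin e → (Fin N → ℝ)}
    (hv : LinearIndependent ℝ v) (hw : LinearIndependent ℝ w)
    (h : Submodule.span ℝ (Set.range v) = Submodule.span ℝ (Set.range w)) :
    SignRel (orientSign v w) (ιMulti ℝ d v) (ιMulti ℝ e w) := by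
  obtain rfl : d = e := by
    rw [← Fintype.card_fin d, ← Fintype.card_fin e, ← finrank_span_eq_card hv, h,
      finrank_span_eq_card hw]
  refine SignRel.symm ?_
  rw [orientSign]
  split_ifs with hvw
  · obtain ⟨_, M, hM, hw'⟩ := hvw
    have : w = fun i => ∑ j, M i j • v j := funext hw'
    rw [this, ιMulti_eq_det_smul]
    exact SignRel.pos_smul hM _
  · have hmem : ∀ i, ∃ c : Fin d → ℝ, ∑ j, c j • v j = w i := fun i => by
      rw [← Submodule.mem_span_range_iff_exists_fun, h]
      exact Submodule.subset_span ⟨i, rfl⟩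
    choose M hM using hmem
    have hw' : w = fun i => ∑ j, M i j • v j := funext fun i => (hM i).symm
    have hdet : ιMulti ℝ d w = (Matrix.of M).det • ιMulti ℝ d v := by
      conv_lhs => rw [hw']
      exact ιMulti_eq_det_smul (Matrix.of M) v
    -- the transition matrix has a determinant which is neither positive nor zero
    have hle : (Matrix.of M).det ≤ 0 := not_lt.1 fun hlt =>
      hvw ⟨rfl, Matrix.of M, hlt, fun i => (hM i).symm⟩
    have hne : (Matrix.of M).det ≠ 0 := fun h0 => by
      rw [h0, zero_smul] at hdet
      exact ιMulti_ne_zero hw hdet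
    refine ⟨-(Matrix.of M).det, neg_pos.2 (lt_of_le_of_ne hle hne), ?_⟩
    rw [hdet]
    simp

end Volume

section CellVolume

open ExteriorAlgebra

variable {N : ℕ}

/-- The product of the vectors of the basis which orients a cell. -/
noncomputable def cellVol (F : Set (Fin N → ℝ)) : ExteriorAlgebra ℝ (Fin N → ℝ) :=
  ιMulti ℝ _ (cellBasis F)

theorem cellVol_ne_zero (F : Set (Fin N → ℝ)) : cellVol F ≠ 0 :=
  ιMulti_ne_zero (cellBasis_linearIndependent F)

theorem ι_mul_cellVol {F : Set (Fin N → ℝ)} {x : Fin N → ℝ} (hx : x ∈ vectorSpan ℝ F) :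
    ι ℝ x * cellVol F = 0 :=
  ι_mul_ιMulti_eq_zero (by rwa [span_cellBasis])

open Classical in
/-- The sign of the incidence number of a cell and one of its facets. -/
noncomputable def incidenceSign (F G : Set (Fin N → ℝ)) : ℤˣ :=
  if ∃ x ∈ G, ∃ y ∈ F \ G, SameOrientation (Fin.cons (x - y) (cellBasis G)) (cellBasis F)
  then 1 else -1

theorem incidence_eq_zero (K : Type u) [Field K] {F G : Set (Fin N → ℝ)} (h : ¬ G ⊆ F) :
    incidence K F G = 0 := if_neg h

theorem incidence_eq (K : Type u) [Field K] {F G : Set (Fin N → ℝ)} (h : G ⊆ F) :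
    incidence K F G = ((incidenceSign F G : ℤ) : K) := by
  rw [incidence, if_pos h, incidenceSign]
  split_ifs <;> simp

variable {P F G : Set (Fin N → ℝ)} {p q : ℤ}

/-- The incidence number may be computed with any two points. -/
theorem incidenceSign_rel (hF : IsCell P p F) (hG : IsCell P q G) (hpq : q + 1 = p) (h : G ⊆ F)
    {x y : Fin N → ℝ} (hx : x ∈ G) (hy : y ∈ F) (hy' : y ∉ G) :
    SignRel (incidenceSign F G) (ι ℝ (x - y) * cellVol G) (cellVol F) := by
  obtain ⟨l, rfl⟩ := hG.2.1.exists_eq_maxFace hG.1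
  have hLI : ∀ {x y : Fin N → ℝ}, x ∈ maxFace P l → y ∈ F → y ∉ maxFace P l →
      LinearIndependent ℝ (Fin.cons (x - y) (cellBasis (maxFace P l)) : Fin (_ + 1) → _) := by
    intro x y hx hy hy'
    refine linearIndependent_finCons.2 ⟨cellBasis_linearIndependent _, fun hmem => ?_⟩
    rw [span_cellBasis] at hmem
    have := dotProduct_pos hx (hF.2.1.subset hy) hy'
    rw [dotProduct_eq_zero_of_mem hmem] at this
    exact lt_irrefl _ this
  have hspan : ∀ {x y : Fin N → ℝ}, x ∈ maxFace P l → y ∈ F → y ∉ maxFace P l →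
      Submodule.span ℝ (Set.range (Fin.cons (x - y) (cellBasis (maxFace P l)) :
        Fin (_ + 1) → _)) = vectorSpan ℝ F := by
    intro x y hx hy hy'
    refine Submodule.eq_of_le_of_finrank_eq ?_ ?_
    · rw [Fin.range_cons, Submodule.span_le, Set.insert_subset_iff]
      refine ⟨vsub_mem_vectorSpan ℝ (h hx) hy, ?_⟩
      rw [← Submodule.span_le, span_cellBasis]
      exact vectorSpan_mono ℝ h
    · rw [finrank_span_eq_card (hLI hx hy hy'), Fintype.card_fin]
      have := hF.2.2
      have := hG.2.2
      omega
  -- for every choice of the points, the vector `x - y` completes a basis of `G` to a basis of `F`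
  have hrel : ∀ {x y : Fin N → ℝ}, x ∈ maxFace P l → y ∈ F → y ∉ maxFace P l →
      SignRel (orientSign (Fin.cons (x - y) (cellBasis (maxFace P l)) : Fin (_ + 1) → _)
        (cellBasis F)) (ι ℝ (x - y) * cellVol (maxFace P l)) (cellVol F) := by
    intro x y hx hy hy'
    rw [cellVol, cellVol, ← ιMulti_cons]
    exact orientSign_rel (hLI hx hy hy') (cellBasis_linearIndependent F)
      ((hspan hx hy hy').trans (span_cellBasis F).symm)
  by_cases hex : ∃ x ∈ maxFace P l, ∃ y ∈ F \ maxFace P l,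
      SameOrientation (Fin.cons (x - y) (cellBasis (maxFace P l))) (cellBasis F)
  · obtain ⟨x', hx', y', hy'', hso⟩ := id hex
    have h1 := hrel hx' hy''.1 hy''.2
    rw [orientSign, if_pos hso] at h1
    rw [incidenceSign, if_pos hex]
    -- the two outward vectors agree up to a positive factor and vectors parallel to the facet
    have hmem : x - y ∈ vectorSpan ℝ F := vsub_mem_vectorSpan ℝ (h hx) hy
    rw [← hspan hx' hy''.1 hy''.2, Fin.range_cons, Submodule.mem_span_insert] at hmem
    obtain ⟨c, g, hg, hxy⟩ := hmem
    rw [span_cellBasis] at hg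
    have hc : 0 < c := by
      have h2 := dotProduct_pos hx (hF.2.1.subset hy) hy'
      have h3 := dotProduct_pos hx' (hF.2.1.subset hy''.1) hy''.2
      rw [hxy, dotProduct_add, dotProduct_smul, dotProduct_eq_zero_of_mem hg, add_zero,
        smul_eq_mul] at h2
      exact (pos_iff_pos_of_mul_pos h2).2 h3
    rw [hxy, map_add, add_mul, ι_mul_cellVol hg, add_zero, map_smul, smul_mul_assoc]
    simpa using (SignRel.pos_smul hc _).trans h1
  · have h1 := hrel hx hy hy'
    rw [orientSign, if_neg fun hso => hex ⟨x, hx, y, ⟨hy, hy'⟩, hso⟩] at h1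
    rw [incidenceSign, if_neg hex]
    exact h1

theorem exists_mem_of_subset (hF : IsCell P p F) (hG : IsCell P q G) (hpq : q + 1 = p)
    (h : G ⊆ F) : ∃ y ∈ F, y ∉ G := by
  by_contra! h'
  have : G = F := h.antisymm h'
  subst this
  have := hF.2.2
  have := hG.2.2
  omega

end CellVolume

namespace Shuffle

open ExteriorAlgebra

variable {n a b : ℕ+} (r : Shuffle n a b)

/-- The map of exterior algebras which is induced by the inclusion of the first factor. -/
noncomputable def extl : ExteriorAlgebra ℝ (Fin a → ℝ) →ₐ[ℝ] ExteriorAlgebra ℝ (Fin n → ℝ) :=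
  ExteriorAlgebra.map r.inl

/-- The map of exterior algebras which is induced by the inclusion of the second factor. -/
noncomputable def extr : ExteriorAlgebra ℝ (Fin b → ℝ) →ₐ[ℝ] ExteriorAlgebra ℝ (Fin n → ℝ) :=
  ExteriorAlgebra.map r.inr

theorem extl_ι (x : Fin a → ℝ) : r.extl (ι ℝ x) = ι ℝ (r.inl x) := map_apply_ι _ _

theorem extr_ι (x : Fin b → ℝ) : r.extr (ι ℝ x) = ι ℝ (r.inr x) := map_apply_ι _ _

theorem ιMulti_prodBasis (F : Set (Fin a → ℝ)) (G : Set (Fin b → ℝ)) :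
    ιMulti ℝ _ (r.prodBasis F G) = r.extl (cellVol F) * r.extr (cellVol G) := by
  rw [prodBasis_eq, ιMulti_append, extl, extr, cellVol, cellVol, map_apply_ιMulti,
    map_apply_ιMulti]

/-- The sign of the product of two cells. -/
noncomputable def cellSign (F : Set (Fin a → ℝ)) (G : Set (Fin b → ℝ)) : ℤˣ :=
  orientSign (r.prodBasis F G) (cellBasis (r.prodCell F G))

/-- The sign of a product of cells compares the product of the volume elements of the factors with
the volume element of the product. -/
theorem cellSign_rel {F : Set (Fin a → ℝ)} {G : Set (Fin b → ℝ)} (hF : F.Nonempty)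
    (hG : G.Nonempty) : SignRel (r.cellSign F G) (r.extl (cellVol F) * r.extr (cellVol G))
      (cellVol (r.prodCell F G)) := by
  rw [← ιMulti_prodBasis]
  exact orientSign_rel (r.prodBasis_linearIndependent F G) (cellBasis_linearIndependent _)
    ((r.span_prodBasis hF hG).trans (span_cellBasis _).symm)

theorem extl_mul_ι {F : Set (Fin a → ℝ)} {p : ℤ}
    (h : (Module.finrank ℝ (vectorSpan ℝ F) : ℤ) = p) (x : Fin n → ℝ) :
    SignRel ((-1) ^ p) (r.extl (cellVol F) * ι ℝ x) (ι ℝ x * r.extl (cellVol F)) := by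
  rw [cellVol, extl, map_apply_ιMulti, ιMulti_mul_ι, ← h, zpow_natCast]
  have := SignRel.units_smul ((-1) ^ (Module.finrank ℝ (vectorSpan ℝ F)))
    (ι ℝ x * ιMulti ℝ _ (r.inl ∘ cellBasis F))
  push_cast at this
  exact this

end Shuffle

/-! ### Products of cells -/

open Permutohedron ExteriorAlgebra

namespace Shuffle

section Assoc

variable {m a b c e f : ℕ+} {t : Shuffle m a e} {s : Shuffle e b c} {w : Shuffle m f c}
  {v : Shuffle f a b} (h : t.oneTimes s = w.timesOne v)

include h

theorem combine_assoc (x : Fin a → ℝ) (y : Fin b → ℝ) (z : Fin c → ℝ) :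
    w.combine (f : ℕ) (v.combine (a : ℕ) x y) z = t.combine (a : ℕ) x (s.combine (b : ℕ) y z) := by
  refine w.combine_ext (fun j => ?_) fun j => ?_
  · induction j using v.emb_cases with
    | h0 j => rw [combine_emb₀, combine_emb₀, emb_assoc_zero_apply h, combine_emb₀]
    | h1 j => rw [combine_emb₀, combine_emb₁, emb_assoc_one_apply h, combine_emb₁, combine_emb₀]
  · rw [combine_emb₁, emb_assoc_two_apply h, combine_emb₁, combine_emb₁, v.card_eq]
    push_cast
    ring

theorem prodCell_assoc (F : Set (Fin a → ℝ)) (G : Set (Fin b → ℝ)) (H : Set (Fin c → ℝ)) :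
    w.prodCell (v.prodCell F G) H = t.prodCell F (s.prodCell G H) := by
  ext u
  constructor
  · rintro ⟨_, ⟨x, hx, y, hy, rfl⟩, z, hz, rfl⟩
    exact ⟨x, hx, _, ⟨y, hy, z, hz, rfl⟩, (combine_assoc h x y z).symm⟩
  · rintro ⟨x, hx, _, ⟨y, hy, z, hz, rfl⟩, rfl⟩
    exact ⟨_, ⟨x, hx, y, hy, rfl⟩, z, hz, combine_assoc h x y z⟩

theorem extl_extl (x : ExteriorAlgebra ℝ (Fin a → ℝ)) : w.extl (v.extl x) = t.extl x := by
  have : w.inl ∘ₗ v.inl = t.inl := LinearMap.ext fun x => by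
    refine w.combine_ext (fun j => ?_) fun j => ?_
    · induction j using v.emb_cases with
      | h0 j => rw [LinearMap.comp_apply, inl_emb₀, inl_emb₀, emb_assoc_zero_apply h, inl_emb₀]
      | h1 j => rw [LinearMap.comp_apply, inl_emb₀, inl_emb₁, emb_assoc_one_apply h, inl_emb₁]
    · rw [LinearMap.comp_apply, inl_emb₁, emb_assoc_two_apply h, inl_emb₁]
  rw [extl, extl, extl, ← AlgHom.comp_apply, map_comp_map, this]

theorem extl_extr (x : ExteriorAlgebra ℝ (Fin b → ℝ)) :
    w.extl (v.extr x) = t.extr (s.extl x) := by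
  have : w.inl ∘ₗ v.inr = t.inr ∘ₗ s.inl := LinearMap.ext fun x => by
    refine w.combine_ext (fun j => ?_) fun j => ?_
    · induction j using v.emb_cases with
      | h0 j => rw [LinearMap.comp_apply, inl_emb₀, inr_emb₀, emb_assoc_zero_apply h,
          LinearMap.comp_apply, inr_emb₀]
      | h1 j => rw [LinearMap.comp_apply, inl_emb₀, inr_emb₁, emb_assoc_one_apply h,
          LinearMap.comp_apply, inr_emb₁, inl_emb₀]
    · rw [LinearMap.comp_apply, inl_emb₁, emb_assoc_two_apply h, LinearMap.comp_apply, inr_emb₁,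
        inl_emb₁]
  rw [extl, extr, extr, extl, ← AlgHom.comp_apply, ← AlgHom.comp_apply, map_comp_map, map_comp_map,
    this]

theorem extr_eq (x : ExteriorAlgebra ℝ (Fin c → ℝ)) : w.extr x = t.extr (s.extr x) := by
  have : w.inr = t.inr ∘ₗ s.inr := LinearMap.ext fun x => by
    refine w.combine_ext (fun j => ?_) fun j => ?_
    · induction j using v.emb_cases with
      | h0 j => rw [inr_emb₀, emb_assoc_zero_apply h,
          LinearMap.comp_apply, inr_emb₀]
      | h1 j => rw [inr_emb₀, emb_assoc_one_apply h, LinearMap.comp_apply, inr_emb₁, inr_emb₀]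
    · rw [inr_emb₁, emb_assoc_two_apply h, LinearMap.comp_apply, inr_emb₁, inr_emb₁]
  rw [extr, extr, extr, ← AlgHom.comp_apply, map_comp_map, this]

theorem extl_mul_extr_assoc (x : ExteriorAlgebra ℝ (Fin a → ℝ)) (y : ExteriorAlgebra ℝ (Fin b → ℝ))
    (z : ExteriorAlgebra ℝ (Fin c → ℝ)) :
    w.extl (v.extl x * v.extr y) * w.extr z = t.extl x * t.extr (s.extl y * s.extr z) := by
  rw [map_mul, map_mul, extl_extl h, extl_extr h, extr_eq h, mul_assoc]

/-- Both sides compare the product of the three volume elements with that of the triple product. -/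
theorem cellSign_assoc {F : Set (Fin a → ℝ)} {G : Set (Fin b → ℝ)} {H : Set (Fin c → ℝ)}
    (hF : F.Nonempty) (hG : G.Nonempty) (hH : H.Nonempty) :
    v.cellSign F G * w.cellSign (v.prodCell F G) H =
      s.cellSign G H * t.cellSign F (s.prodCell G H) := by
  have h1 := ((v.cellSign_rel hF hG).map w.extl.toLinearMap).mul_right (w.extr (cellVol H)) |>.trans
    (w.cellSign_rel (v.prodCell_nonempty hF hG) hH)
  have h2 := ((s.cellSign_rel hG hH).map t.extr.toLinearMap).mul_left (t.extl (cellVol F)) |>.trans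
    (t.cellSign_rel hF (s.prodCell_nonempty hG hH))
  simp only [AlgHom.toLinearMap_apply] at h1 h2
  rw [extl_mul_extr_assoc h, prodCell_assoc h] at h1
  exact h1.unique h2 (cellVol_ne_zero _)

end Assoc

variable {n a b : ℕ+} (r : Shuffle n a b)

/-- The sign in the Leibniz rule when the boundary is taken in the first factor: a vector pointing
out of the face of the first factor also points out of the face of the product. -/
theorem cellSign_mul_incidenceSign_left {F F' : Set (Fin a → ℝ)} {G : Set (Fin b → ℝ)} {p p' q : ℤ}
    (hF : IsCell (permutohedron a) p F) (hF' : IsCell (permutohedron a) p' F')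
    (hG : IsCell (permutohedron b) q G) (hp : p' + 1 = p) (h : F' ⊆ F) :
    incidenceSign F F' * r.cellSign F G =
      r.cellSign F' G * incidenceSign (r.prodCell F G) (r.prodCell F' G) := by
  obtain ⟨x, hx⟩ := hF'.1
  obtain ⟨y, hy, hy'⟩ := exists_mem_of_subset hF hF' hp h
  obtain ⟨z, hz⟩ := hG.1
  have h1 := ((incidenceSign_rel hF hF' hp h hx hy hy').map r.extl.toLinearMap).mul_right
    (r.extr (cellVol G)) |>.trans (r.cellSign_rel hF.1 hG.1)
  have h2 := incidenceSign_rel (isCell_prodCell r rfl hF hG) (isCell_prodCell r rfl hF' hG)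
    (by omega) (r.prodCell_mono h le_rfl) (r.combine_mem_prodCell.2 ⟨hx, hz⟩)
    (r.combine_mem_prodCell.2 ⟨hy, hz⟩) fun h => hy' (r.combine_mem_prodCell.1 h).1
  have h3 := ((r.cellSign_rel hF'.1 hG.1).mul_left (ι ℝ (r.inl (x - y)))).trans (by
    rwa [r.combine_sub_combine, sub_self, map_zero, add_zero] at h2)
  simp only [AlgHom.toLinearMap_apply] at h1
  rw [map_mul, r.extl_ι, mul_assoc] at h1
  exact h1.unique h3 (cellVol_ne_zero _)

/-- The sign in the Leibniz rule when the boundary is taken in the second factor: the outward vector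
has to be moved past the volume element of the first factor. -/
theorem cellSign_mul_incidenceSign_right {F : Set (Fin a → ℝ)} {G G' : Set (Fin b → ℝ)}
    {p q q' : ℤ} (hF : IsCell (permutohedron a) p F) (hG : IsCell (permutohedron b) q G)
    (hG' : IsCell (permutohedron b) q' G') (hq : q' + 1 = q) (h : G' ⊆ G) :
    (-1) ^ p * (incidenceSign G G' * r.cellSign F G) =
      r.cellSign F G' * incidenceSign (r.prodCell F G) (r.prodCell F G') := by
  obtain ⟨x, hx⟩ := hG'.1
  obtain ⟨y, hy, hy'⟩ := exists_mem_of_subset hG hG' hq h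
  obtain ⟨z, hz⟩ := hF.1
  have h1 := ((incidenceSign_rel hG hG' hq h hx hy hy').map r.extr.toLinearMap).mul_left
    (r.extl (cellVol F)) |>.trans (r.cellSign_rel hF.1 hG.1)
  have h2 := incidenceSign_rel (isCell_prodCell r rfl hF hG) (isCell_prodCell r rfl hF hG')
    (by omega) (r.prodCell_mono le_rfl h) (r.combine_mem_prodCell.2 ⟨hz, hx⟩)
    (r.combine_mem_prodCell.2 ⟨hz, hy⟩) fun h => hy' (r.combine_mem_prodCell.1 h).2
  have h3 := ((r.cellSign_rel hF.1 hG'.1).mul_left (ι ℝ (r.inr (x - y)))).trans (by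
    rwa [r.combine_sub_combine, sub_self, map_zero, zero_add] at h2)
  simp only [AlgHom.toLinearMap_apply] at h1
  rw [map_mul, r.extr_ι, ← mul_assoc] at h1
  rw [← mul_assoc] at h3
  have h4 := ((r.extl_mul_ι hF.2.2 (r.inr (x - y))).symm.mul_right (r.extr (cellVol G'))).trans h1
  exact h4.unique h3 (cellVol_ne_zero _)

end Shuffle

/-! ### The cellular chains -/

section Chains

variable {K : Type u} [Field K]

noncomputable instance (n : ℕ+) (p : ℤ) : Fintype (Cell (permutohedron n) p) :=
  haveI : Finite (Cell (permutohedron n) p) := finite_cell (finite_vertices n) p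
  Fintype.ofFinite _

variable (K) in
/-- The product of cellular chains. -/
noncomputable def chainOp {n a b : ℕ+} (r : Shuffle n a b) (p q s : ℤ) :
    (Cell (permutohedron a) p →₀ K) →ₗ[K] (Cell (permutohedron b) q →₀ K) →ₗ[K]
      (Cell (permutohedron n) s →₀ K) :=
  Finsupp.linearCombination K fun F => Finsupp.linearCombination K fun G => r.cellProd K s F G

/-- The product of two cells. -/
def Shuffle.mulCell {n a b : ℕ+} (r : Shuffle n a b) {p q s : ℤ} (h : p + q = s)
    (F : Cell (permutohedron a) p) (G : Cell (permutohedron b) q) : Cell (permutohedron n) s :=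
  ⟨r.prodCell F.1 G.1, isCell_prodCell r h F.2 G.2⟩

theorem chainOp_single {n a b : ℕ+} (r : Shuffle n a b) {p q s : ℤ} (h : p + q = s)
    (F : Cell (permutohedron a) p) (G : Cell (permutohedron b) q) (c c' : K) :
    chainOp K r p q s (Finsupp.single F c) (Finsupp.single G c') =
      Finsupp.single (r.mulCell h F G) (c * c' * ((r.cellSign F.1 G.1 : ℤ) : K)) := by
  have h1 : r.cellProd K s F G =
      Finsupp.single (r.mulCell h F G) ((r.cellSign F.1 G.1 : ℤ) : K) := by
    rw [Shuffle.cellProd, dif_pos (isCell_prodCell r h F.2 G.2), Shuffle.cellSign, orientSign]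
    congr 1
    split_ifs <;> simp
  rw [chainOp, Finsupp.linearCombination_single, LinearMap.smul_apply,
    Finsupp.linearCombination_single, h1, Finsupp.smul_single, Finsupp.smul_single, smul_eq_mul,
    smul_eq_mul, mul_assoc]

theorem permutohedralChains_isPermutad : (permutohedralChains K).IsPermutad := by
  intro m a b c e f t s w v huv i j k ij jk l hij hjk h h' x y z
  have key : ∀ (x : Cell (permutohedron a) i →₀ K) (y : Cell (permutohedron b) j →₀ K)
      (z : Cell (permutohedron c) k →₀ K),
      chainOp K w ij k l (chainOp K v i j ij x y) z =
        chainOp K t i jk l x (chainOp K s j k jk y z) := by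
    intro x y z
    induction x using Finsupp.induction_linear with
    | zero => simp only [map_zero, LinearMap.zero_apply]
    | add x x' hx hx' => simp only [map_add, LinearMap.add_apply, hx, hx']
    | single F c₁ =>
      induction y using Finsupp.induction_linear with
      | zero => simp only [map_zero, LinearMap.zero_apply]
      | add y y' hy hy' => simp only [map_add, LinearMap.add_apply, hy, hy']
      | single G c₂ =>
        induction z using Finsupp.induction_linear with
        | zero => simp only [map_zero]
        | add z z' hz hz' => simp only [map_add, hz, hz']
        | single H c₃ =>
          rw [chainOp_single v hij, chainOp_single w h, chainOp_single s hjk, chainOp_single t h']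
          have h1 : w.mulCell h (v.mulCell hij F G) H = t.mulCell h' F (s.mulCell hjk G H) :=
            Subtype.ext (Shuffle.prodCell_assoc huv F.1 G.1 H.1)
          rw [h1]
          congr 1
          have h2 := congrArg (fun ε : ℤˣ => ((ε : ℤ) : K))
            (Shuffle.cellSign_assoc huv F.2.1 G.2.1 H.2.1)
          simp only [Units.val_mul, Int.cast_mul] at h2
          change c₁ * c₂ * ((v.cellSign F.1 G.1 : ℤ) : K) * c₃ *
            ((w.cellSign (v.prodCell F.1 G.1) H.1 : ℤ) : K) =
            c₁ * (c₂ * c₃ * ((s.cellSign G.1 H.1 : ℤ) : K)) *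
            ((t.cellSign F.1 (s.prodCell G.1 H.1) : ℤ) : K)
          linear_combination (c₁ * c₂ * c₃) * h2
  exact key x y z

theorem cellularBoundary_single {n : ℕ+} (p q : ℤ) (F : Cell (permutohedron n) p) (c : K) :
    cellularBoundary K (permutohedron n) p q (Finsupp.single F c) =
      ∑ G : Cell (permutohedron n) q, Finsupp.single G (c * incidence K F.1 G.1) := by
  rw [cellularBoundary, Finsupp.linearCombination_single, finsum_eq_sum_of_fintype,
    Finset.smul_sum]
  simp only [Finsupp.smul_single, smul_eq_mul]

theorem sign_mul_eq {ε₁ ε₂ ε₃ ε₄ : ℤˣ} (h : ε₁ * ε₂ = ε₃ * ε₄) : ε₁ * ε₃ = ε₂ * ε₄ := by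
  revert ε₁ ε₂ ε₃ ε₄
  decide

theorem cast_neg_one_zpow (p : ℤ) : ((((-1) ^ p : ℤˣ) : ℤ) : K) = (-1) ^ p := by
  rcases Int.even_or_odd p with h | h
  · rw [h.neg_one_zpow, h.neg_one_zpow]
    simp
  · rw [h.neg_one_zpow, h.neg_one_zpow]
    simp

/-- The facets of a product are the products with one factor replaced by a facet. -/
theorem boundary_chainOp_single {n a b : ℕ+} (r : Shuffle n a b) {p q s s' p' q' : ℤ}
    (h : p + q = s) (hs : s' + 1 = s) (hp : p' + 1 = p) (hq : q' + 1 = q) (h₁ : p' + q = s')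
    (h₂ : p + q' = s') (F : Cell (permutohedron a) p) (G : Cell (permutohedron b) q) :
    cellularBoundary K (permutohedron n) s s' (chainOp K r p q s (Finsupp.single F 1)
        (Finsupp.single G 1)) =
      chainOp K r p' q s' (cellularBoundary K (permutohedron a) p p' (Finsupp.single F 1))
          (Finsupp.single G 1) +
        ((-1 : K) ^ p) • chainOp K r p q' s' (Finsupp.single F 1)
          (cellularBoundary K (permutohedron b) q q' (Finsupp.single G 1)) := by
  rw [chainOp_single r h, cellularBoundary_single, cellularBoundary_single,
    cellularBoundary_single, map_sum, map_sum, LinearMap.sum_apply, Finset.smul_sum]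
  -- the two sums on the right are the parts of the boundary indexed by the image of `e`
  let e : Cell (permutohedron a) p' ⊕ Cell (permutohedron b) q' → Cell (permutohedron n) s' :=
    Sum.elim (fun F' => r.mulCell h₁ F' G) fun G' => r.mulCell h₂ F G'
  have he : Function.Injective e := by
    rintro (F' | G') (F'' | G'') h
    · rw [Subtype.ext (r.prodCell_injective F'.2.1 G.2.1 (congrArg Subtype.val h)).1]
    · have h3 := (r.prodCell_injective F'.2.1 G.2.1 (congrArg Subtype.val h)).1
      have h4 := F'.2.2.2
      have h5 := F.2.2.2
      rw [h3] at h4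
      omega
    · have h3 := (r.prodCell_injective F.2.1 G'.2.1 (congrArg Subtype.val h)).1
      have h4 := F''.2.2.2
      have h5 := F.2.2.2
      rw [← h3] at h4
      omega
    · rw [Subtype.ext (r.prodCell_injective F.2.1 G'.2.1 (congrArg Subtype.val h)).2]
  have hsum := Fintype.sum_of_injective e he
    (Sum.elim (fun F' => chainOp K r p' q s' (Finsupp.single F' (1 * incidence K F.1 F'.1))
        (Finsupp.single G 1))
      fun G' => (-1 : K) ^ p • chainOp K r p q' s' (Finsupp.single F 1)
        (Finsupp.single G' (1 * incidence K G.1 G'.1)))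
    (fun H => Finsupp.single H (1 * 1 * ((r.cellSign F.1 G.1 : ℤ) : K) *
      incidence K (r.mulCell h F G).1 H.1)) ?_ ?_
  · rw [← hsum, Fintype.sum_sum_type]
    rfl
  · intro H hH
    rw [incidence_eq_zero, mul_zero, Finsupp.single_zero]
    intro hsub
    obtain ⟨i, j, F', G', hij, hF', hG', hH'⟩ := exists_prodCell_eq_of_subset r H.2
      (hsub.trans (r.prodCell_mono F.2.2.1.subset G.2.2.1.subset))
    rw [hH'] at hsub
    have hsub' := (r.prodCell_subset_iff hF'.1 hG'.1).1 hsub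
    have h3 := F.2.finrank_le hF' hsub'.1
    have h4 := G.2.finrank_le hG' hsub'.2
    -- for reasons of dimension, one of the two factors is unchanged
    rcases h3.eq_or_lt with rfl | h3
    · obtain rfl : j = q' := by omega
      refine hH ⟨Sum.inr ⟨G', hG'⟩, Subtype.ext ?_⟩
      rw [hH', F.2.eq_of_subset hF' hsub'.1]
      rfl
    · obtain rfl : j = q := by omega
      obtain rfl : i = p' := by omega
      refine hH ⟨Sum.inl ⟨F', hF'⟩, Subtype.ext ?_⟩
      rw [hH', G.2.eq_of_subset hG' hsub'.2]
      rfl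
  · rintro (F' | G')
    · simp only [Sum.elim_inl, e]
      rw [chainOp_single r h₁]
      congr 1
      by_cases hsub : F'.1 ⊆ F.1
      · rw [incidence_eq K hsub, incidence_eq K (F := (r.mulCell h F G).1)
          (G := (r.mulCell h₁ F' G).1) (r.prodCell_mono hsub le_rfl)]
        have h3 := congrArg (fun ε : ℤˣ => ((ε : ℤ) : K))
          (sign_mul_eq (r.cellSign_mul_incidenceSign_left F.2 F'.2 G.2 hp hsub))
        simp only [Units.val_mul, Int.cast_mul] at h3
        simp only [one_mul, mul_one]
        exact h3
      · rw [incidence_eq_zero K hsub, incidence_eq_zero]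
        · ring
        · exact fun h => hsub ((r.prodCell_subset_iff F'.2.1 G.2.1).1 h).1
    · simp only [Sum.elim_inr, e]
      rw [chainOp_single r h₂, Finsupp.smul_single]
      congr 1
      by_cases hsub : G'.1 ⊆ G.1
      · rw [incidence_eq K hsub, incidence_eq K (F := (r.mulCell h F G).1)
          (G := (r.mulCell h₂ F G').1) (r.prodCell_mono le_rfl hsub), smul_eq_mul,
          ← cast_neg_one_zpow]
        have h3 := r.cellSign_mul_incidenceSign_right F.2 G.2 G'.2 hq hsub
        rw [← mul_assoc] at h3
        have h4 := congrArg (fun ε : ℤˣ => ((ε : ℤ) : K)) (sign_mul_eq h3)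
        simp only [Units.val_mul, Int.cast_mul] at h4
        simp only [one_mul, mul_one, ← mul_assoc]
        exact h4
      · rw [incidence_eq_zero K hsub, incidence_eq_zero]
        · simp
        · exact fun h => hsub ((r.prodCell_subset_iff F.2.1 G'.2.1).1 h).2

/-- The faces of codimension one of a product of cells are the products of one factor with a face of
codimension one of the other. -/
theorem permutohedralChains_leibniz {n a b : ℕ+} (r : Shuffle n a b) {p q s s' p' q' : ℤ}
    (h : p + q = s) (hs : s' + 1 = s) (hp : p' + 1 = p) (hq : q' + 1 = q) (h₁ : p' + q = s')
    (h₂ : p + q' = s') (x : (permutohedralChains K).X a p) (y : (permutohedralChains K).X b q) :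
    (permutohedralChains K).d hs ((permutohedralChains K).op r h x y) =
      (permutohedralChains K).op r h₁ ((permutohedralChains K).d hp x) y +
        ((-1 : K) ^ p) • (permutohedralChains K).op r h₂ x ((permutohedralChains K).d hq y) := by
  have key : ∀ (x : Cell (permutohedron a) p →₀ K) (y : Cell (permutohedron b) q →₀ K),
      cellularBoundary K (permutohedron n) s s' (chainOp K r p q s x y) =
        chainOp K r p' q s' (cellularBoundary K (permutohedron a) p p' x) y +
        ((-1 : K) ^ p) • chainOp K r p q' s' x (cellularBoundary K (permutohedron b) q q' y) := by
    intro x y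
    induction x using Finsupp.induction_linear with
    | zero => simp only [map_zero, LinearMap.zero_apply, smul_zero, add_zero]
    | add x x' hx hx' =>
      simp only [map_add, LinearMap.add_apply, hx, hx', smul_add]
      abel
    | single F c₁ =>
      induction y using Finsupp.induction_linear with
      | zero => simp only [map_zero, smul_zero, add_zero]
      | add y y' hy hy' =>
        simp only [map_add, hy, hy', smul_add]
        abel
      | single G c₂ =>
        rw [← mul_one c₁, ← mul_one c₂, ← smul_eq_mul, ← smul_eq_mul, ← Finsupp.smul_single,
          ← Finsupp.smul_single]
        simp only [map_smul, LinearMap.smul_apply]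
        rw [boundary_chainOp_single r h hs hp hq h₁ h₂]
        simp only [smul_add]
        rw [smul_comm c₁ ((-1 : K) ^ p), smul_comm c₂ ((-1 : K) ^ p)]
  exact key x y

end Chains

open ExteriorAlgebra

/-! ### The boundary of the permutohedron -/

/-- The exterior algebras of the spaces `ℝⁿ` as a permutad, which does not depend on the degree. -/
noncomputable def exteriorPermutad : PrePermutad ℝ where
  X n _ := ExteriorAlgebra ℝ (Fin n → ℝ)
  op r _ _ _ _ := (LinearMap.mul ℝ _).compl₁₂ r.extl.toLinearMap r.extr.toLinearMap

theorem exteriorPermutad_isPermutad : exteriorPermutad.IsPermutad := by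
  intro m a b c e f t s w v h i j k ij jk l hij hjk h1 h2 x y z
  exact Shuffle.extl_mul_extr_assoc h x y z

/-- The product of the standard basis vectors. -/
noncomputable def standardVol (n : ℕ+) : ExteriorAlgebra ℝ (Fin n → ℝ) :=
  ιMulti ℝ n fun i => Pi.single i 1

namespace Shuffle

theorem first_emb₁ {m n : ℕ+} (h : (m : ℕ) = n + 1) (j : Fin n) :
    ((first m n h).emb₁ j : ℕ) = j + 1 := by
  obtain rfl : m = n + 1 := PNat.eq h
  have h1 : (first (n + 1) n h).emb₁ = Fin.succOrderEmb n := by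
    refine OrderEmbedding.range_inj.1 ?_
    rw [range_emb₁]
    ext i
    have h2 := first_apply h i
    constructor
    · intro hi
      have h3 : (i : ℕ) ≠ 0 := fun h0 => by
        rw [Set.mem_ofPred_eq, h2.2 h0] at hi
        exact absurd hi (by decide)
      have h4 : (i : ℕ) < n + 1 := i.2
      exact ⟨⟨(i : ℕ) - 1, by omega⟩, Fin.ext (Nat.sub_add_cancel (Nat.pos_of_ne_zero h3))⟩
    · rintro ⟨j, rfl⟩
      have h3 : (first (n + 1) n h).1 (Fin.succOrderEmb n j) ≠ 0 := fun h0 =>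
        absurd (h2.1 h0) (Nat.succ_ne_zero _)
      rw [Set.mem_ofPred_eq]
      omega
  rw [h1]
  rfl

theorem first_emb₀ {m n : ℕ+} (h : (m : ℕ) = n + 1) (j : Fin (1 : ℕ+)) :
    ((first m n h).emb₀ j : ℕ) = 0 := (first_apply h _).1 (apply_emb₀ _ _)

variable {n a b : ℕ+} (r : Shuffle n a b)

theorem extl_standardVol : r.extl (standardVol a) =
    (List.ofFn fun i : Fin a => ι ℝ (Pi.single (r.emb₀ i) 1 : Fin n → ℝ)).prod := by
  rw [extl, standardVol, map_apply_ιMulti, ιMulti_apply]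
  simp only [Function.comp_apply, inl_single]

theorem extr_standardVol : r.extr (standardVol b) =
    (List.ofFn fun i : Fin b => ι ℝ (Pi.single (r.emb₁ i) 1 : Fin n → ℝ)).prod := by
  rw [extr, standardVol, map_apply_ιMulti, ιMulti_apply]
  simp only [Function.comp_apply, inr_single]

theorem extl_standardVol_one (r : Shuffle n 1 b) : r.extl (standardVol 1) =
    ι ℝ (Pi.single (r.emb₀ ⟨0, Nat.one_pos⟩) 1 : Fin n → ℝ) := by
  rw [extl_standardVol]
  exact List.prod_singleton

theorem extr_standardVol_one (r : Shuffle n a 1) : r.extr (standardVol 1) =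
    ι ℝ (Pi.single (r.emb₁ ⟨0, Nat.one_pos⟩) 1 : Fin n → ℝ) := by
  rw [extr_standardVol]
  exact List.prod_singleton

end Shuffle

theorem idShuffle_emb₀ (j : Fin (1 : ℕ+)) : idShuffle.emb₀ j = ⟨0, by decide⟩ := by
  have h : ∀ i, idShuffle.1 i = 0 → i = ⟨0, by decide⟩ := by decide
  exact h _ (Shuffle.apply_emb₀ _ _)

theorem idShuffle_emb₁ (j : Fin (1 : ℕ+)) : idShuffle.emb₁ j = ⟨1, by decide⟩ := by
  have h : ∀ i, idShuffle.1 i = 1 → i = ⟨1, by decide⟩ := by decide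
  exact h _ (Shuffle.apply_emb₁ _ _)

theorem swapShuffle_emb₀ (j : Fin (1 : ℕ+)) : swapShuffle.emb₀ j = ⟨1, by decide⟩ := by
  have h : ∀ i, swapShuffle.1 i = 0 → i = ⟨1, by decide⟩ := by decide
  exact h _ (Shuffle.apply_emb₀ _ _)

theorem swapShuffle_emb₁ (j : Fin (1 : ℕ+)) : swapShuffle.emb₁ j = ⟨0, by decide⟩ := by
  have h : ∀ i, swapShuffle.1 i = 1 → i = ⟨0, by decide⟩ := by decide
  exact h _ (Shuffle.apply_emb₁ _ _)

theorem isPowerFamily_standardVol :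
    IsPowerFamily exteriorPermutad (-1) 0 fun n _ => standardVol n where
  rec_eq {m n} hm {p q s} h hp hq := by
    change (Shuffle.first m n hm).extl (standardVol 1) * (Shuffle.first m n hm).extr
      (standardVol n) = standardVol m
    rw [Shuffle.extl_standardVol_one, Shuffle.extr_standardVol, standardVol, ιMulti_apply]
    obtain rfl : m = n + 1 := PNat.eq hm
    refine Eq.trans ?_ (congrArg List.prod (List.ofFn_succ (n := n)
      (f := fun i => ι ℝ (Pi.single i 1 : Fin (n + 1 : ℕ+) → ℝ)))).symm
    have h0 : (Shuffle.first (n + 1) n hm).emb₀ ⟨0, Nat.one_pos⟩ = (0 : Fin ((n : ℕ) + 1)) :=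
      Fin.ext (Shuffle.first_emb₀ hm _)
    have h1 : (fun i => ι ℝ (Pi.single ((Shuffle.first (n + 1) n hm).emb₁ i) 1 :
        Fin (n + 1 : ℕ+) → ℝ)) = fun i : Fin n => ι ℝ (Pi.single (i.succ : Fin ((n : ℕ) + 1)) 1) :=
      funext fun i => congrArg (fun i => ι ℝ (Pi.single i 1 : Fin (n + 1 : ℕ+) → ℝ))
        (Fin.ext (Shuffle.first_emb₁ hm _))
    rw [List.prod_cons, h0, h1]
    rfl
  swap_eq h hp hq := by
    change swapShuffle.extl (standardVol 1) * swapShuffle.extr (standardVol 1) =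
      (-1 : ℝ) • (idShuffle.extl (standardVol 1) * idShuffle.extr (standardVol 1))
    rw [Shuffle.extl_standardVol_one, Shuffle.extr_standardVol_one, Shuffle.extl_standardVol_one,
      Shuffle.extr_standardVol_one, idShuffle_emb₀, idShuffle_emb₁, swapShuffle_emb₀,
      swapShuffle_emb₁, neg_one_smul, eq_neg_iff_add_eq_zero]
    exact ι_add_mul_swap _ _

/-- The sign of a shuffle is `(-1)` to the number of inversions. -/
theorem Shuffle.extl_mul_extr_standardVol {n a b : ℕ+} (r : Shuffle n a b) :
    r.extl (standardVol a) * r.extr (standardVol b) = (-1 : ℝ) ^ r.inv • standardVol n :=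
  isPowerFamily_standardVol.op_eq exteriorPermutad_isPermutad r (zero_add (0 : ℤ)) (mul_zero _).symm
    (mul_zero _).symm

theorem standardVol_ne_zero (n : ℕ+) : standardVol n ≠ 0 :=
  ιMulti_ne_zero (Pi.linearIndependent_single_one (Fin n) ℝ)

namespace Permutohedron

/-- The sign which compares the chosen orientation of the permutohedron with the one for which the
vector `(1, …, 1)` followed by an oriented basis is an oriented basis of `ℝⁿ`. -/
noncomputable def topSign (n : ℕ+) : ℤˣ :=
  orientSign (Fin.cons 1 (cellBasis (permutohedron n)) : Fin (_ + 1) → (Fin n → ℝ))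
    fun i : Fin n => (Pi.single i 1 : Fin n → ℝ)

theorem topSign_rel (n : ℕ+) :
    SignRel (topSign n) (ι ℝ 1 * cellVol (permutohedron n)) (standardVol n) := by
  have hLI : LinearIndependent ℝ
      (Fin.cons 1 (cellBasis (permutohedron n)) : Fin (_ + 1) → (Fin n → ℝ)) := by
    refine linearIndependent_finCons.2 ⟨cellBasis_linearIndependent _, ?_⟩
    rw [span_cellBasis, mem_vectorSpan_iff]
    simp
  rw [cellVol, ← ιMulti_cons]
  refine orientSign_rel hLI (Pi.linearIndependent_single_one (Fin n) ℝ) ?_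
  have h1 := finrank_permutohedron n
  rw [hLI.span_eq_top_of_card_eq_finrank (by simp; omega),
    (Pi.linearIndependent_single_one (Fin n) ℝ).span_eq_top_of_card_eq_finrank (by simp)]

variable {n a b : ℕ+} (r : Shuffle n a b)

/-- The facet which belongs to a shuffle maximizes the sum of the coordinates in the second
fibre. -/
theorem prodCell_eq_maxFace : r.prodCell (permutohedron a) (permutohedron b) =
    maxFace (permutohedron n) fun i => if r.1 i = 0 then 0 else 1 := by
  have h0 : (fun i => if r.1 i = 0 then (0 : ℝ) else 1) ∘ r.emb₀ = 0 := funext fun j => by simp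
  have h1 : (fun i => if r.1 i = 0 then (0 : ℝ) else 1) ∘ r.emb₁ =
      fun i => (0 : Fin b → ℝ) i + 1 := funext fun j => by simp
  rw [maxFace_eq_prodCell r (fun i j => by simp), h0, h1, maxFace_add_const, maxFace_zero,
    maxFace_zero]

theorem sum_emb₁_pos {x y : Fin n → ℝ} (hx : x ∈ r.prodCell (permutohedron a) (permutohedron b))
    (hy : y ∈ permutohedron n) (hy' : y ∉ r.prodCell (permutohedron a) (permutohedron b)) :
    0 < ∑ j, (x - y) (r.emb₁ j) := by
  rw [prodCell_eq_maxFace] at hx hy'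
  have h := dotProduct_pos hx hy hy'
  rw [dotProduct, r.sum_eq] at h
  simpa using h

/-- An outward vector of the facet which belongs to a shuffle is, up to a positive factor, multiples
of `(1, …, 1)` and vectors parallel to the facet, the indicator vector of the second fibre. -/
theorem ι_one_mul_ι_mul_cellVol {x y : Fin n → ℝ}
    (hx : x ∈ r.prodCell (permutohedron a) (permutohedron b))
    (hy : y ∈ permutohedron n) (hy' : y ∉ r.prodCell (permutohedron a) (permutohedron b)) :
    SignRel 1 (ι ℝ 1 * (ι ℝ (x - y) * cellVol (r.prodCell (permutohedron a) (permutohedron b))))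
      (ι ℝ (r.inl 1) * (ι ℝ (r.inr 1) *
        cellVol (r.prodCell (permutohedron a) (permutohedron b)))) := by
  have ha : (0 : ℝ) < (a : ℕ) := Nat.cast_pos.2 a.pos
  have hb : (0 : ℝ) < (b : ℕ) := Nat.cast_pos.2 b.pos
  set S := ∑ j, (x - y) (r.emb₁ j) with hS
  have hpos : 0 < S := sum_emb₁_pos r hx hy hy'
  have hsum : ∑ j, (x - y) (r.emb₀ j) = -S := by
    have h := (mem_vectorSpan_iff (x - y)).1 (vsub_mem_vectorSpan ℝ (prodCell_subset r hx) hy)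
    rw [r.sum_eq] at h
    linarith
  -- the coordinates in each fibre are replaced by their mean value
  have hmem : x - y - (-(S / (a : ℕ)) • r.inl 1 + (S / (b : ℕ)) • r.inr 1) ∈
      vectorSpan ℝ (r.prodCell (permutohedron a) (permutohedron b)) := by
    have h1 : x - y - (-(S / (a : ℕ)) • r.inl 1 + (S / (b : ℕ)) • r.inr 1) =
        r.inl ((x - y) ∘ r.emb₀ + (S / (a : ℕ)) • 1) +
          r.inr ((x - y) ∘ r.emb₁ - (S / (b : ℕ)) • 1) := by
      conv_lhs => rw [r.eq_inl_add_inr (x - y)]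
      simp only [map_add, map_sub, map_smul]
      module
    rw [h1, r.vectorSpan_prodCell (nonempty a) (nonempty b)]
    refine Submodule.add_mem_sup (Submodule.mem_map_of_mem ?_) (Submodule.mem_map_of_mem ?_)
    · rw [mem_vectorSpan_iff]
      simp only [Pi.add_apply, Function.comp_apply, Pi.smul_apply, Pi.one_apply, smul_eq_mul,
        mul_one, Finset.sum_add_distrib, hsum, Finset.sum_const, Finset.card_univ,
        Fintype.card_fin, nsmul_eq_mul]
      field_simp
      ring
    · rw [mem_vectorSpan_iff]
      simp only [Pi.sub_apply, Function.comp_apply, Pi.smul_apply, Pi.one_apply, smul_eq_mul,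
        mul_one, Finset.sum_sub_distrib, Finset.sum_const, Finset.card_univ,
        Fintype.card_fin, nsmul_eq_mul]
      simp only [Pi.sub_apply, Finset.sum_sub_distrib] at hS
      rw [← hS]
      field_simp
      ring
  have hι := ι_mul_cellVol hmem
  rw [map_sub, sub_mul, sub_eq_zero] at hι
  have hone : (1 : Fin n → ℝ) = r.inl 1 + r.inr 1 := r.eq_inl_add_inr 1
  have hswap : ι ℝ (r.inr 1) * ι ℝ (r.inl 1) = -(ι ℝ (r.inl 1) * ι ℝ (r.inr 1)) :=
    eq_neg_of_add_eq_zero_left (ι_add_mul_swap _ _)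
  refine ⟨S / (a : ℕ) + S / (b : ℕ), by positivity, ?_⟩
  rw [hι, hone, ← mul_assoc, ← mul_assoc]
  simp only [map_add, map_smul, mul_add, add_mul, mul_smul_comm, smul_mul_assoc, ι_sq_zero, hswap]
  simp only [zero_mul, zero_add, add_zero, Units.val_one, Int.cast_one, mul_one]
  simp only [neg_mul]
  module

/-- The incidence number of the permutohedron and one of its facets. The sign `(-1) ^ (a - 1)` comes
from moving the outward vector past the volume element of the first factor. -/
theorem incidenceSign_prodCell :
    r.cellSign (permutohedron a) (permutohedron b) *
        incidenceSign (permutohedron n) (r.prodCell (permutohedron a) (permutohedron b)) *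
      topSign n = (-1) ^ ((a : ℤ) - 1) * (topSign a * topSign b) * (-1) ^ r.inv := by
  have hn := r.card_eq
  have hPa := isCell_permutohedron a (p := (a : ℤ) - 1) (by ring)
  have hPb := isCell_permutohedron b (p := (b : ℤ) - 1) (by ring)
  have hPn := isCell_permutohedron n (p := (n : ℤ) - 1) (by ring)
  have hH := isCell_prodCell r (s := (n : ℤ) - 2) (by omega) hPa hPb
  have hsub := prodCell_subset r
  obtain ⟨x, hx⟩ := hH.1
  obtain ⟨y, hy, hy'⟩ := exists_mem_of_subset hPn hH (by ring) hsub
  have h1 := (((r.cellSign_rel hPa.1 hPb.1).mul_left (ι ℝ (x - y))).trans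
    (incidenceSign_rel hPn hH (by ring) hsub hx hy hy')).mul_left (ι ℝ 1) |>.trans (topSign_rel n)
  have h2 := (((r.cellSign_rel hPa.1 hPb.1).mul_left (ι ℝ (x - y))).mul_left (ι ℝ 1)).trans
    (ι_one_mul_ι_mul_cellVol r hx hy hy') |>.trans
    (((r.cellSign_rel hPa.1 hPb.1).symm.mul_left (ι ℝ (r.inr 1))).mul_left (ι ℝ (r.inl 1)))
  have h3 := ((r.extl_mul_ι hPa.2.2 (r.inr 1)).symm.mul_right (r.extr (cellVol (permutohedron b)))
    |>.mul_left (ι ℝ (r.inl 1)))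
  have h4 := ((topSign_rel a).map r.extl.toLinearMap).mul ((topSign_rel b).map r.extr.toLinearMap)
  simp only [AlgHom.toLinearMap_apply] at h4
  rw [map_mul, map_mul, r.extl_ι, r.extr_ι, r.extl_mul_extr_standardVol] at h4
  have h5 : SignRel ((-1) ^ r.inv) ((-1 : ℝ) ^ r.inv • standardVol n) (standardVol n) := by
    have := SignRel.units_smul ((-1) ^ r.inv) (standardVol n)
    push_cast at this
    exact this
  simp only [mul_assoc] at h1 h2 h3 h4
  -- `ι 1 * (ι (x - y) * (extl (cellVol P_a) * extr (cellVol P_b)))` is compared with the standard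
  -- volume element in two ways: through the top cell by `h1`, and through the two factors by `h2`
  -- to `h5`
  have h6 := h1.unique (h2.trans (h3.trans (h4.trans h5))) (standardVol_ne_zero n)
  rw [← mul_assoc] at h6
  rw [h6]
  generalize r.cellSign (permutohedron a) (permutohedron b) = ε
  rw [one_mul, Int.units_mul_self, one_mul]
  simp only [mul_assoc]

end Permutohedron

section Top

open Permutohedron

variable {K : Type u} [Field K]

/-- The facets of the permutohedron are the products which belong to the surjections onto two
elements. -/
theorem exists_surj₂_prodCell {n : ℕ+} {q : ℤ} (hq : q + 2 = n) {F : Set (Fin n → ℝ)}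
    (hF : IsCell (permutohedron n) q F) : ∃ r : Surj₂ n,
      F = r.toShuffle.prodCell (permutohedron (r.fibre 0)) (permutohedron (r.fibre 1)) := by
  obtain ⟨c, hc, rfl⟩ := OrderedPartition.exists_eq_cell hF
  cases c with
  | top n =>
    rw [OrderedPartition.deg] at hc
    omega
  | @cons n a b r c =>
    cases c with
    | top b =>
      obtain ⟨f, h0, h1⟩ := r
      have hf : Function.Surjective f := by
        intro i
        have h : 0 < (Finset.univ.filter fun j => f j = i).card := by
          obtain rfl | rfl : i = 0 ∨ i = 1 := by omega
          · rw [h0]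
            exact a.pos
          · rw [h1]
            exact b.pos
        obtain ⟨j, hj⟩ := Finset.card_pos.1 h
        exact ⟨j, (Finset.mem_filter.1 hj).2⟩
      obtain rfl : Surj₂.fibre ⟨f, hf⟩ 0 = a := PNat.eq h0
      obtain rfl : Surj₂.fibre ⟨f, hf⟩ 1 = b := PNat.eq h1
      exact ⟨⟨f, hf⟩, rfl⟩
    | cons r' c' =>
      have h1 := (OrderedPartition.cons r (.cons r' c')).deg_add_len
      have h2 := c'.len_pos
      simp only [OrderedPartition.len] at h1
      omega

/-- Different surjections onto two elements have different facets. -/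
theorem prodCell_surj₂_injective {n : ℕ+} {r r' : Surj₂ n}
    (h : r.toShuffle.prodCell (permutohedron (r.fibre 0)) (permutohedron (r.fibre 1)) =
      r'.toShuffle.prodCell (permutohedron (r'.fibre 0)) (permutohedron (r'.fibre 1))) :
    r = r' := by
  have h1 : OrderedPartition.cons r.toShuffle (.top _) = .cons r'.toShuffle (.top _) :=
    OrderedPartition.cell_injective h
  have h2 := congrArg OrderedPartition.blocks h1
  simp only [OrderedPartition.blocks, List.cons.injEq] at h2
  refine Subtype.ext (funext fun i => ?_)
  have h3 := r.toShuffle.mem_fib₀ i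
  have h4 := r'.toShuffle.mem_fib₀ i
  rw [h2.1, h4] at h3
  have h5 : r'.1 i = 0 ↔ r.1 i = 0 := h3
  omega

/-- The permutohedron as a cell. -/
def topCell (n : ℕ+) {p : ℤ} (h : p + 1 = n) : Cell (permutohedron n) p :=
  ⟨permutohedron n, isCell_permutohedron n h⟩

variable (K) in
/-- The permutohedron as a chain, with the orientation which the vector `(1, …, 1)` induces. The
chain is zero in the wrong degrees. -/
noncomputable def topChain (n : ℕ+) (p : ℤ) : Cell (permutohedron n) p →₀ K :=
  if h : p + 1 = n then Finsupp.single (topCell n h) ((topSign n : ℤ) : K) else 0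

theorem topChain_eq {n : ℕ+} {p : ℤ} (h : p + 1 = n) :
    topChain K n p = Finsupp.single (topCell n h) ((topSign n : ℤ) : K) := dif_pos h

theorem topChain_eq_zero {n : ℕ+} {p : ℤ} (h : p + 1 ≠ n) : topChain K n p = 0 := dif_neg h

theorem cast_sign_mul_self (ε : ℤˣ) : ((ε : ℤ) : K) * ((ε : ℤ) : K) = 1 := by
  obtain rfl | rfl := Int.units_eq_one_or ε <;> simp

/-- The boundary of the top cell, normalized by `topSign`, is the same signed sum over the
surjections onto two elements as the derivation of a generator in the dual bar construction. -/
theorem boundary_topChain {n : ℕ+} {p q : ℤ} (hq : q + 1 = p) (hp : p + 1 = n) :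
    cellularBoundary K (permutohedron n) p q (topChain K n p) =
      ∑ r : Surj₂ n, (SetWord.par K (r.fibre 0) * (-1) ^ r.toShuffle.inv) •
        chainOp K r.toShuffle ((r.fibre 0 : ℤ) - 1) (q - (r.fibre 0 - 1)) q
          (topChain K _ _) (topChain K _ _) := by
  have hcard : ∀ r : Surj₂ n, (n : ℤ) = r.fibre 0 + r.fibre 1 := fun r => by
    exact_mod_cast r.toShuffle.card_eq
  have h0 : ∀ r : Surj₂ n, (r.fibre 0 : ℤ) - 1 + 1 = r.fibre 0 := fun r => by ring
  have h1 : ∀ r : Surj₂ n, q - ((r.fibre 0 : ℤ) - 1) + 1 = r.fibre 1 := fun r => by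
    have := hcard r
    omega
  have hs : ∀ r : Surj₂ n, (r.fibre 0 : ℤ) - 1 + (q - ((r.fibre 0 : ℤ) - 1)) = q := fun r => by
    ring
  rw [topChain_eq hp, cellularBoundary_single]
  -- the facets are indexed by the surjections, and it remains to compare the coefficients
  refine (Fintype.sum_of_injective
    (fun r : Surj₂ n => r.toShuffle.mulCell (hs r) (topCell _ (h0 r)) (topCell _ (h1 r)))
    (fun r r' h => prodCell_surj₂_injective (congrArg Subtype.val h)) _ _ ?_ ?_).symm
  · intro H hH
    obtain ⟨r, hr⟩ := exists_surj₂_prodCell (by omega) H.2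
    exact absurd ⟨r, Subtype.ext hr.symm⟩ hH
  · intro r
    rw [topChain_eq (h0 r), topChain_eq (h1 r), chainOp_single r.toShuffle (hs r),
      Finsupp.smul_single, smul_eq_mul]
    congr 1
    have h2 : incidence K (topCell n hp).1 (r.toShuffle.mulCell (hs r) (topCell _ (h0 r))
        (topCell _ (h1 r))).1 = ((incidenceSign (permutohedron n)
          (r.toShuffle.prodCell (permutohedron (r.fibre 0))
            (permutohedron (r.fibre 1))) : ℤ) : K) :=
      incidence_eq K (prodCell_subset r.toShuffle)
    have h3 := congrArg (fun ε : ℤˣ => ((ε : ℤ) : K)) (incidenceSign_prodCell r.toShuffle)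
    have h4 := cast_sign_mul_self (K := K)
      (r.toShuffle.cellSign (permutohedron (r.fibre 0)) (permutohedron (r.fibre 1)))
    have h5 : ((((-1) ^ ((r.fibre 0 : ℤ) - 1) : ℤˣ) : ℤ) : K) = SetWord.par K (r.fibre 0) := by
      rw [cast_neg_one_zpow, SetWord.par, zpow_sub₀ (by simp), zpow_natCast, pow_succ]
      simp [div_neg]
    simp only [Units.val_mul, Int.cast_mul, h5] at h3
    have h6 : ((((-1) ^ r.toShuffle.inv : ℤˣ) : ℤ) : K) = (-1) ^ r.toShuffle.inv := by
      push_cast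
      rfl
    rw [h6] at h3
    rw [h2]
    change SetWord.par K (r.fibre 0) * (-1) ^ r.toShuffle.inv *
      (((topSign (r.fibre 0) : ℤ) : K) * ((topSign (r.fibre 1) : ℤ) : K) *
        ((r.toShuffle.cellSign (permutohedron (r.fibre 0)) (permutohedron (r.fibre 1)) : ℤ) : K)) =
      ((topSign n : ℤ) : K) * _
    generalize ((r.toShuffle.cellSign (permutohedron (r.fibre 0))
      (permutohedron (r.fibre 1)) : ℤ) : K) = ε at h3 h4 ⊢
    linear_combination (-ε) * h3 + (((topSign n : ℤ) : K) * ((incidenceSign (permutohedron n)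
          (r.toShuffle.prodCell (permutohedron (r.fibre 0))
            (permutohedron (r.fibre 1))) : ℤ) : K)) * h4

end Top

/-! ### The free permutad and the cellular chains -/

namespace GeneratorBasis

open Permutohedron

variable {K : Type u} [Field K] {B : Coll K} (G : GeneratorBasis B)

/-- The morphism from the free permutad to the cellular chains which takes the generator of arity
`n` to the permutohedron in `ℝⁿ`. -/
noncomputable def toChains :
    PrePermutad.Hom (freePermutad B) (permutohedralChains K).toPrePermutad :=
  FreePermutad.lift _ permutohedralChains_isPermutad fun n p =>
    (LinearMap.toSpanSingleton K (Cell (permutohedron n) p →₀ K) (topChain K n p)) ∘ₗ G.χ n p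

/-- The cellular chain of an element of the free permutad. -/
noncomputable def chain (n : ℕ+) (p : ℤ) :
    (freePermutad B).X n p →ₗ[K] (Cell (permutohedron n) p →₀ K) :=
  G.toChains.map n p

theorem chain_ι {n : ℕ+} {p : ℤ} (b : B.X n p) :
    G.chain n p (FreePermutad.ι B n p b) = G.χ n p b • topChain K n p := rfl

theorem chain_gen {n : ℕ+} {p : ℤ} : G.chain n p (G.gen n p) = topChain K n p := by
  by_cases h : p + 1 = n
  · rw [gen, chain_ι, G.χ_β h, one_smul]
  · rw [G.gen_eq_zero h, map_zero, topChain_eq_zero h]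

theorem chain_op {n a b : ℕ+} (r : Shuffle n a b) {p q s : ℤ} (h : p + q = s)
    (x : (freePermutad B).X a p) (y : (freePermutad B).X b q) :
    G.chain n s ((freePermutad B).op r h x y) = chainOp K r p q s (G.chain a p x) (G.chain b q y) :=
  G.toChains.map_op r h x y

/-- A monomial goes to a cell, up to sign. -/
theorem exists_chain_monomial {n : ℕ+} (c : OrderedPartition n) {p : ℤ} (h : c.deg = p) :
    ∃ ε : ℤˣ, G.chain n p (G.monomial c p) =
      Finsupp.single ⟨c.cell, c.isCell_cell h⟩ ((ε : ℤ) : K) := by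
  induction c generalizing p with
  | top n =>
    rw [OrderedPartition.deg] at h
    have h' : p + 1 = n := by omega
    refine ⟨topSign n, ?_⟩
    rw [monomial, chain_gen, topChain_eq h']
    rfl
  | @cons n a b r c ih =>
    rw [OrderedPartition.deg] at h
    obtain ⟨ε, hε⟩ := ih (p := p - (a - 1)) (by omega)
    refine ⟨topSign a * ε * r.cellSign (permutohedron a) c.cell, ?_⟩
    rw [monomial, chain_op, chain_gen, topChain_eq (by ring), hε, chainOp_single r (by ring)]
    push_cast
    rfl

/-- The monomials go to the cells of the ordered partitions, up to sign, and these are a basis. -/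
theorem toChains_isIso : G.toChains.IsIso := by
  intro n p
  constructor
  · refine G.injective_of_linearIndependent (G.chain n p) ?_
    choose ε hε using fun c : {c : OrderedPartition n // c.deg = p} =>
      G.exists_chain_monomial c.1 c.2
    have h1 : LinearIndependent K fun c : {c : OrderedPartition n // c.deg = p} =>
        (Finsupp.single ⟨c.1.cell, c.1.isCell_cell c.2⟩ (1 : K) : Cell (permutohedron n) p →₀ K) :=
      (Finsupp.linearIndependent_single_one K (Cell (permutohedron n) p)).comp
        (fun c : {c : OrderedPartition n // c.deg = p} => ⟨c.1.cell, c.1.isCell_cell c.2⟩)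
        fun c c' h => Subtype.ext (OrderedPartition.cell_injective (congrArg Subtype.val h))
    have h2 := h1.units_smul fun c => Units.map (Int.castRingHom K).toMonoidHom (ε c)
    have h3 : (fun c : {c : OrderedPartition n // c.deg = p} => G.chain n p (G.monomial c.1 p)) =
        (fun c => Units.map (Int.castRingHom K).toMonoidHom (ε c)) • fun c =>
          (Finsupp.single ⟨c.1.cell, c.1.isCell_cell c.2⟩ (1 : K) :
            Cell (permutohedron n) p →₀ K) :=
      funext fun c => (hε c).trans (by simp [Units.smul_def])
    rw [h3]
    exact h2
  · have key : ∀ y : Cell (permutohedron n) p →₀ K, ∃ x, G.chain n p x = y := by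
      intro y
      induction y using Finsupp.induction_linear with
      | zero => exact ⟨0, map_zero _⟩
      | add y y' hy hy' =>
        obtain ⟨x, rfl⟩ := hy
        obtain ⟨x', rfl⟩ := hy'
        exact ⟨x + x', map_add _ _ _⟩
      | single F k =>
        obtain ⟨c, hc, hF⟩ := OrderedPartition.exists_eq_cell F.2
        obtain ⟨ε, hε⟩ := G.exists_chain_monomial c hc
        refine ⟨(k * ((ε : ℤ) : K)) • G.monomial c p, ?_⟩
        have hF' : (⟨c.cell, c.isCell_cell hc⟩ : Cell (permutohedron n) p) = F :=
          Subtype.ext hF.symm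
        rw [map_smul, hε, hF', Finsupp.smul_single, smul_eq_mul, mul_assoc, cast_sign_mul_self,
          mul_one]
    exact key

theorem boundary_chain_gen {n : ℕ+} {p q : ℤ} (h : q + 1 = p) :
    cellularBoundary K (permutohedron n) p q (topChain K n p) = G.chain n q (G.dGen n q) := by
  by_cases hp : p + 1 = n
  · rw [boundary_topChain h hp, dGen, map_sum]
    refine Finset.sum_congr rfl fun r _ => ?_
    rw [map_smul, chain_op, chain_gen, chain_gen]
  · rw [topChain_eq_zero hp, G.dGen_eq_zero (by omega), map_zero, map_zero]

variable {σ : ∀ (n : ℕ+) {p q : ℤ}, q + 1 = p → B.X n p →ₗ[K] (freePermutad B).X n q}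
  (hσ : ∀ (n : ℕ+) {p q : ℤ} (h : q + 1 = p), σ n h (G.β n p) = G.dGen n q)

include hσ

/-- Both sides are derivations along `chain`, so that it is enough to compare them on generators. -/
theorem chain_deriv {n : ℕ+} {p q : ℤ} (h : q + 1 = p) (x : (freePermutad B).X n p) :
    G.chain n q (FreePermutad.deriv σ h x) =
      cellularBoundary K (permutohedron n) p q (G.chain n p x) := by
  induction n, p, x using FreePermutad.induction generalizing q with
  | hι n p b =>
    rw [FreePermutad.deriv_ι, chain_ι, map_smul, G.boundary_chain_gen h, ← hσ n h, ← map_smul,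
      ← map_smul, ← G.eq_smul b]
  | @hop n a b r i j s hs x y hx hy =>
    rw [FreePermutad.deriv_op σ r hs h (p' := i - 1) (q' := j - 1) (by ring) (by ring) (by omega)
      (by omega), map_add, map_smul, chain_op, chain_op, chain_op, hx, hy]
    exact (permutohedralChains_leibniz r hs h (by ring) (by ring) (by omega) (by omega)
      (G.chain a i x) (G.chain b j y)).symm
  | hzero => rw [map_zero, map_zero, map_zero, map_zero]
  | hadd n p x y hx hy => rw [map_add, map_add, map_add, map_add, hx, hy]
  | hsmul n p c x hx => rw [map_smul, map_smul, map_smul, map_smul, hx]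

theorem toChains_isDGHom : PreDGPermutad.IsDGHom ⟨freePermutad B, FreePermutad.deriv σ⟩
    (permutohedralChains K) G.toChains := fun _ _ _ h x => G.chain_deriv hσ h x

include G in
theorem permutohedralChains_isDGPermutad : (permutohedralChains K).IsDGPermutad where
  assoc := permutohedralChains_isPermutad
  d_d {n p q s} h h' x := by
    obtain ⟨x, rfl⟩ := (G.toChains_isIso n p).2 x
    have h1 := G.toChains_isDGHom hσ n h x
    have h2 := G.toChains_isDGHom hσ n h' (FreePermutad.deriv σ h x)
    refine (congrArg ((permutohedralChains K).d h') h1.symm).trans (h2.symm.trans ?_)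
    exact (congrArg (G.toChains.map n s) ((G.isDGPermutad hσ).d_d h h' x)).trans (map_zero _)
  leibniz r _ _ _ _ _ _ h hs hp hq h₁ h₂ x y :=
    permutohedralChains_leibniz r h hs hp hq h₁ h₂ x y

omit hσ in
theorem chain_dGen_mem {n : ℕ+} (q : ℤ) :
    G.toChains.map n q (G.dGen n q) ∈
      (permutohedralChains K).toPrePermutad.decomposables n q := by
  have h1 : G.dGen n q ∈ ((freePermutad B).decomposables n q).restrictScalars K := by
    exact Submodule.sum_mem _ fun r _ => Submodule.smul_mem _ _ (Submodule.subset_span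
      ⟨_, _, _, _, _, _, _, _, rfl⟩)
  have h2 : (freePermutad B).decomposables n q ≤
      ((permutohedralChains K).toPrePermutad.decomposables n q).comap (G.toChains.map n q) := by
    rw [PrePermutad.decomposables, Submodule.span_le]
    rintro _ ⟨a, b, r, i, j, h, x, y, rfl⟩
    exact Submodule.subset_span ⟨a, b, r, i, j, h, _, _, G.toChains.map_op r h x y⟩
  exact h2 h1

include hσ in
theorem boundary_toChains_mem {n : ℕ+} {p q : ℤ} (h : q + 1 = p) (b : B.X n p) :
    (permutohedralChains K).d h (G.toChains.map n p (FreePermutad.ι B n p b)) ∈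
      (permutohedralChains K).toPrePermutad.decomposables n q := by
  have h1 : (permutohedralChains K).d h (G.toChains.map n p (FreePermutad.ι B n p b)) =
      G.χ n p b • G.toChains.map n q (G.dGen n q) := by
    refine (G.chain_deriv hσ h (FreePermutad.ι B n p b)).symm.trans ?_
    rw [FreePermutad.deriv_ι]
    conv_lhs => rw [G.eq_smul b, map_smul, hσ, map_smul]
    rfl
  rw [h1]
  exact Submodule.smul_mem _ _ (G.chain_dGen_mem q)

end GeneratorBasis

/-! ### The terminal permutad and the permutohedra -/

theorem theoremA {K : Type*} [Field K] [CharZero K] :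
    -- the dual bar construction of the Koszul dual is isomorphic to the cellular chains
    (perAsPresentation K).koszulDual.permutad.dualBar.IsDGPermutad ∧
    (permutohedralChains K).IsDGPermutad ∧
    PreDGPermutad.Isomorphic (perAsPresentation K).koszulDual.permutad.dualBar
      (permutohedralChains K) ∧
    -- the permutohedra are contractible, and their chains are the minimal model
    (∀ n : ℕ+, ContractibleSpace (permutohedron n)) ∧
    (permutohedralChains K).IsMinimalModel (perAs K).toDG ∧
    -- the terminal permutad is quadratic and Koszul
    (∃ f : PrePermutad.Hom (perAs K) (perAsPresentation K).permutad, f.IsIso) ∧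
    (perAsPresentation K).IsKoszul := by
  obtain ⟨H', -⟩ := perAsPresentation.exists_dual K
  -- one generator in each arity for the dual bar construction of the Koszul dual
  let G := H'.generatorBasis (BinaryQuadratic.koszulDual_deg rfl)
  have hσ : ∀ (n : ℕ+) {p q : ℤ} (h : q + 1 = p),
      (perAsPresentation K).koszulDual.permutad.dual.sigma n h (G.β n p) = G.dGen n q :=
    fun n _ _ h => H'.sigma_β _ n h
  have hchains : (permutohedralChains K).IsDGPermutad := G.permutohedralChains_isDGPermutad hσ
  have hiso : G.toChains.IsIso := G.toChains_isIso
  have hdg : PreDGPermutad.IsDGHom (perAsPresentation K).koszulDual.permutad.dualBar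
      (permutohedralChains K) G.toChains := G.toChains_isDGHom hσ
  have hkoszul := perAsPresentation.isKoszul K
  -- the morphism from the chains to the terminal permutad is the canonical map of the presentation,
  -- transported along `G.toChains` and the isomorphism of the presented permutad with `perAs K`
  have hperAs : PreDGPermutad.IsDGHom (perAsPresentation K).permutad.toDG (perAs K).toDG
      (perAsPresentation.toPerAs K) := fun n p q _ _ => map_zero _
  have hdg' := hdg.inverse hiso
  have hiso' := G.toChains.inverse_isIso hiso
  have hquasi := hkoszul.2.iso_comp hperAs (perAsPresentation.toPerAs_isIso K)
  refine ⟨BinaryQuadratic.dualBar_isDGPermutad H' rfl, hchains, ⟨G.toChains, hiso, hdg⟩,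
    fun n => (Permutohedron.convex n).contractibleSpace (Permutohedron.nonempty n),
    ⟨hchains, ⟨_, G.toChains, hiso, fun n p q h b => G.boundary_toChains_mem hσ h b⟩,
      ((perAsPresentation.toPerAs K).comp (perAsPresentation K).canonicalMap).comp
        (G.toChains.inverse hiso), (hperAs.comp hkoszul.1).comp hdg', hquasi.comp_iso hdg' hiso'⟩,
    ⟨(perAsPresentation.toPerAs K).inverse (perAsPresentation.toPerAs_isIso K),
      (perAsPresentation.toPerAs K).inverse_isIso _⟩, hkoszul⟩
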